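/- Let $\mathbb{K}$ be a field, $\tau$ an automorphism of $\mathbb{K}$ of order $2$, and $V$ an $n$-dimensional unitary space over $\mathbb{K}$, i.e. a $\mathbb{K}$-vector space of dimension $n$ with a form $\Psi : V\times V\to\mathbb{K}$ that is linear in the first argument, Hermitian ($\Psi(v,w)=\tau(\Psi(w,v))$ for all $v,w$) and non-degenerate. Let $\mathcal{G}(V)$ be the graph whose vertices are the $1$-dimensional subspaces of $V$ on which $\Psi$ is non-degenerate, two of them being adjacent if and only if they are orthogonal, and let the frame complex $\mathcal{F}(V)$ be the clique complex of $\mathcal{G}(V)$, whose simplices are the nonempty finite cliques. Homotopy types refer to the geometric realization with the weak topology; $\mathrm{GF}(q^2)$ denotes the field with $q^2$ elements, $q$ a prime power. (i) If $n=3$ and $\mathbb{K}\neq\mathrm{GF}(4)$, then $\mathcal{F}(V)$ is homotopy equivalent to a wedge of a nonempty family of $1$-dimensional spheres. If moreover $\mathbb{K}=\mathrm{GF}(q^2)$, $q\neq 2$, the number of spheres in the wedge is $\frac13\,(q^6-2q^5-q^4+2q^3-3q^2+3)$. (ii) If $n=3$ and $\mathbb{K}=\mathrm{GF}(4)$, then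 $\mathcal{F}(V)$ collapses (by finitely many elementary simplicial collapses) to a discrete complex consisting of $4$ points; in particular it is homotopy equivalent to a wedge of $3$ spheres of dimension $0$. (iii) If $n=2$, then $\mathcal{F}(V)$ is homotopy equivalent to a discrete space. If moreover $\mathbb{K}=\mathrm{GF}(q^2)$, this discrete space has $q(q-1)/2$ points. -/

import Mathlib

universe u v w

noncomputable section

/-! ### Simplicial complexes: realization, clique complexes, collapses -/

namespace PreAbstractSimplicialComplex

variable {α : Type v}

/-- The points of the geometric realization of an abstract simplicial complex `X`, in barycentric
coordinates: finitely supported functions on the vertices with nonnegative values of total sum `1`,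
whose support is a simplex of `X`. -/
def Realization (X : PreAbstractSimplicialComplex α) : Type v :=
  {f : α →₀ ℝ // f.support ∈ X.faces ∧ (∀ a, 0 ≤ f a) ∧ (f.sum fun _ t => t) = 1}

/-- The inclusion of the closed geometric simplex spanned by a simplex `σ` of `X`. -/
def simplexInclusion (X : PreAbstractSimplicialComplex α) (σ : X.faces)
    (x : stdSimplex ℝ σ.1) : X.Realization :=
  ⟨Finsupp.embDomain (Function.Embedding.subtype (· ∈ σ.1)) (Finsupp.equivFunOnFinite.symm x.1), by
    have hsum : ((Finsupp.embDomain (Function.Embedding.subtype (· ∈ σ.1))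
        (Finsupp.equivFunOnFinite.symm x.1)).sum fun _ t => t) = 1 := by
      rw [Finsupp.sum_embDomain, Finsupp.sum_fintype _ _ (fun _ => rfl)]
      exact x.2.2
    refine ⟨(X.isRelLowerSet_faces σ.2).2 ?_ ?_, ?_, hsum⟩
    · intro a ha
      rw [Finsupp.support_embDomain, Finset.mem_map] at ha
      obtain ⟨b, -, rfl⟩ := ha
      exact b.2
    · rw [Finsupp.support_nonempty_iff]
      intro h
      rw [h] at hsum
      simp at hsum
    · intro a
      by_cases ha : a ∈ σ.1
      · have h := Finsupp.embDomain_apply_self (Function.Embedding.subtype (· ∈ σ.1))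
          (Finsupp.equivFunOnFinite.symm x.1) ⟨a, ha⟩
        exact h.symm ▸ x.2.1 ⟨a, ha⟩
      · rw [Finsupp.embDomain_of_notMem_range]
        rintro ⟨b, rfl⟩
        exact ha b.2⟩

/-- The weak (coherent) topology on the geometric realization: a set is open if and only if its
trace on every closed simplex is open in the Euclidean topology of that simplex. -/
instance (X : PreAbstractSimplicialComplex α) : TopologicalSpace X.Realization :=
  ⨆ σ : X.faces, TopologicalSpace.coinduced (X.simplexInclusion σ) inferInstance

/-- `Y` arises from `X` by an elementary collapse: `σ` is a free face of `X`, i.e. there is exactly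
one simplex `τ` of `X` that properly contains `σ` (so `τ` is maximal, of dimension one more), and
the simplices `σ` and `τ` are removed. -/
def ElementaryCollapse (X Y : PreAbstractSimplicialComplex α) : Prop :=
  ∃ σ ∈ X.faces, ∃ τ ∈ X.faces, σ ⊂ τ ∧ (∀ ρ ∈ X.faces, σ ⊂ ρ → ρ = τ) ∧
    Y.faces = X.faces \ {σ, τ}

/-- `X` collapses to `Y`: finitely many elementary collapses lead from `X` to `Y`. -/
def Collapses (X Y : PreAbstractSimplicialComplex α) : Prop :=
  Relation.ReflTransGen ElementaryCollapse X Y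

end PreAbstractSimplicialComplex

/-- The clique complex of a graph: its simplices are the nonempty finite cliques. -/
def SimpleGraph.cliqueComplex {α : Type v} (G : SimpleGraph α) : PreAbstractSimplicialComplex α where
  faces := {s | s.Nonempty ∧ G.IsClique (s : Set α)}
  isRelLowerSet_faces := fun _ hs =>
    ⟨hs.1, fun _ hts ht => ⟨ht, hs.2.subset (Finset.coe_subset.2 hts)⟩⟩

/-! ### Wedges of spheres -/

/-- The identification that defines the wedge of a family of pointed spaces: all base points are
glued to one extra point (which is the whole wedge if the family is empty). -/
inductive WedgeRel {ι : Type v} (X : ι → Type w) (x₀ : ∀ i, X i) :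
    PUnit.{1} ⊕ (Σ i, X i) → PUnit.{1} ⊕ (Σ i, X i) → Prop
  | glue (i : ι) : WedgeRel X x₀ (Sum.inr ⟨i, x₀ i⟩) (Sum.inl PUnit.unit)

/-- The wedge (one-point union) of a family of pointed topological spaces. -/
def Wedge {ι : Type v} (X : ι → Type w) (x₀ : ∀ i, X i) : Type (max v w) :=
  Quot (WedgeRel X x₀)

instance {ι : Type v} (X : ι → Type w) (x₀ : ∀ i, X i) [∀ i, TopologicalSpace (X i)] :
    TopologicalSpace (Wedge X x₀) :=
  inferInstanceAs (TopologicalSpace (Quot (WedgeRel X x₀)))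

/-- The unit sphere of dimension `d` in `ℝ^(d+1)`. -/
abbrev UnitSphere (d : ℕ) : Type :=
  Metric.sphere (0 : EuclideanSpace ℝ (Fin (d + 1))) 1

/-- The base point `(1, 0, …, 0)` of the unit sphere. -/
def UnitSphere.base (d : ℕ) : UnitSphere d :=
  ⟨EuclideanSpace.single 0 1, by simp⟩

/-- The wedge of a family of `d`-dimensional spheres indexed by `ι`. -/
abbrev WedgeOfSpheres (d : ℕ) (ι : Type v) : Type v :=
  Wedge (fun _ : ι => UnitSphere d) (fun _ => UnitSphere.base d)

/-! ### Unitary spaces and the frame complex -/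

section Unitary

variable {K : Type u} {V : Type v} [Field K] [AddCommGroup V] [Module K V] {τ : RingAut K}

/-- The subspace `S` is non-degenerate with respect to the form `Ψ`: its radical is zero. -/
def IsNondegenerateSubspace (Ψ : V →ₗ[K] V →ₛₗ[(τ : K →+* K)] K) (S : Submodule K V) : Prop :=
  ∀ v ∈ S, (∀ w ∈ S, Ψ v w = 0) → v = 0

/-- `(V, Ψ)` is a unitary space: `τ` is a field automorphism of order `2` and `Ψ` is a
non-degenerate Hermitian form with respect to `τ` (linear in the first argument). -/
structure IsUnitary (Ψ : V →ₗ[K] V →ₛₗ[(τ : K →+* K)] K) : Prop where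
  orderOf_eq_two : orderOf τ = 2
  hermitian : ∀ v w, Ψ v w = τ (Ψ w v)
  nondegenerate : IsNondegenerateSubspace Ψ ⊤

/-- The vertices of the orthogonality graph: non-degenerate `1`-dimensional subspaces. -/
def NondegenerateLine (Ψ : V →ₗ[K] V →ₛₗ[(τ : K →+* K)] K) : Type v :=
  {S : Submodule K V // Module.finrank K S = 1 ∧ IsNondegenerateSubspace Ψ S}

variable {Ψ : V →ₗ[K] V →ₛₗ[(τ : K →+* K)] K}

/-- The graph on the non-degenerate `1`-dimensional subspaces in which two of them are adjacent if
and only if they are orthogonal. -/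
def orthogonalityGraph (h : IsUnitary Ψ) : SimpleGraph (NondegenerateLine Ψ) where
  Adj S T := ∀ v ∈ S.1, ∀ w ∈ T.1, Ψ v w = 0
  symm := ⟨fun S T hST v hv w hw => by rw [h.hermitian, hST w hw v hv, map_zero]⟩
  loopless := ⟨fun S hS => by
    have hbot : S.1 = ⊥ := (Submodule.eq_bot_iff _).2 fun v hv => S.2.2 v hv (hS v hv)
    have h1 := S.2.1
    rw [hbot, finrank_bot] at h1
    exact zero_ne_one h1⟩

/-- The frame complex `F(V)`: the clique complex of the orthogonality graph. -/
def frameComplex (h : IsUnitary Ψ) : PreAbstractSimplicialComplex (NondegenerateLine Ψ) :=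
  (orthogonalityGraph h).cliqueComplex

end Unitary

end

/-! ### A criterion for quotient maps to be homotopy equivalences; realizations -/

noncomputable section

open Topology

/-! Every clique of the orthogonality graph extends to an orthogonal frame by Gram–Schmidt, so the
frames are the maximal simplices of the frame complex. In dimension `2` one line determines its
frame, in dimension `3` two orthogonal lines do. Hence the complex is a union of full simplices, the
blocks, any two of which share at most one vertex (`isBlockSystem_frameComplex`).

Such a complex has the homotopy type of the bipartite incidence graph of vertices and blocks, since
a block retracts to the star of legs from its barycenter to its vertices. If this graph is
connected, contracting a spanning tree leaves one circle for every flag (block, vertex) outside the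
tree. This is carried out by a single map `collapse` to the wedge. It is a quotient map, and the
identity of the complex is deformed, compatibly with its fibres, into a map constant on them: first
each block shrinks to its legs, then the legs slide along the tree to the root
(`nonempty_homotopyEquiv_wedge`).

The remainder is Hermitian geometry. In dimension `3`, two lines with non-degenerate span have a
common neighbour. If the span is degenerate, one line is first replaced by a suitable neighbour;
this needs a trace `z + τ z` avoiding two values, which is available unless the field has four
elements (`exists_trace_ne`). Some flag lies outside the tree: for infinite `K` because of an
orthogonal pentagon (`exists_pentagon`), for finite `K` by counting.

For the counts, nonzero fibres of the norm have `q + 1` elements (`card_norm_fibre`). This yields `N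
= q ^ 4 - q ^ 3 + q ^ 2` lines in dimension `3`, each in `(q ^ 2 - q) / 2` frames, and the Euler
characteristic of the incidence graph gives the number of circles. For `q = 2` every line lies in
one frame only: the complex consists of four disjoint triangles, which collapse to points. In
dimension `2` it consists of disjoint edges. -/

/-- A quotient map `f` is a homotopy equivalence if the identity of its source can be deformed,
through maps that respect the fibres of `f`, into a map that is constant on these fibres. -/
theorem Topology.IsQuotientMap.nonempty_homotopyEquiv {X : Type u} {Y : Type v}
    [TopologicalSpace X] [TopologicalSpace Y] {f : C(X, Y)} (hf : IsQuotientMap f) {k : C(X, X)}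
    (h : (ContinuousMap.id X).Homotopy k) (hk : ∀ x y, f x = f y → k x = k y)
    (hh : ∀ t x y, f x = f y → f (h (t, x)) = f (h (t, y))) :
    Nonempty (ContinuousMap.HomotopyEquiv X Y) := by
  let g : C(Y, X) := hf.lift k hk
  have hg : ∀ x, g (f x) = k x := fun x => congrArg (fun m : C(X, X) => m x) (hf.lift_comp k hk)
  let s : Y → X := Function.surjInv hf.surjective
  have hs : ∀ y, f (s y) = y := Function.surjInv_eq hf.surjective
  -- The section `s` need not be continuous. Continuity is tested after composing with `id × f`,
  -- which is still a quotient map because the interval is locally compact; there the choice made by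
  -- `s` disappears by `hh`.
  have hH : Continuous fun p : unitInterval × Y => f (h (p.1, s p.2)) := by
    refine hf.continuous_lift_prod_right ?_
    have : (fun p : unitInterval × X => f (h (p.1, s (f p.2)))) = fun p => f (h (p.1, p.2)) :=
      funext fun p => hh _ _ _ (hs _)
    show Continuous fun p : unitInterval × X => f (h (p.1, s (f p.2)))
    rw [this]
    exact f.continuous.comp h.continuous
  let H : (ContinuousMap.id Y).Homotopy (f.comp g) :=
    { toFun := fun p => f (h (p.1, s p.2))
      continuous_toFun := hH
      map_zero_left := fun y => by simp [hs]
      map_one_left := fun y => by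
        simp only [ContinuousMap.Homotopy.apply_one, ContinuousMap.comp_apply]
        rw [← hg, hs] }
  refine ⟨⟨f, g, ?_, ⟨H.symm⟩⟩⟩
  have : g.comp f = k := ContinuousMap.ext hg
  rw [this]
  exact ⟨h.symm⟩

namespace PreAbstractSimplicialComplex

variable {α : Type v} {X : PreAbstractSimplicialComplex α}

/-- The barycentric coordinates of a point of the realization. -/
def Realization.coord (x : X.Realization) : α →₀ ℝ := x.1

theorem continuous_realization_iff {Y : Type w} [TopologicalSpace Y] {g : X.Realization → Y} :
    Continuous g ↔ ∀ σ : X.faces, Continuous fun y => g (X.simplexInclusion σ y) := by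
  simp only [continuous_iSup_dom, continuous_coinduced_dom]
  rfl

theorem continuous_simplexInclusion (σ : X.faces) : Continuous (X.simplexInclusion σ) :=
  continuous_realization_iff.1 continuous_id σ

theorem simplexInclusion_apply (σ : X.faces) (y : stdSimplex ℝ σ.1) (a : σ.1) :
    (X.simplexInclusion σ y).coord a = y.1 a :=
  Finsupp.embDomain_apply_self (Function.Embedding.subtype (· ∈ σ.1))
          (Finsupp.equivFunOnFinite.symm y.1) a

theorem support_simplexInclusion (σ : X.faces) (y : stdSimplex ℝ σ.1) :
    (X.simplexInclusion σ y).coord.support ⊆ σ.1 := by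
  intro a ha
  simp only [simplexInclusion, Realization.coord, Finsupp.support_embDomain, Finset.mem_map] at ha
  obtain ⟨b, -, rfl⟩ := ha
  exact b.2

namespace Realization

theorem ext {x y : X.Realization} (F : Finset α) (hx : x.coord.support ⊆ F) (hy : y.coord.support ⊆ F)
    (h : ∀ a ∈ F, x.coord a = y.coord a) : x = y := by
  refine Subtype.ext (Finsupp.ext fun a => (?_ : x.coord a = y.coord a))
  by_cases ha : a ∈ F
  · exact h a ha
  · rw [Finsupp.notMem_support_iff.1 fun h => ha (hx h),
      Finsupp.notMem_support_iff.1 fun h => ha (hy h)]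

theorem nonneg (x : X.Realization) (a : α) : 0 ≤ x.coord a := x.2.2.1 a

theorem sum_eq_one (x : X.Realization) {F : Finset α} (hF : x.coord.support ⊆ F) :
    ∑ a ∈ F, x.coord a = 1 := by
  have h : ∑ a ∈ x.coord.support, x.coord a = 1 := x.2.2.2
  rw [← h]
  exact (Finset.sum_subset hF fun a _ ha => Finsupp.notMem_support_iff.1 ha).symm

theorem add_le_one (x : X.Realization) {a b : α} (hab : a ≠ b) : x.coord a + x.coord b ≤ 1 := by
  classical
  have hF : x.coord.support ⊆ insert a (insert b x.coord.support) := fun c hc => by simp [hc]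
  rw [← x.sum_eq_one hF, ← Finset.sum_pair hab]
  exact Finset.sum_le_sum_of_subset_of_nonneg (fun c hc => by simp at hc ⊢; tauto)
    fun c _ _ => x.nonneg c

theorem le_one (x : X.Realization) (a : α) : x.coord a ≤ 1 := by
  classical
  have hF : x.coord.support ⊆ insert a x.coord.support := fun c hc => by simp [hc]
  rw [← x.sum_eq_one hF]
  exact Finset.single_le_sum (f := fun c => x.coord c) (fun c _ => x.nonneg c) (by simp)

theorem mem_support_of_pos (x : X.Realization) {a : α} (ha : 0 < x.coord a) : a ∈ x.coord.support :=
  Finsupp.mem_support_iff.2 ha.ne'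

/-- The coordinates with respect to a simplex that contains the support. -/
def toStdSimplex (x : X.Realization) (F : Finset α) (hF : x.coord.support ⊆ F) : stdSimplex ℝ F :=
  ⟨fun a => x.coord a, fun a => x.nonneg a, by
    exact (Finset.sum_coe_sort F fun a => x.coord a).trans (x.sum_eq_one hF)⟩

theorem simplexInclusion_toStdSimplex (x : X.Realization) (σ : X.faces) (hF : x.coord.support ⊆ σ.1) :
    X.simplexInclusion σ (x.toStdSimplex σ.1 hF) = x :=
  ext σ.1 (support_simplexInclusion _ _) hF fun a ha => simplexInclusion_apply _ _ ⟨a, ha⟩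

/-- Continuity of coordinates is in general too weak for the weak topology; it suffices here because
the image stays in one closed simplex, which is Euclidean. -/
theorem continuous_of_coords {Z : Type w} [TopologicalSpace Z] (g : Z → X.Realization)
    {F : Finset α} (hF : F ∈ X.faces) (hs : ∀ z, (g z).coord.support ⊆ F)
    (hc : ∀ a ∈ F, Continuous fun z => (g z).coord a) : Continuous g := by
  have : g = fun z => X.simplexInclusion ⟨F, hF⟩ ((g z).toStdSimplex F (hs z)) :=
    funext fun z => (simplexInclusion_toStdSimplex _ ⟨F, hF⟩ (hs z)).symm
  rw [this]
  refine (continuous_simplexInclusion _).comp (Continuous.subtype_mk ?_ _)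
  exact continuous_pi fun a => hc a a.2

theorem continuous_coord (a : α) : Continuous fun x : X.Realization => x.coord a := by
  refine continuous_realization_iff.2 fun σ => ?_
  by_cases ha : a ∈ σ.1
  · simp only [simplexInclusion_apply σ _ ⟨a, ha⟩]
    exact (continuous_apply _).comp continuous_subtype_val
  · have : ∀ y, (X.simplexInclusion σ y).coord a = 0 := fun y =>
      Finsupp.notMem_support_iff.1 fun h => ha (support_simplexInclusion _ _ h)
    simp only [this]
    exact continuous_const

/-- The point with given barycentric coordinates in the simplex `F`. -/
def mk (F : Finset α) (hF : F ∈ X.faces) (c : α → ℝ) (h0 : ∀ a ∈ F, 0 ≤ c a)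
    (h1 : ∑ a ∈ F, c a = 1) : X.Realization :=
  X.simplexInclusion ⟨F, hF⟩ ⟨fun a => c a, fun a => h0 a a.2, by
    exact (Finset.sum_coe_sort F c).trans h1⟩

theorem mk_apply {F : Finset α} (hF : F ∈ X.faces) (c : α → ℝ) (h0 : ∀ a ∈ F, 0 ≤ c a)
    (h1 : ∑ a ∈ F, c a = 1) {a : α} (ha : a ∈ F) : (mk F hF c h0 h1).coord a = c a :=
  simplexInclusion_apply ⟨F, hF⟩ _ ⟨a, ha⟩

theorem support_mk {F : Finset α} (hF : F ∈ X.faces) (c : α → ℝ) (h0 : ∀ a ∈ F, 0 ≤ c a)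
    (h1 : ∑ a ∈ F, c a = 1) : (mk F hF c h0 h1).coord.support ⊆ F :=
  support_simplexInclusion _ _

end Realization

/-- The weak topology is a colimit, and products with a locally compact space preserve it: curry to
a map into `C(Z, Y)`, check continuity simplex by simplex, and uncurry. With `Z` the unit interval
this gives the continuity of homotopies. -/
theorem continuous_realization_prod {Z : Type w} {Y : Type*} [TopologicalSpace Z]
    [LocallyCompactSpace Z] [TopologicalSpace Y] {g : X.Realization × Z → Y}
    (h : ∀ σ : X.faces,
      Continuous fun p : stdSimplex ℝ σ.1 × Z => g (X.simplexInclusion σ p.1, p.2)) :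
    Continuous g := by
  have hx : ∀ x, Continuous fun z => g (x, z) := fun x => by
    have := (h ⟨x.coord.support, x.2.1⟩).comp (Continuous.prodMk_right (x.toStdSimplex _ subset_rfl))
    have e := x.simplexInclusion_toStdSimplex ⟨x.coord.support, x.2.1⟩ subset_rfl
    rw [← e]
    exact this
  let G : X.Realization → C(Z, Y) := fun x => ⟨fun z => g (x, z), hx x⟩
  have hG : Continuous G := continuous_realization_iff.2 fun σ =>
    ContinuousMap.continuous_of_continuous_uncurry _ (h σ)
  exact ContinuousMap.continuous_uncurry_of_continuous ⟨G, hG⟩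

end PreAbstractSimplicialComplex
end

/-! ### Straight-line homotopies, block systems and maps glued from legs -/

noncomputable section

open Topology

namespace PreAbstractSimplicialComplex

variable {α : Type v} {X : PreAbstractSimplicialComplex α}

namespace Realization

theorem support_nonempty (x : X.Realization) : x.coord.support.Nonempty :=
  (X.isRelLowerSet_faces x.2.1).1

/-- The point dividing the segment between two points of a common simplex in the ratio
`t : 1 - t`. -/
def lineMap (x y : X.Realization) (t : unitInterval)
    (h : ∃ F ∈ X.faces, x.coord.support ⊆ F ∧ y.coord.support ⊆ F) : X.Realization :=
  ⟨(1 - (t : ℝ)) • x.coord + (t : ℝ) • y.coord, by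
    classical
    obtain ⟨F, hF, hx, hy⟩ := h
    have hs : ((1 - (t : ℝ)) • x.coord + (t : ℝ) • y.coord).support ⊆ F :=
      Finsupp.support_add.trans (Finset.union_subset (Finsupp.support_smul.trans hx)
        (Finsupp.support_smul.trans hy))
    have hsum : (((1 - (t : ℝ)) • x.coord + (t : ℝ) • y.coord).sum fun _ t => t) = 1 := by
      rw [Finsupp.sum_of_support_subset _ hs _ (fun _ _ => rfl)]
      simp only [Finsupp.add_apply, Finsupp.smul_apply, smul_eq_mul, Finset.sum_add_distrib,
        ← Finset.mul_sum, x.sum_eq_one hx, y.sum_eq_one hy]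
      ring
    refine ⟨(X.isRelLowerSet_faces hF).2 hs ?_, fun a => ?_, hsum⟩
    · rw [Finsupp.support_nonempty_iff]
      intro h
      rw [h] at hsum
      simp at hsum
    · have h1 := mul_nonneg (sub_nonneg.2 t.2.2) (x.nonneg a)
      have h2 := mul_nonneg t.2.1 (y.nonneg a)
      simpa using add_nonneg h1 h2⟩

variable (x y : X.Realization) (t : unitInterval)
    (h : ∃ F ∈ X.faces, x.coord.support ⊆ F ∧ y.coord.support ⊆ F)

theorem coord_lineMap (a : α) :
    (lineMap x y t h).coord a = (1 - (t : ℝ)) * x.coord a + t * y.coord a := rfl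

variable {x y} in
theorem support_lineMap {F : Finset α} (hx : x.coord.support ⊆ F) (hy : y.coord.support ⊆ F) :
    (lineMap x y t h).coord.support ⊆ F := by
  classical
  exact Finsupp.support_add.trans (Finset.union_subset (Finsupp.support_smul.trans hx)
        (Finsupp.support_smul.trans hy))

variable {x y t} in
theorem eq_of_coord {x y : X.Realization} (h : ∀ a, x.coord a = y.coord a) : x = y :=
  Subtype.ext (Finsupp.ext h)

/-- The straight path between two points of a common simplex. -/
def segment : Path x y where
  toFun t := lineMap x y t h
  continuous_toFun := by
    obtain ⟨F, hF, hx, hy⟩ := h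
    refine continuous_of_coords _ hF (fun t => support_lineMap t _ hx hy) fun a _ => ?_
    simp only [coord_lineMap]
    fun_prop
  source' := eq_of_coord fun a => by simp [coord_lineMap]
  target' := eq_of_coord fun a => by simp [coord_lineMap]

theorem segment_apply : segment x y h t = lineMap x y t h := rfl

/-- Two maps carry every simplex into a common simplex. -/
def Contiguous (g₀ g₁ : X.Realization → X.Realization) : Prop :=
  ∀ s ∈ X.faces, ∃ F ∈ X.faces, ∀ x : X.Realization, x.coord.support ⊆ s →
      (g₀ x).coord.support ⊆ F ∧ (g₁ x).coord.support ⊆ F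

theorem Contiguous.exists_face {g₀ g₁ : X.Realization → X.Realization} (h : Contiguous g₀ g₁)
    (x : X.Realization) :
    ∃ F ∈ X.faces, (g₀ x).coord.support ⊆ F ∧ (g₁ x).coord.support ⊆ F := by
  obtain ⟨F, hF, hx⟩ := h _ x.2.1
  exact ⟨F, hF, hx x subset_rfl⟩

/-- On a given simplex both maps, and hence all segments between them, stay in one closed simplex
`F`, where the affine formula is visibly continuous. -/
theorem Contiguous.continuous_lineMap {g₀ g₁ : X.Realization → X.Realization}
    (h : Contiguous g₀ g₁) (h₀ : Continuous g₀) (h₁ : Continuous g₁) :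
    Continuous fun p : X.Realization × unitInterval =>
      lineMap (g₀ p.1) (g₁ p.1) p.2 (h.exists_face p.1) := by
  refine continuous_realization_prod fun s => ?_
  obtain ⟨F, hF, hx⟩ := h s.1 s.2
  refine continuous_of_coords _ hF (fun p => support_lineMap _ _
    (hx _ (support_simplexInclusion _ _)).1 (hx _ (support_simplexInclusion _ _)).2) fun a _ => ?_
  simp only [coord_lineMap]
  have h0 : Continuous fun p : stdSimplex ℝ s.1 × unitInterval =>
      (g₀ (X.simplexInclusion s p.1)).coord a :=
    (continuous_coord a).comp (h₀.comp ((continuous_simplexInclusion s).comp continuous_fst))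
  have h1 : Continuous fun p : stdSimplex ℝ s.1 × unitInterval =>
      (g₁ (X.simplexInclusion s p.1)).coord a :=
    (continuous_coord a).comp (h₁.comp ((continuous_simplexInclusion s).comp continuous_fst))
  have ht : Continuous fun p : stdSimplex ℝ s.1 × unitInterval => (p.2 : ℝ) :=
    continuous_subtype_val.comp continuous_snd
  exact ((continuous_const.sub ht).mul h0).add (ht.mul h1)

/-- The straight-line homotopy between two maps that carry every simplex into a common simplex, with
the time as second variable. -/
def straightLineMap (g₀ g₁ : C(X.Realization, X.Realization)) (h : Contiguous g₀ g₁) :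
    C(X.Realization × unitInterval, X.Realization) :=
  ⟨_, h.continuous_lineMap g₀.continuous g₁.continuous⟩

theorem coord_straightLineMap (g₀ g₁ : C(X.Realization, X.Realization)) (h : Contiguous g₀ g₁)
    (p : X.Realization × unitInterval) (a : α) :
    (straightLineMap g₀ g₁ h p).coord a =
      (1 - (p.2 : ℝ)) * (g₀ p.1).coord a + p.2 * (g₁ p.1).coord a := rfl

/-- The straight-line homotopy between two maps that carry every simplex into a common simplex. -/
def straightLine (g₀ g₁ : C(X.Realization, X.Realization)) (h : Contiguous g₀ g₁) :
    g₀.Homotopy g₁ where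
  toContinuousMap := (straightLineMap g₀ g₁ h).comp ContinuousMap.prodSwap
  map_zero_left x := eq_of_coord fun a =>
    (coord_straightLineMap g₀ g₁ h (x, 0) a).trans (by simp)
  map_one_left x := eq_of_coord fun a =>
    (coord_straightLineMap g₀ g₁ h (x, 1) a).trans (by simp)

end Realization

/-- The set `B` of simplices of `X` covers `X`, and two simplices in `B` meet in at most one
vertex: `X` is a union of full simplices glued along vertices. -/
structure IsBlockSystem (X : PreAbstractSimplicialComplex α) (B : Set (Finset α)) : Prop where
  subset_faces : B ⊆ X.faces
  exists_superset : ∀ s ∈ X.faces, ∃ F ∈ B, s ⊆ F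
  eq_of_mem : ∀ F ∈ B, ∀ F' ∈ B, ∀ a b, a ≠ b → a ∈ F → b ∈ F → a ∈ F' → b ∈ F' → F = F'
  two_le_card : ∀ F ∈ B, 2 ≤ F.card
  singleton_mem : ∀ a, {a} ∈ X.faces

namespace IsBlockSystem

variable {B : Set (Finset α)} (hB : X.IsBlockSystem B)

include hB

/-- A block containing the support of a given point. -/
def block (x : X.Realization) : B :=
  ⟨(hB.exists_superset _ x.2.1).choose, (hB.exists_superset _ x.2.1).choose_spec.1⟩

theorem support_subset_block (x : X.Realization) : x.coord.support ⊆ (hB.block x).1 :=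
  (hB.exists_superset _ x.2.1).choose_spec.2

/-- Distinct blocks share at most one vertex, so the block of a point is ambiguous only at vertices.
Constructions that choose a block need to be checked for independence only there. -/
theorem eq_or_exists_coord_eq_one (x : X.Realization) {F F' : B} (hF : x.coord.support ⊆ F.1)
    (hF' : x.coord.support ⊆ F'.1) : F = F' ∨ ∃ a, x.coord a = 1 := by
  by_cases h : F = F'
  · exact Or.inl h
  right
  obtain ⟨a, ha⟩ := x.support_nonempty
  refine ⟨a, ?_⟩
  have hs : x.coord.support ⊆ {a} := fun b hb => by
    rw [Finset.mem_singleton]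
    by_contra hab
    exact h (Subtype.ext (hB.eq_of_mem F F.2 F' F'.2 b a hab (hF hb) (hF ha) (hF' hb) (hF' ha)))
  simpa using x.sum_eq_one hs

/-- The barycenter of a block. -/
def center (F : B) : X.Realization :=
  Realization.mk F.1 (hB.subset_faces F.2) (fun _ => 1 / (F.1.card : ℝ)) (fun _ _ => by positivity)
    (by
      have := hB.two_le_card F F.2
      have : (F.1.card : ℝ) ≠ 0 := by positivity
      simp [this])

theorem coord_center (F : B) {a : α} (ha : a ∈ F.1) :
    (hB.center F).coord a = 1 / (F.1.card : ℝ) :=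
  Realization.mk_apply _ _ _ _ ha

theorem support_center (F : B) : (hB.center F).coord.support ⊆ F.1 :=
  Realization.support_mk _ _ _ _

/-- Blocks are required to have at least two vertices for the sake of this bound: it puts the
barycenter into the central region, on which glued maps are constant for each parameter. -/
theorem coord_center_le (F : B) (a : α) : (hB.center F).coord a ≤ 1 / 2 := by
  by_cases ha : a ∈ F.1
  · rw [hB.coord_center F ha]
    have : (2 : ℝ) ≤ F.1.card := by exact_mod_cast hB.two_le_card F F.2
    exact one_div_le_one_div_of_le (by norm_num) this
  · rw [Finsupp.notMem_support_iff.1 fun h => ha (hB.support_center F h)]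
    norm_num

/-- A vertex as a point of the realization. -/
def vertex (a : α) : X.Realization :=
  Realization.mk {a} (hB.singleton_mem a) (fun _ => 1) (fun _ _ => zero_le_one) (by simp)

theorem support_vertex (a : α) : (hB.vertex a).coord.support ⊆ {a} :=
  Realization.support_mk _ _ _ _

theorem coord_vertex_self (a : α) : (hB.vertex a).coord a = 1 :=
  Realization.mk_apply _ _ _ _ (Finset.mem_singleton_self a)

theorem coord_vertex_of_ne {a b : α} (h : b ≠ a) : (hB.vertex a).coord b = 0 :=
  Finsupp.notMem_support_iff.1 fun hb => h (Finset.mem_singleton.1 (hB.support_vertex a hb))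

end IsBlockSystem

/-- The data from which a map on the realization of a complex with blocks `B`, with parameters
in `Z`, is glued: a map on each of the legs, which join the center of a block to its vertices. -/
structure LegMap (B : Set (Finset α)) (Z : Type u) (Y : Type w) [TopologicalSpace Z]
    [TopologicalSpace Y] where
  leg : B → α → ℝ → Z → Y
  center : B → Z → Y
  vertex : α → Z → Y
  continuous_leg : ∀ F : B, ∀ a ∈ F.1, Continuous fun p : ℝ × Z => leg F a p.1 p.2
  leg_zero : ∀ F : B, ∀ a ∈ F.1, ∀ z, leg F a 0 z = center F z
  leg_one : ∀ F : B, ∀ a ∈ F.1, ∀ z, leg F a 1 z = vertex a z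

namespace LegMap

variable {B : Set (Finset α)} (hB : X.IsBlockSystem B) {Z : Type u} {Y : Type w}
  [TopologicalSpace Z] [TopologicalSpace Y] (ℓ : LegMap B Z Y)

open Classical in
/-- The map on the realization that is obtained from maps on the legs by retracting every block
to its legs. -/
def glue (x : X.Realization) (z : Z) : Y :=
  -- Coordinates sum to `1`, so at most one exceeds `1 / 2` and the chosen vertex is forced. As this
  -- coordinate runs from `1 / 2` to `1`, the leg parameter `2 * x.coord a - 1` runs from the center
  -- to the vertex.
  if h : ∃ a, 1 / 2 < x.coord a then
    ℓ.leg (hB.block x) h.choose (2 * x.coord h.choose - 1) z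
  else ℓ.center (hB.block x) z

variable {x : X.Realization} {F : B} (hF : x.coord.support ⊆ F.1) (z : Z)

include hF

/-- The formula holds for any block containing the support: if that block differs from the chosen
one, the point is a vertex and `leg_one` makes the value independent of the block. At the value `1 /
2` the two branches of `glue` agree by `leg_zero`. -/
theorem glue_of_le {a : α} (ha : 1 / 2 ≤ x.coord a) :
    ℓ.glue hB x z = ℓ.leg F a (2 * x.coord a - 1) z := by
  have hmem : ∀ {b}, 1 / 2 ≤ x.coord b → b ∈ x.coord.support := fun hb =>
    x.mem_support_of_pos (lt_of_lt_of_le (by norm_num) hb)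
  rw [glue]
  rcases hB.eq_or_exists_coord_eq_one x hF (hB.support_subset_block x) with h | ⟨b, hb⟩
  · rw [← h]
    split_ifs with hc
    · have hcs := hc.choose_spec
      by_cases hac : hc.choose = a
      · rw [hac]
      · have := x.add_le_one hac
        linarith
    · have : x.coord a = 1 / 2 := le_antisymm (not_lt.1 fun h => hc ⟨a, h⟩) ha
      rw [this, show (2 * (1 / 2) - 1 : ℝ) = 0 by norm_num, ℓ.leg_zero F a (hF (hmem ha))]
  · have key : ∀ c, 1 / 2 ≤ x.coord c → c = b := fun c hc => by
      by_contra hcb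
      have := x.add_le_one hcb
      linarith
    have hex : ∃ a, 1 / 2 < x.coord a := ⟨b, by rw [hb]; norm_num⟩
    rw [dif_pos hex, key a ha, key _ hex.choose_spec.le, hb, show (2 * 1 - 1 : ℝ) = 1 by norm_num,
      ℓ.leg_one, ℓ.leg_one]
    · exact hF (hmem (by rw [hb]; norm_num))
    · exact hB.support_subset_block x (hmem (by rw [hb]; norm_num))

theorem glue_of_forall_le (h : ∀ a ∈ F.1, x.coord a ≤ 1 / 2) :
    ℓ.glue hB x z = ℓ.center F z := by
  have hex : ¬ ∃ a, 1 / 2 < x.coord a := by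
    rintro ⟨a, ha⟩
    exact absurd (h a (hF (x.mem_support_of_pos (by linarith)))) (not_le.2 ha)
  rw [glue, dif_neg hex]
  rcases hB.eq_or_exists_coord_eq_one x hF (hB.support_subset_block x) with h | ⟨b, hb⟩
  · rw [← h]
  · exact absurd ⟨b, by rw [hb]; norm_num⟩ hex

omit hF

/-- A simplex is covered by finitely many closed sets: the central region, where no coordinate
exceeds `1 / 2`, and for each vertex of its block the region where that coordinate is at least `1 /
2`. On each of them one explicit formula holds. -/
theorem continuous_glue [LocallyCompactSpace Z] :
    Continuous fun p : X.Realization × Z => ℓ.glue hB p.1 p.2 := by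
  classical
  refine continuous_realization_prod fun s => ?_
  obtain ⟨F, hF, hsF⟩ := hB.exists_superset s.1 s.2
  have hsup : ∀ y, (X.simplexInclusion s y).coord.support ⊆ F :=
    fun y => (support_simplexInclusion _ _).trans hsF
  have hcont : ∀ a, Continuous fun p : stdSimplex ℝ s.1 × Z =>
      (X.simplexInclusion s p.1).coord a := fun a =>
    (Realization.continuous_coord a).comp ((continuous_simplexInclusion s).comp continuous_fst)
  let C : Option F → Set (stdSimplex ℝ s.1 × Z) := fun o => match o with
    | none => {p | ∀ a ∈ F, (X.simplexInclusion s p.1).coord a ≤ 1 / 2}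
    | some a => {p | 1 / 2 ≤ (X.simplexInclusion s p.1).coord a}
  refine (locallyFinite_of_finite C).continuous ?_ ?_ ?_
  · refine Set.eq_univ_of_forall fun p => Set.mem_iUnion.2 ?_
    by_cases h : ∃ a : F, 1 / 2 ≤ (X.simplexInclusion s p.1).coord a
    · exact ⟨some h.choose, h.choose_spec⟩
    · push Not at h
      exact ⟨none, fun a ha => (h ⟨a, ha⟩).le⟩
  · rintro (_ | a)
    · simp only [C, Set.ofPred_forall]
      exact isClosed_iInter fun a => isClosed_iInter fun _ =>
        isClosed_le (hcont a) continuous_const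
    · exact isClosed_le continuous_const (hcont a)
  · rintro (_ | ⟨a, ha⟩)
    -- Continuity of `center` is not a field of `LegMap`; it is inherited from any leg of the block
    -- at parameter `0`.
    · obtain ⟨a, ha⟩ : F.Nonempty := (X.isRelLowerSet_faces (hB.subset_faces hF)).1
      have hc : Continuous fun p : stdSimplex ℝ s.1 × Z => ℓ.center ⟨F, hF⟩ p.2 := by
        simp only [← ℓ.leg_zero ⟨F, hF⟩ a ha]
        exact (ℓ.continuous_leg ⟨F, hF⟩ a ha).comp (continuous_const.prodMk continuous_snd)
      exact hc.continuousOn.congr fun p hp =>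
        ℓ.glue_of_forall_le hB (F := ⟨F, hF⟩) (hsup _) _ hp
    · have hc : Continuous fun p : stdSimplex ℝ s.1 × Z =>
          ℓ.leg ⟨F, hF⟩ a (2 * (X.simplexInclusion s p.1).coord a - 1) p.2 :=
        (ℓ.continuous_leg ⟨F, hF⟩ a ha).comp
          (((hcont a).const_mul 2 |>.sub continuous_const).prodMk continuous_snd)
      exact hc.continuousOn.congr fun p hp => ℓ.glue_of_le hB (F := ⟨F, hF⟩) (hsup _) _ hp

end LegMap

end PreAbstractSimplicialComplex
end

/-! ### Wedges and the parametrization of the circle -/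

noncomputable section

open Topology

namespace Wedge

variable {ι : Type v} {X : ι → Type w} {x₀ : ∀ i, X i}

/-- The base point of a wedge. -/
def base : Wedge X x₀ := Quot.mk _ (Sum.inl PUnit.unit)

/-- The inclusion of a summand into a wedge. -/
def incl (i : ι) (x : X i) : Wedge X x₀ := Quot.mk _ (Sum.inr ⟨i, x⟩)

theorem incl_base (i : ι) : (incl i (x₀ i) : Wedge X x₀) = base := Quot.sound (WedgeRel.glue i)

open Classical in
/-- The point of a summand that represents a point of the wedge, if this is not the base point. -/
def label : Wedge X x₀ → Option (Σ i, X i) :=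
  Quot.lift (Sum.elim (fun _ => none) fun p => if p.2 = x₀ p.1 then none else some p) <| by
    rintro _ _ ⟨i⟩
    simp

theorem label_base : label (base : Wedge X x₀) = none := rfl

theorem label_incl {i : ι} {x : X i} (hx : x ≠ x₀ i) :
    label (incl i x : Wedge X x₀) = some ⟨i, x⟩ := if_neg hx

theorem incl_ne_base {i : ι} {x : X i} (hx : x ≠ x₀ i) : (incl i x : Wedge X x₀) ≠ base :=
  fun h => by simpa [label_incl hx, label_base] using congrArg label h

theorem incl_eq_incl {i j : ι} {x : X i} {y : X j} (hx : x ≠ x₀ i)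
    (h : (incl i x : Wedge X x₀) = incl j y) : (⟨i, x⟩ : Σ i, X i) = ⟨j, y⟩ := by
  have hy : y ≠ x₀ j := by
    rintro rfl
    exact incl_ne_base hx (h.trans (incl_base j))
  have := congrArg label h
  rwa [label_incl hx, label_incl hy, Option.some_inj] at this

theorem eq_base_or_incl (z : Wedge X x₀) : z = base ∨ ∃ i x, z = incl i x := by
  rcases z with ⟨⟨⟩ | ⟨i, x⟩⟩
  · exact Or.inl rfl
  · exact Or.inr ⟨i, x, rfl⟩

variable [∀ i, TopologicalSpace (X i)]

theorem continuous_incl (i : ι) : Continuous (incl i : X i → Wedge X x₀) :=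
  continuous_quot_mk.comp (continuous_inr.comp continuous_sigmaMk)

theorem isOpen_iff {U : Set (Wedge X x₀)} : IsOpen U ↔ ∀ i, IsOpen (incl i ⁻¹' U) := by
  refine ⟨fun h i => h.preimage (continuous_incl i), fun h => ?_⟩
  refine isQuotientMap_quot_mk.isOpen_preimage.1 (isOpen_sum_iff.2 ⟨?_, isOpen_sigma_iff.2 h⟩)
  exact isOpen_discrete _

end Wedge

namespace UnitSphere

/-- The standard parametrization of the circle with period `1`. -/
def circle (t : ℝ) : UnitSphere 1 :=
  ⟨!₂[Real.cos (2 * Real.pi * t), Real.sin (2 * Real.pi * t)], by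
    simp [EuclideanSpace.norm_eq, Fin.sum_univ_two]⟩

theorem continuous_circle : Continuous circle := by
  refine Continuous.subtype_mk ?_ _
  refine (PiLp.continuous_toLp 2 _).comp (continuous_pi fun i => ?_)
  fin_cases i <;> simp <;> fun_prop

theorem coe_circle (t : ℝ) :
    (circle t).1 = !₂[Real.cos (2 * Real.pi * t), Real.sin (2 * Real.pi * t)] := rfl

theorem base_eq : (base 1).1 = !₂[(1 : ℝ), 0] := by
  ext i
  fin_cases i <;> simp [base]

theorem circle_zero : circle 0 = base 1 := by
  apply Subtype.ext
  rw [base_eq, coe_circle]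
  simp

theorem circle_one : circle 1 = base 1 := by
  apply Subtype.ext
  rw [base_eq, coe_circle]
  simp

/-- Equal points have parameters differing by an integer. One parameter in the open interval already
makes the difference smaller than `1`; with both in the closed interval, `0` and `1` would be
identified. -/
theorem circle_injOn {s t : ℝ} (hs : s ∈ Set.Ioo (0 : ℝ) 1) (ht : t ∈ Set.Icc (0 : ℝ) 1)
    (h : circle s = circle t) : s = t := by
  have h' := congrArg Subtype.val h
  rw [coe_circle, coe_circle] at h'
  have h0 := congrArg (fun v : EuclideanSpace ℝ (Fin 2) => v 0) h'
  have h1 := congrArg (fun v : EuclideanSpace ℝ (Fin 2) => v 1) h'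
  simp only [Matrix.cons_val_zero, Matrix.cons_val_one] at h0 h1
  obtain ⟨k, hk⟩ := Real.Angle.angle_eq_iff_two_pi_dvd_sub.1 (Real.Angle.cos_sin_inj h0 h1)
  have hk' : s - t = k := by
    have : 2 * Real.pi * (s - t - k) = 0 := by linarith
    have := (mul_eq_zero.1 this).resolve_left (by positivity)
    linarith
  have h1 : (k : ℝ) < 1 := by linarith [hs.2, ht.1]
  have h2 : (-1 : ℝ) < k := by linarith [hs.1, ht.2]
  have h1' : k < 1 := by exact_mod_cast h1
  have h2' : -1 < k := by exact_mod_cast h2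
  have : k = 0 := by lia
  rw [this] at hk'
  push_cast at hk'
  linarith

theorem exists_circle_eq (z : UnitSphere 1) : ∃ t ∈ Set.Icc (0 : ℝ) 1, circle t = z := by
  have hz : z.1 0 ^ 2 + z.1 1 ^ 2 = 1 := by
    have := z.2
    rw [mem_sphere_zero_iff_norm, EuclideanSpace.norm_eq, Real.sqrt_eq_one, Fin.sum_univ_two] at this
    simpa using this
  let c : ℂ := ⟨z.1 0, z.1 1⟩
  have hc : ‖c‖ = 1 := by
    rw [← sq_eq_sq₀ (norm_nonneg _) zero_le_one, ← Complex.normSq_eq_norm_sq, Complex.normSq_mk]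
    linarith
  have hc0 : c ≠ 0 := by
    rw [← norm_pos_iff, hc]
    exact one_pos
  have hcos : Real.cos c.arg = z.1 0 := by rw [Complex.cos_arg hc0, hc, div_one]
  have hsin : Real.sin c.arg = z.1 1 := by rw [Complex.sin_arg, hc, div_one]
  have key : ∀ t : ℝ, Real.cos (2 * Real.pi * t) = z.1 0 → Real.sin (2 * Real.pi * t) = z.1 1 →
      circle t = z := fun t h0 h1 => by
    refine Subtype.ext ?_
    rw [coe_circle]
    ext i
    fin_cases i
    · exact h0
    · exact h1
  have hpi := Real.pi_pos
  have e1 : 2 * Real.pi * (c.arg / (2 * Real.pi)) = c.arg := by field_simp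
  have e2 : 2 * Real.pi * (c.arg / (2 * Real.pi) + 1) = c.arg + 2 * Real.pi := by field_simp
  -- The argument lies in `(-π, π]`; negative values are shifted by one period to land in `[0, 1]`.
  rcases le_or_gt 0 c.arg with h | h
  · refine ⟨c.arg / (2 * Real.pi), ⟨by positivity, ?_⟩, key _ (by rw [e1, hcos]) (by rw [e1, hsin])⟩
    rw [div_le_one (by positivity)]
    linarith [Complex.arg_le_pi c]
  · refine ⟨c.arg / (2 * Real.pi) + 1, ⟨?_, ?_⟩, key _ (by rw [e2, Real.cos_add_two_pi, hcos])
      (by rw [e2, Real.sin_add_two_pi, hsin])⟩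
    · have : -1 ≤ c.arg / (2 * Real.pi) := by
        rw [le_div_iff₀ (by positivity)]
        linarith [Complex.neg_pi_lt_arg c]
      linarith
    · have := div_neg_of_neg_of_pos h (by positivity : 0 < 2 * Real.pi)
      linarith

theorem circle_ne_base {s : ℝ} (hs : s ∈ Set.Ioo (0 : ℝ) 1) : circle s ≠ base 1 := fun h => by
  rw [← circle_zero] at h
  exact hs.1.ne' (circle_injOn hs ⟨le_rfl, zero_le_one⟩ h)

theorem isQuotientMap_circle : IsQuotientMap fun t : unitInterval => circle t :=
  have h : Continuous fun t : unitInterval => circle t :=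
    continuous_circle.comp continuous_subtype_val
  h.isClosedMap.isQuotientMap h fun z => by
    obtain ⟨t, ht, h⟩ := exists_circle_eq z
    exact ⟨⟨t, ht⟩, h⟩

end UnitSphere
end

/-! ### Rooted spanning trees and the deformation of legs along them -/

noncomputable section

open Topology

theorem Path.extend_trans_left {Y : Type w} [TopologicalSpace Y] {x y z : Y} (γ : Path x y)
    (γ' : Path y z) {s : ℝ} (h0 : 0 ≤ s) (h1 : s ≤ 1 / 2) :
    (γ.trans γ').extend s = γ.extend (2 * s) := by
  rw [Path.extend_apply _ (⟨h0, by linarith⟩ : s ∈ unitInterval), Path.trans_apply, dif_pos h1,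
    Path.extend_apply _ (⟨by linarith, by linarith⟩ : 2 * s ∈ unitInterval)]

theorem Path.extend_trans_right {Y : Type w} [TopologicalSpace Y] {x y z : Y} (γ : Path x y)
    (γ' : Path y z) {s : ℝ} (h0 : 1 / 2 ≤ s) (h1 : s ≤ 1) :
    (γ.trans γ').extend s = γ'.extend (2 * s - 1) := by
  rcases h0.eq_or_lt with h | h
  · rw [Path.extend_trans_left γ γ' (by linarith) h.ge, ← h]
    norm_num
  · rw [Path.extend_apply _ (⟨by linarith, h1⟩ : s ∈ unitInterval), Path.trans_apply,
      dif_neg (not_le.2 h),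
      Path.extend_apply _ (⟨by linarith, by linarith⟩ : 2 * s - 1 ∈ unitInterval)]

namespace PreAbstractSimplicialComplex

variable {α : Type v} {X : PreAbstractSimplicialComplex α} {B : Set (Finset α)}

/-- The incidence relation on the disjoint union of the vertices and the blocks. -/
def Incident : α ⊕ B → α ⊕ B → Prop
  | Sum.inl a, Sum.inr F => a ∈ F.1
  | Sum.inr F, Sum.inl a => a ∈ F.1
  | _, _ => False

theorem Incident.symm : ∀ {n m : α ⊕ B}, Incident n m → Incident m n
  | Sum.inl _, Sum.inr _, h => h
  | Sum.inr _, Sum.inl _, h => h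

theorem Incident.of_mem {F : B} {a : α} (h : a ∈ F.1) :
    Incident (Sum.inr F : α ⊕ B) (Sum.inl a) := h

/-- A rooted spanning tree of the incidence graph of vertices and blocks. -/
structure RootedTree (B : Set (Finset α)) where
  root : α ⊕ B
  parent : α ⊕ B → α ⊕ B
  depth : α ⊕ B → ℕ
  incident : ∀ n, n ≠ root → Incident n (parent n)
  depth_lt : ∀ n, n ≠ root → depth (parent n) < depth n

namespace RootedTree

/-- The flag `(F, a)` belongs to the tree. -/
def HasFlag (T : RootedTree B) (F : B) (a : α) : Prop :=
  (Sum.inl a ≠ T.root ∧ T.parent (Sum.inl a) = Sum.inr F) ∨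
    (Sum.inr F ≠ T.root ∧ T.parent (Sum.inr F) = Sum.inl a)

/-- The flags that do not belong to the tree. -/
abbrev Nontree (T : RootedTree B) : Type v :=
  {p : B × α // p.2 ∈ p.1.1 ∧ ¬ T.HasFlag p.1 p.2}

end RootedTree

namespace IsBlockSystem

variable (hB : X.IsBlockSystem B)

include hB

/-- The points of the realization that correspond to vertices and blocks. -/
def node : α ⊕ B → X.Realization := Sum.elim hB.vertex hB.center

theorem exists_block_of_incident {n m : α ⊕ B} (h : Incident n m) :
    ∃ F ∈ B, (hB.node n).coord.support ⊆ F ∧ (hB.node m).coord.support ⊆ F := by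
  rcases n with a | F <;> rcases m with b | F'
  · exact h.elim
  · exact ⟨F', F'.2, (hB.support_vertex a).trans (Finset.singleton_subset_iff.2 h),
      hB.support_center F'⟩
  · exact ⟨F, F.2, hB.support_center F,
      (hB.support_vertex b).trans (Finset.singleton_subset_iff.2 h)⟩
  · exact h.elim

/-- The straight path between the points of incident nodes. -/
def edge {n m : α ⊕ B} (h : Incident n m) : Path (hB.node n) (hB.node m) :=
  Realization.segment _ _ <| by
    obtain ⟨F, hF, h⟩ := hB.exists_block_of_incident h
    exact ⟨F, hB.subset_faces hF, h⟩

theorem coord_edge {n m : α ⊕ B} (h : Incident n m) (t : unitInterval) (a : α) :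
    (hB.edge h t).coord a = (1 - (t : ℝ)) * (hB.node n).coord a + t * (hB.node m).coord a := rfl

theorem edge_symm {n m : α ⊕ B} (h : Incident n m) {s : ℝ} (h0 : 0 ≤ s) (h1 : s ≤ 1) :
    (hB.edge h).extend (1 - s) = (hB.edge h.symm).extend s := by
  rw [Path.extend_apply _ (⟨by linarith, by linarith⟩ : 1 - s ∈ unitInterval),
    Path.extend_apply _ (⟨h0, h1⟩ : s ∈ unitInterval)]
  refine Realization.eq_of_coord fun a => ?_
  rw [coord_edge, coord_edge]
  ring

theorem support_edge {F : B} {a : α} (h : a ∈ F.1) (t : unitInterval) :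
    (hB.edge (Incident.of_mem h) t).coord.support ⊆ F.1 :=
  Realization.support_lineMap _ (by
      obtain ⟨F', hF', h'⟩ := hB.exists_block_of_incident (Incident.of_mem h)
      exact ⟨F', hB.subset_faces hF', h'⟩) (hB.support_center F)
    ((hB.support_vertex a).trans (Finset.singleton_subset_iff.2 h))

/-- A point of a leg is a convex combination of the barycenter and one vertex, so only the
coordinate at that vertex can exceed `1 / 2`. -/
theorem coord_edge_le {F : B} {a : α} (h : a ∈ F.1) (t : unitInterval) {b : α} (hb : b ≠ a) :
    (hB.edge (Incident.of_mem h) t).coord b ≤ 1 / 2 := by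
  rw [coord_edge]
  have h1 : (hB.node (Sum.inr F)).coord b ≤ 1 / 2 := hB.coord_center_le F b
  have h2 : (hB.node (Sum.inl a)).coord b = 0 := hB.coord_vertex_of_ne hb
  have h3 := (hB.node (Sum.inr F)).nonneg b
  have := t.2.1
  have := t.2.2
  rw [h2]
  nlinarith

variable (T : RootedTree B)

open Classical in
/-- The path to the root along the tree. -/
def path (n : α ⊕ B) : Path (hB.node n) (hB.node T.root) :=
  if h : n = T.root then (Path.refl _).cast (congrArg _ h) rfl
  else (hB.edge (T.incident n h)).trans (path (T.parent n))
termination_by T.depth n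
decreasing_by exact T.depth_lt n h

theorem path_root (t : unitInterval) : hB.path T T.root t = hB.node T.root := by
  rw [path, dif_pos rfl]
  rfl

theorem path_of_parent {n m : α ⊕ B} (hn : n ≠ T.root) (hm : T.parent n = m)
    (h : Incident n m) : hB.path T n = (hB.edge h).trans (hB.path T m) := by
  subst hm
  rw [path, dif_neg hn]

/-- The path along a leg, followed by the tree path at its end and preceded by the reversed tree
path at its beginning. -/
def loop {F : B} {a : α} (h : a ∈ F.1) : Path (hB.node T.root) (hB.node T.root) :=
  ((hB.path T (Sum.inr F)).symm.trans
    (hB.edge (Incident.of_mem h))).trans (hB.path T (Sum.inl a))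

open Classical in
/-- The deformation of a leg along the tree that moves its end points to the root. -/
def legDeformation {F : B} {a : α} (h : a ∈ F.1) (l t : ℝ) : X.Realization :=
  -- The tree path of the vertex runs through this leg, from the vertex to the center, during its
  -- first half. The point with leg parameter `l` is therefore met at time `(1 - l) / 2`, and is
  -- pushed on affinely to time `1`.
  if Sum.inl a ≠ T.root ∧ T.parent (Sum.inl a) = Sum.inr F then
    (hB.path T (Sum.inl a)).extend ((1 - l) / 2 + t * (1 - (1 - l) / 2))
  -- The same with the block farther from the root: its path runs through the leg in the opposite
  -- direction, so the starting time is `l / 2`.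
  else if Sum.inr F ≠ T.root ∧ T.parent (Sum.inr F) = Sum.inl a then
    (hB.path T (Sum.inr F)).extend (l / 2 + t * (1 - l / 2))
  -- In the loop the leg occupies `[1/4, 1/2]`, between the reversed path of the center and the path
  -- of the vertex. At time `t` it is stretched over `[(1 - t)/4, (1 + t)/2]`, which is all of `[0,
  -- 1]` at `t = 1`.
  else (hB.loop T h).extend ((1 - l) * (1 - t) / 4 + l * (1 + t) / 2)

variable {F : B} {a : α} (h : a ∈ F.1) {l t : ℝ}

theorem continuous_legDeformation :
    Continuous fun p : ℝ × ℝ => hB.legDeformation T h p.1 p.2 := by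
  unfold legDeformation
  split_ifs
  all_goals
    refine (Path.continuous_extend _).comp ?_
    fun_prop

theorem path_extend_half {n m : α ⊕ B} (hn : n ≠ T.root) (hm : T.parent n = m)
    (h : Incident n m) (h0 : 0 ≤ t) (h1 : t ≤ 1) :
    (hB.path T n).extend (1 / 2 + t * (1 - 1 / 2)) = (hB.path T m).extend t := by
  rw [hB.path_of_parent T hn hm h, Path.extend_trans_right _ _ (by linarith) (by linarith)]
  congr 1
  ring

/-- In all three cases the central end of the leg follows the tree path of the block. The motion of
this end does not depend on the leg, so the deformations of the legs of a block fit together. -/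
theorem legDeformation_zero_left (h0 : 0 ≤ t) (h1 : t ≤ 1) :
    hB.legDeformation T h 0 t = (hB.path T (Sum.inr F)).extend t := by
  unfold legDeformation
  split_ifs with hc hc'
  · rw [sub_zero, hB.path_extend_half T hc.1 hc.2 (Incident.of_mem h).symm h0 h1]
  · norm_num
  · rw [loop, Path.extend_trans_left _ _ (by linarith) (by linarith),
      Path.extend_trans_left _ _ (by linarith) (by linarith), Path.extend_symm_apply]
    congr 1
    ring

theorem legDeformation_one_left (h0 : 0 ≤ t) (h1 : t ≤ 1) :
    hB.legDeformation T h 1 t = (hB.path T (Sum.inl a)).extend t := by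
  unfold legDeformation
  split_ifs with hc hc'
  · norm_num
  · rw [hB.path_extend_half T hc'.1 hc'.2 (Incident.of_mem h) h0 h1]
  · rw [loop, Path.extend_trans_right _ _ (by linarith) (by linarith)]
    congr 1
    ring

theorem legDeformation_zero_right (h0 : 0 ≤ l) (h1 : l ≤ 1) :
    hB.legDeformation T h l 0 = (hB.edge (Incident.of_mem h)).extend l := by
  unfold legDeformation
  split_ifs with hc hc'
  · have h' : Incident (Sum.inl a) (Sum.inr F) := (Incident.of_mem h).symm
    rw [hB.path_of_parent T hc.1 hc.2 h', Path.extend_trans_left _ _ (by linarith) (by linarith),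
      ← hB.edge_symm h' h0 h1]
    congr 1
    ring
  · rw [hB.path_of_parent T hc'.1 hc'.2 (Incident.of_mem h), Path.extend_trans_left _ _ (by linarith) (by linarith)]
    congr 1
    ring
  · rw [loop, Path.extend_trans_left _ _ (by linarith) (by linarith),
      Path.extend_trans_right _ _ (by linarith) (by linarith)]
    congr 1
    ring

theorem legDeformation_one_right (hT : T.HasFlag F a) :
    hB.legDeformation T h l 1 = hB.node T.root := by
  unfold legDeformation
  split_ifs with hc hc'
  · rw [show (1 - l) / 2 + 1 * (1 - (1 - l) / 2) = 1 by ring, Path.extend_one]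
  · rw [show l / 2 + 1 * (1 - l / 2) = 1 by ring, Path.extend_one]
  · exact absurd hT (not_or.2 ⟨hc, hc'⟩)

/-- A leg of the tree never leaves the tree paths while it is deformed, so its image in the wedge
remains the base point. -/
theorem exists_path_eq_legDeformation (hT : T.HasFlag F a) :
    ∃ n s, hB.legDeformation T h l t = hB.path T n s := by
  unfold legDeformation
  split_ifs with hc hc'
  · exact ⟨_, _, rfl⟩
  · exact ⟨_, _, rfl⟩
  · exact absurd hT (not_or.2 ⟨hc, hc'⟩)

variable (F a) in
open Classical in
/-- The deformation of all legs along the tree. -/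
def legDeformations (l : ℝ) (t : unitInterval) : X.Realization :=
  if h : a ∈ F.1 then hB.legDeformation T h l t else hB.center F

theorem legDeformations_eq (t : unitInterval) :
    hB.legDeformations T F a l t = hB.legDeformation T h l t := dif_pos h

theorem continuous_legDeformations (h : a ∈ F.1) :
    Continuous fun p : ℝ × unitInterval => hB.legDeformations T F a p.1 p.2 := by
  have hc : Continuous fun p : ℝ × unitInterval => (p.1, (p.2 : ℝ)) :=
    continuous_fst.prodMk (continuous_subtype_val.comp continuous_snd)
  have := (hB.continuous_legDeformation T h).comp hc
  exact this.congr fun p => (hB.legDeformations_eq T h p.2).symm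

theorem legDeformations_zero (h : a ∈ F.1) (t : unitInterval) :
    hB.legDeformations T F a 0 t = hB.path T (Sum.inr F) t := by
  rw [hB.legDeformations_eq T h, hB.legDeformation_zero_left T h t.2.1 t.2.2, Path.extend_apply]

theorem legDeformations_one (h : a ∈ F.1) (t : unitInterval) :
    hB.legDeformations T F a 1 t = hB.path T (Sum.inl a) t := by
  rw [hB.legDeformations_eq T h, hB.legDeformation_one_left T h t.2.1 t.2.2, Path.extend_apply]

/-- The retraction of the blocks to their legs, followed by a deformation along the tree. -/
def deformationData : LegMap B unitInterval X.Realization where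
  leg F a l t := hB.legDeformations T F a l t
  center F t := hB.path T (Sum.inr F) t
  vertex a t := hB.path T (Sum.inl a) t
  continuous_leg _ _ h := hB.continuous_legDeformations T h
  leg_zero _ _ h t := hB.legDeformations_zero T h t
  leg_one _ _ h t := hB.legDeformations_one T h t

end IsBlockSystem

open Classical in
/-- The map to the wedge of circles that collapses the tree. -/
def RootedTree.collapseData (T : RootedTree B) : LegMap B PUnit.{1} (WedgeOfSpheres 1 T.Nontree) where
  leg F a l _ := if h : a ∈ F.1 ∧ ¬ T.HasFlag F a then
    Wedge.incl (⟨(F, a), h⟩ : T.Nontree) (UnitSphere.circle l) else Wedge.base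
  center _ _ := Wedge.base
  vertex _ _ := Wedge.base
  continuous_leg F a h := by
    by_cases hc : a ∈ F.1 ∧ ¬ T.HasFlag F a
    · simp only [dif_pos hc]
      exact (Wedge.continuous_incl _).comp (UnitSphere.continuous_circle.comp continuous_fst)
    · simp only [dif_neg hc]
      exact continuous_const
  leg_zero F a h _ := by
    split_ifs
    · rw [UnitSphere.circle_zero, Wedge.incl_base]
    · rfl
  leg_one F a h _ := by
    split_ifs
    · rw [UnitSphere.circle_one, Wedge.incl_base]
    · rfl

end PreAbstractSimplicialComplex
end

/-! ### The collapse to the wedge of circles and its fibres -/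

noncomputable section

open Topology

namespace PreAbstractSimplicialComplex

variable {α : Type v} {X : PreAbstractSimplicialComplex α} {B : Set (Finset α)}

theorem Realization.mem_of_half_le {x : X.Realization} {F : Finset α}
    (hF : x.coord.support ⊆ F) {a : α} (ha : 1 / 2 ≤ x.coord a) : a ∈ F :=
  hF (x.mem_support_of_pos (by linarith))

theorem Realization.half_le_cases (x : X.Realization) (F : Finset α) :
    (∀ a ∈ F, x.coord a ≤ 1 / 2) ∨ ∃ a ∈ F, 1 / 2 ≤ x.coord a := by
  by_cases h : ∃ a ∈ F, 1 / 2 ≤ x.coord a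
  · exact Or.inr h
  · push Not at h
    exact Or.inl fun a ha => (h a ha).le

theorem Realization.coord_le_half_of_ne {x : X.Realization} {a : α} (ha : 1 / 2 ≤ x.coord a) :
    ∀ b ≠ a, x.coord b ≤ 1 / 2 := fun b hb => by
  have := x.add_le_one hb
  linarith

/-- A point is in the part of the realization that is collapsed. -/
def RootedTree.InTree (T : RootedTree B) (x : X.Realization) : Prop :=
  ∃ F : B, x.coord.support ⊆ F.1 ∧ ((∀ a ∈ F.1, x.coord a ≤ 1 / 2) ∨
    ∃ a ∈ F.1, 1 / 2 ≤ x.coord a ∧ (T.HasFlag F a ∨ x.coord a = 1))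

namespace IsBlockSystem

variable (hB : X.IsBlockSystem B)

include hB

/-- The retraction of the blocks to their legs. -/
def retractionData : LegMap B PUnit.{1} X.Realization where
  leg F a l _ := open Classical in
    if h : a ∈ F.1 then (hB.edge (Incident.of_mem h)).extend l else hB.center F
  center F _ := hB.center F
  vertex a _ := hB.vertex a
  continuous_leg F a h := by
    simp only [dif_pos h]
    exact (Path.continuous_extend _).comp continuous_fst
  leg_zero F a h _ := by
    rw [dif_pos h, Path.extend_zero]
    rfl
  leg_one F a h _ := by
    rw [dif_pos h, Path.extend_one]
    rfl

/-- The retraction of the realization to the union of the legs. -/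
def retraction : C(X.Realization, X.Realization) where
  toFun x := hB.retractionData.glue hB x PUnit.unit
  continuous_toFun := (hB.retractionData.continuous_glue hB).comp (Continuous.prodMk_left _)

section

variable {x : X.Realization} {F : B} (hF : x.coord.support ⊆ F.1)

include hF

theorem retraction_of_forall_le (h : ∀ a ∈ F.1, x.coord a ≤ 1 / 2) :
    hB.retraction x = hB.center F :=
  hB.retractionData.glue_of_forall_le hB hF _ h

theorem retraction_of_le {a : α} (h : a ∈ F.1) (ha : 1 / 2 ≤ x.coord a) :
    hB.retraction x = (hB.edge (Incident.of_mem h)).extend (2 * x.coord a - 1) :=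
  (hB.retractionData.glue_of_le hB hF _ ha).trans (dif_pos h)

theorem support_retraction : (hB.retraction x).coord.support ⊆ F.1 := by
  rcases x.half_le_cases F.1 with h | ⟨a, h, ha⟩
  · rw [hB.retraction_of_forall_le hF h]
    exact hB.support_center F
  · rw [hB.retraction_of_le hF h ha]
    exact hB.support_edge h _

theorem coord_retraction_le (h : ∀ a ∈ F.1, x.coord a ≤ 1 / 2) (a : α) :
    (hB.retraction x).coord a ≤ 1 / 2 := by
  rw [hB.retraction_of_forall_le hF h]
  exact hB.coord_center_le F a

theorem coord_retraction_le_of_ne {a b : α} (h : a ∈ F.1) (ha : 1 / 2 ≤ x.coord a) (hb : b ≠ a) :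
    (hB.retraction x).coord b ≤ 1 / 2 := by
  rw [hB.retraction_of_le hF h ha]
  exact hB.coord_edge_le h _ hb

end

theorem contiguous_retraction :
    Realization.Contiguous (ContinuousMap.id X.Realization) hB.retraction := by
  intro s hs
  obtain ⟨F, hF, hsF⟩ := hB.exists_superset s hs
  exact ⟨F, hB.subset_faces hF, fun x hx =>
    ⟨hx.trans hsF, hB.support_retraction (F := ⟨F, hF⟩) (hx.trans hsF)⟩⟩

/-- The straight-line homotopy from the identity to the retraction to the legs. -/
def retractionHomotopy : (ContinuousMap.id X.Realization).Homotopy hB.retraction :=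
  Realization.straightLine _ _ hB.contiguous_retraction

theorem coord_retractionHomotopy (t : unitInterval) (x : X.Realization) (a : α) :
    (hB.retractionHomotopy (t, x)).coord a =
      (1 - (t : ℝ)) * x.coord a + t * (hB.retraction x).coord a := rfl

theorem support_retractionHomotopy {x : X.Realization} {F : B} (hF : x.coord.support ⊆ F.1)
    (t : unitInterval) : (hB.retractionHomotopy (t, x)).coord.support ⊆ F.1 :=
  Realization.support_lineMap _ (hB.contiguous_retraction.exists_face x) hF
    (hB.support_retraction hF)

theorem coord_retractionHomotopy_le {t : unitInterval} {x : X.Realization} {a : α}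
    (h : x.coord a ≤ 1 / 2) (h' : (hB.retraction x).coord a ≤ 1 / 2) :
    (hB.retractionHomotopy (t, x)).coord a ≤ 1 / 2 := by
  rw [coord_retractionHomotopy]
  have := t.2.1
  have := t.2.2
  nlinarith

variable (T : RootedTree B)

/-- The map to the wedge of circles that collapses the tree. -/
def collapse : C(X.Realization, WedgeOfSpheres 1 T.Nontree) where
  toFun x := T.collapseData.glue hB x PUnit.unit
  continuous_toFun := (T.collapseData.continuous_glue hB).comp (Continuous.prodMk_left _)

section

variable {x : X.Realization} {F : B} (hF : x.coord.support ⊆ F.1)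

include hF

theorem collapse_of_forall_le (h : ∀ a ∈ F.1, x.coord a ≤ 1 / 2) :
    hB.collapse T x = Wedge.base :=
  T.collapseData.glue_of_forall_le hB hF _ h

/-- Only the other coordinates are bounded, because the retraction homotopy can carry the coordinate
at `a` across `1 / 2`: in a triangle the barycenter has coordinates `1 / 3`. -/
theorem collapse_of_hasFlag {a : α} (hb : ∀ b ≠ a, x.coord b ≤ 1 / 2) (hT : T.HasFlag F a) :
    hB.collapse T x = Wedge.base := by
  by_cases ha : 1 / 2 ≤ x.coord a
  · exact (T.collapseData.glue_of_le hB hF _ ha).trans (dif_neg fun h => h.2 hT)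
  · refine hB.collapse_of_forall_le T hF fun b _ => ?_
    by_cases hba : b = a
    · rw [hba]
      exact (not_le.1 ha).le
    · exact hb b hba

/-- The truncation `max 0` unites the leg region with the central region, where the image is the
base point. The value thus depends on the coordinate at `a` alone. -/
theorem collapse_of_not_hasFlag {a : α} (h : a ∈ F.1) (hb : ∀ b ≠ a, x.coord b ≤ 1 / 2)
    (hT : ¬ T.HasFlag F a) : hB.collapse T x =
      Wedge.incl (⟨(F, a), h, hT⟩ : T.Nontree)
        (UnitSphere.circle (max 0 (2 * x.coord a - 1))) := by
  by_cases ha : 1 / 2 ≤ x.coord a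
  · rw [max_eq_right (by linarith)]
    exact (T.collapseData.glue_of_le hB hF _ ha).trans (dif_pos ⟨h, hT⟩)
  · rw [max_eq_left (by linarith), UnitSphere.circle_zero]
    refine (hB.collapse_of_forall_le T hF fun b _ => ?_).trans
      (Wedge.incl_base (⟨(F, a), h, hT⟩ : T.Nontree)).symm
    by_cases hba : b = a
    · rw [hba]
      exact (not_le.1 ha).le
    · exact hb b hba

end

theorem collapse_of_coord_eq_one {x : X.Realization} {a : α} (ha : x.coord a = 1) :
    hB.collapse T x = Wedge.base := by
  have ha' : 1 / 2 ≤ x.coord a := by rw [ha]; norm_num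
  rw [show hB.collapse T x = _ from
    T.collapseData.glue_of_le hB (hB.support_subset_block x) PUnit.unit ha',
    show 2 * x.coord a - 1 = 1 by rw [ha]; norm_num]
  exact T.collapseData.leg_one _ _
    (Realization.mem_of_half_le (hB.support_subset_block x) ha') _

theorem collapse_of_inTree {x : X.Realization} (hx : T.InTree x) :
    hB.collapse T x = Wedge.base := by
  obtain ⟨F, hF, h | ⟨a, h, ha, hT | h1⟩⟩ := hx
  · exact hB.collapse_of_forall_le T hF h
  · exact hB.collapse_of_hasFlag T hF (Realization.coord_le_half_of_ne ha) hT
  · exact hB.collapse_of_coord_eq_one T h1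

theorem inTree_or (x : X.Realization) : T.InTree x ∨ ∃ i : T.Nontree,
    x.coord.support ⊆ i.1.1.1 ∧ 1 / 2 < x.coord i.1.2 ∧ x.coord i.1.2 < 1 := by
  have hF := hB.support_subset_block x
  rcases x.half_le_cases (hB.block x).1 with h | ⟨a, h, ha⟩
  · exact Or.inl ⟨_, hF, Or.inl h⟩
  by_cases hT : T.HasFlag (hB.block x) a
  · exact Or.inl ⟨_, hF, Or.inr ⟨a, h, ha, Or.inl hT⟩⟩
  by_cases h1 : x.coord a = 1
  · exact Or.inl ⟨_, hF, Or.inr ⟨a, h, ha, Or.inr h1⟩⟩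
  rcases ha.eq_or_lt with ha' | ha'
  · refine Or.inl ⟨_, hF, Or.inl fun b _ => ?_⟩
    by_cases hba : b = a
    · rw [hba, ← ha']
    · exact Realization.coord_le_half_of_ne ha b hba
  · exact Or.inr ⟨⟨(hB.block x, a), h, hT⟩, hF, ha', lt_of_le_of_ne (x.le_one a) h1⟩

theorem collapse_eq_incl {x : X.Realization} (i : T.Nontree) (hF : x.coord.support ⊆ i.1.1.1)
    (ha : 1 / 2 ≤ x.coord i.1.2) :
    hB.collapse T x = Wedge.incl i (UnitSphere.circle (2 * x.coord i.1.2 - 1)) := by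
  rw [hB.collapse_of_not_hasFlag T hF i.2.1 (Realization.coord_le_half_of_ne ha) i.2.2,
    max_eq_right (by linarith)]

/-- The fibres of the collapse: the collapsed part, and the pieces of the blocks on which the
coordinate at the vertex of a flag outside the tree is a constant between `1 / 2` and `1`. -/
theorem collapse_eq_collapse {x y : X.Realization} (h : hB.collapse T x = hB.collapse T y) :
    (T.InTree x ∧ T.InTree y) ∨ ∃ i : T.Nontree, x.coord.support ⊆ i.1.1.1 ∧
      y.coord.support ⊆ i.1.1.1 ∧ 1 / 2 ≤ x.coord i.1.2 ∧ x.coord i.1.2 = y.coord i.1.2 := by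
  have key : ∀ (i : T.Nontree) (z : X.Realization), 1 / 2 < z.coord i.1.2 → z.coord i.1.2 < 1 →
      2 * z.coord i.1.2 - 1 ∈ Set.Ioo (0 : ℝ) 1 := fun i z h0 h1 =>
    ⟨by linarith, by linarith⟩
  rcases hB.inTree_or T x with hx | ⟨i, hi, hi1, hi2⟩ <;>
    rcases hB.inTree_or T y with hy | ⟨j, hj, hj1, hj2⟩
  · exact Or.inl ⟨hx, hy⟩
  · rw [hB.collapse_of_inTree T hx, hB.collapse_eq_incl T j hj hj1.le] at h
    exact absurd h.symm (Wedge.incl_ne_base (UnitSphere.circle_ne_base (key j y hj1 hj2)))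
  · rw [hB.collapse_of_inTree T hy, hB.collapse_eq_incl T i hi hi1.le] at h
    exact absurd h (Wedge.incl_ne_base (UnitSphere.circle_ne_base (key i x hi1 hi2)))
  · rw [hB.collapse_eq_incl T i hi hi1.le, hB.collapse_eq_incl T j hj hj1.le] at h
    have := Wedge.incl_eq_incl (X := fun _ : T.Nontree => UnitSphere 1)
      (x₀ := fun _ => UnitSphere.base 1) (UnitSphere.circle_ne_base (key i x hi1 hi2)) h
    obtain ⟨rfl, h'⟩ := Sigma.mk.inj_iff.1 this
    have := UnitSphere.circle_injOn (key i x hi1 hi2)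
      (Set.Ioo_subset_Icc_self (key i y hj1 hj2)) (eq_of_heq h')
    exact Or.inr ⟨i, hi, hj, hi1.le, by linarith⟩

/-- On the part of a block near the vertex of a non-tree flag, the new coordinate at that vertex is
a function of `t` and the old one, so equal coordinates stay equal. Points of the collapsed part
keep mapping to the base point, vertices being fixed throughout. -/
theorem collapse_retractionHomotopy (t : unitInterval) {x y : X.Realization}
    (h : hB.collapse T x = hB.collapse T y) :
    hB.collapse T (hB.retractionHomotopy (t, x)) =
      hB.collapse T (hB.retractionHomotopy (t, y)) := by
  have hne : ∀ {z : X.Realization} {F : B} {a : α}, z.coord.support ⊆ F.1 → a ∈ F.1 →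
      1 / 2 ≤ z.coord a → ∀ b ≠ a, (hB.retractionHomotopy (t, z)).coord b ≤ 1 / 2 :=
    fun hF h ha b hb => hB.coord_retractionHomotopy_le (Realization.coord_le_half_of_ne ha b hb)
      (hB.coord_retraction_le_of_ne hF h ha hb)
  rcases hB.collapse_eq_collapse T h with ⟨hx, hy⟩ | ⟨i, hx, hy, hi, hxy⟩
  · have key : ∀ z, T.InTree z → hB.collapse T (hB.retractionHomotopy (t, z)) = Wedge.base := by
      rintro z ⟨F, hF, h | ⟨a, h, ha, hT | h1⟩⟩
      · exact hB.collapse_of_forall_le T (hB.support_retractionHomotopy hF t) fun a ha =>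
          hB.coord_retractionHomotopy_le (h a ha) (hB.coord_retraction_le hF h a)
      · exact hB.collapse_of_hasFlag T (hB.support_retractionHomotopy hF t) (hne hF h ha) hT
      · refine hB.collapse_of_coord_eq_one T (a := a) ?_
        rw [coord_retractionHomotopy, hB.retraction_of_le hF h ha, h1,
          show (2 * 1 - 1 : ℝ) = 1 by norm_num, Path.extend_one]
        have : (hB.node (Sum.inl a)).coord a = 1 := hB.coord_vertex_self a
        rw [this]
        ring
    rw [key x hx, key y hy]
  · have hy' : 1 / 2 ≤ y.coord i.1.2 := hxy ▸ hi
    rw [hB.collapse_of_not_hasFlag T (hB.support_retractionHomotopy hx t) i.2.1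
        (hne hx i.2.1 hi) i.2.2,
      hB.collapse_of_not_hasFlag T (hB.support_retractionHomotopy hy t) i.2.1
        (hne hy i.2.1 hy') i.2.2,
      coord_retractionHomotopy, coord_retractionHomotopy, hB.retraction_of_le hx i.2.1 hi,
      hB.retraction_of_le hy i.2.1 hy', hxy]

end IsBlockSystem
end PreAbstractSimplicialComplex
end

/-! ### The homotopy equivalence with a wedge of circles -/

noncomputable section

open Topology

namespace PreAbstractSimplicialComplex

variable {α : Type v} {X : PreAbstractSimplicialComplex α} {B : Set (Finset α)}

namespace IsBlockSystem

variable (hB : X.IsBlockSystem B) (T : RootedTree B)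

include hB

/-- Every circle of the wedge is the image of a path inside the complex, namely half of an edge of
the block ending at the vertex of the flag. Openness in the wedge is tested on the circles, and on a
circle after pulling back to the interval. -/
theorem isQuotientMap_collapse : IsQuotientMap (hB.collapse T) := by
  classical
  have hleg : ∀ i : T.Nontree, ∃ e : unitInterval → X.Realization, Continuous e ∧
      ∀ l, hB.collapse T (e l) = Wedge.incl i (UnitSphere.circle l) := by
    rintro ⟨⟨F, a⟩, ha, hT⟩
    obtain ⟨b, hb, hba⟩ := Finset.exists_mem_ne (hB.two_le_card F F.2) a
    have hex : ∃ s ∈ X.faces, (hB.vertex b).coord.support ⊆ s ∧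
        (hB.vertex a).coord.support ⊆ s :=
      ⟨F.1, hB.subset_faces F.2, (hB.support_vertex b).trans (Finset.singleton_subset_iff.2 hb),
        (hB.support_vertex a).trans (Finset.singleton_subset_iff.2 ha)⟩
    -- On the edge from `b` to `a` the coordinate at `a` is the time; `(1 + l) / 2` inverts the leg
    -- parameter `2 * x.coord a - 1`.
    let half : unitInterval → unitInterval := fun l =>
      ⟨(1 + l) / 2, by linarith [l.2.1], by linarith [l.2.2]⟩
    have hhalf : Continuous half := Continuous.subtype_mk (by fun_prop) _
    refine ⟨fun l => Realization.segment _ _ hex (half l),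
      (Realization.segment _ _ hex).continuous.comp hhalf, fun l => ?_⟩
    have hc : (Realization.segment _ _ hex (half l)).coord a = (1 + (l : ℝ)) / 2 := by
      rw [Realization.segment_apply, Realization.coord_lineMap, hB.coord_vertex_self,
        hB.coord_vertex_of_ne hba.symm]
      simp [half]
    have hs : (Realization.segment _ _ hex (half l)).coord.support ⊆ F.1 :=
      Realization.support_lineMap _ hex
        ((hB.support_vertex b).trans (Finset.singleton_subset_iff.2 hb))
        ((hB.support_vertex a).trans (Finset.singleton_subset_iff.2 ha))
    have := hB.collapse_eq_incl T ⟨⟨F, a⟩, ha, hT⟩ hs (by rw [hc]; linarith [l.2.1])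
    rw [this, hc]
    congr 2
    ring
  refine (isQuotientMap_iff _).2 ⟨isCoinducing_iff.2 fun U => ⟨fun hU => Wedge.isOpen_iff.2 fun i => ?_,
    fun h => h.preimage (map_continuous _)⟩, fun z => ?_⟩
  rotate_left
  · rcases z.eq_base_or_incl with rfl | ⟨i, z, rfl⟩
    · rcases T.root with a | F
      · exact ⟨hB.vertex a, hB.collapse_of_coord_eq_one T (hB.coord_vertex_self a)⟩
      · exact ⟨hB.center F, hB.collapse_of_forall_le T (hB.support_center F) fun a _ =>
          hB.coord_center_le F a⟩
    · obtain ⟨e, -, he⟩ := hleg i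
      obtain ⟨l, hl, rfl⟩ := UnitSphere.exists_circle_eq z
      exact ⟨e ⟨l, hl⟩, he ⟨l, hl⟩⟩
  · obtain ⟨e, hc, he⟩ := hleg i
    refine UnitSphere.isQuotientMap_circle.isOpen_preimage.1 ?_
    convert hU.preimage hc using 1
    ext l
    simp only [Set.mem_preimage, he]

/-- The deformation of the legs along the tree. -/
def deformationMap : C(unitInterval × X.Realization, X.Realization) where
  toFun p := (hB.deformationData T).glue hB p.2 p.1
  continuous_toFun := ((hB.deformationData T).continuous_glue hB).comp continuous_swap

section

variable {x : X.Realization} {F : B} (hF : x.coord.support ⊆ F.1) (t : unitInterval)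

include hF

theorem deformationMap_of_forall_le (h : ∀ a ∈ F.1, x.coord a ≤ 1 / 2) :
    hB.deformationMap T (t, x) = hB.path T (Sum.inr F) t :=
  (hB.deformationData T).glue_of_forall_le hB hF _ h

theorem deformationMap_of_le {a : α} (h : a ∈ F.1) (ha : 1 / 2 ≤ x.coord a) :
    hB.deformationMap T (t, x) = hB.legDeformation T h (2 * x.coord a - 1) t :=
  ((hB.deformationData T).glue_of_le hB hF _ ha).trans (dif_pos h)

end

theorem deformationMap_zero (x : X.Realization) :
    hB.deformationMap T (0, x) = hB.retraction x := by
  have hF := hB.support_subset_block x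
  rcases x.half_le_cases (hB.block x).1 with h | ⟨a, h, ha⟩
  · rw [hB.deformationMap_of_forall_le T hF _ h, hB.retraction_of_forall_le hF h, Path.source]
    rfl
  · rw [hB.deformationMap_of_le T hF _ h ha, hB.retraction_of_le hF h ha]
    exact hB.legDeformation_zero_right T h (by linarith) (by linarith [x.le_one a])

theorem collapse_edge {n m : α ⊕ B} (hn : n ≠ T.root) (hm : T.parent n = m) (h : Incident n m)
    (s : unitInterval) : hB.collapse T (hB.edge h s) = Wedge.base := by
  have key : ∀ (F : B) (a : α) (ha : a ∈ F.1), T.HasFlag F a → ∀ s,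
      hB.collapse T (hB.edge (Incident.of_mem ha) s) = Wedge.base := fun F a ha hT s =>
    hB.collapse_of_hasFlag T (hB.support_edge ha s) (fun b hb => hB.coord_edge_le ha s hb) hT
  rcases n with a | F <;> rcases m with b | F'
  · exact h.elim
  · rw [show hB.edge h s = hB.edge h.symm (unitInterval.symm s) from
      Realization.eq_of_coord fun c => by
        rw [coord_edge, coord_edge, unitInterval.coe_symm_eq]
        ring]
    exact key F' a h (Or.inl ⟨hn, hm⟩) _
  · exact key F b h (Or.inr ⟨hn, hm⟩) s
  · exact h.elim

/-- A tree path consists of points that are collapsed. -/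
theorem collapse_path (n : α ⊕ B) (t : unitInterval) :
    hB.collapse T (hB.path T n t) = Wedge.base := by
  induction hd : T.depth n using Nat.strong_induction_on generalizing n t with
  | _ d ih =>
  by_cases hn : n = T.root
  · rw [hn, path_root]
    rcases T.root with a | F
    · exact hB.collapse_of_coord_eq_one T (hB.coord_vertex_self a)
    · exact hB.collapse_of_forall_le T (hB.support_center F) fun a _ => hB.coord_center_le F a
  rw [hB.path_of_parent T hn rfl (T.incident n hn), Path.trans_apply]
  split_ifs
  · exact hB.collapse_edge T hn rfl _ _
  · exact ih _ (hd ▸ T.depth_lt n hn) _ _ rfl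

theorem exists_path_of_inTree {x : X.Realization} (hx : T.InTree x) (t : unitInterval) :
    (∃ n s, hB.deformationMap T (t, x) = hB.path T n s) ∧
      hB.deformationMap T (1, x) = hB.node T.root := by
  obtain ⟨F, hF, h | ⟨a, h, ha, hT | h1⟩⟩ := hx
  · simp only [hB.deformationMap_of_forall_le T hF _ h]
    exact ⟨⟨_, _, rfl⟩, Path.target _⟩
  · simp only [hB.deformationMap_of_le T hF _ h ha]
    exact ⟨hB.exists_path_eq_legDeformation T h hT, hB.legDeformation_one_right T h hT⟩
  · simp only [hB.deformationMap_of_le T hF _ h ha, h1, show (2 * 1 - 1 : ℝ) = 1 by norm_num,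
      hB.legDeformation_one_left T h t.2.1 t.2.2]
    refine ⟨⟨_, _, rfl⟩, ?_⟩
    exact (hB.legDeformation_one_left T h zero_le_one le_rfl).trans (Path.extend_one _)

/-- Both requirements of the quotient criterion: the collapsed part moves within tree paths and ends
at the root, while on the other fibres the deformation depends only on the flag and the common
coordinate. -/
theorem deformationMap_eq_deformationMap {x y : X.Realization}
    (h : hB.collapse T x = hB.collapse T y) :
    (∀ t, hB.collapse T (hB.deformationMap T (t, x)) =
      hB.collapse T (hB.deformationMap T (t, y))) ∧
      hB.deformationMap T (1, x) = hB.deformationMap T (1, y) := by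
  rcases hB.collapse_eq_collapse T h with ⟨hx, hy⟩ | ⟨i, hx, hy, hi, hxy⟩
  · refine ⟨fun t => ?_, ?_⟩
    · obtain ⟨⟨n, s, h⟩, -⟩ := hB.exists_path_of_inTree T hx t
      obtain ⟨⟨n', s', h'⟩, -⟩ := hB.exists_path_of_inTree T hy t
      rw [h, h', collapse_path, collapse_path]
    · rw [(hB.exists_path_of_inTree T hx 0).2, (hB.exists_path_of_inTree T hy 0).2]
  · have key : ∀ t, hB.deformationMap T (t, x) = hB.deformationMap T (t, y) := fun t => by
      rw [hB.deformationMap_of_le T hx t i.2.1 hi,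
        hB.deformationMap_of_le T hy t i.2.1 (hxy ▸ hi), hxy]
    exact ⟨fun t => by rw [key], key 1⟩

/-- A complex with a block system whose incidence graph has a spanning tree is homotopy equivalent
to a wedge of circles, one for each flag outside the tree. -/
theorem nonempty_homotopyEquiv_wedge :
    Nonempty (ContinuousMap.HomotopyEquiv X.Realization (WedgeOfSpheres 1 T.Nontree)) := by
  let k : C(X.Realization, X.Realization) :=
    (hB.deformationMap T).comp ((ContinuousMap.const _ 1).prodMk (ContinuousMap.id _))
  let H : hB.retraction.Homotopy k :=
    { toContinuousMap := hB.deformationMap T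
      map_zero_left := hB.deformationMap_zero T
      map_one_left := fun _ => rfl }
  refine (hB.isQuotientMap_collapse T).nonempty_homotopyEquiv (hB.retractionHomotopy.trans H)
    (fun x y h => (hB.deformationMap_eq_deformationMap T h).2) fun t x y h => ?_
  rw [ContinuousMap.Homotopy.trans_apply, ContinuousMap.Homotopy.trans_apply]
  split_ifs
  · exact hB.collapse_retractionHomotopy T _ h
  · exact (hB.deformationMap_eq_deformationMap T h).1 _

end IsBlockSystem
end PreAbstractSimplicialComplex
end

/-! ### Spanning trees of the incidence graph: existence, edge count, cycles -/

noncomputable section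

namespace PreAbstractSimplicialComplex

variable {α : Type v} {X : PreAbstractSimplicialComplex α} {B : Set (Finset α)}

/-- The bipartite graph of vertices and blocks. -/
def incidenceGraph (B : Set (Finset α)) : SimpleGraph (α ⊕ B) where
  Adj := Incident
  symm := ⟨fun _ _ => Incident.symm⟩
  loopless := ⟨fun n => by rcases n with a | F <;> exact id⟩

theorem connected_incidenceGraph [Nonempty α] (hne : ∀ F ∈ B, F.Nonempty)
    (h : ∀ a b, Relation.ReflTransGen (fun a b => ∃ F ∈ B, a ∈ F ∧ b ∈ F) a b) :
    (incidenceGraph B).Connected := by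
  obtain ⟨a₀⟩ := ‹Nonempty α›
  have h1 : ∀ a, (incidenceGraph B).Reachable (Sum.inl a₀) (Sum.inl a) := fun a => by
    induction h a₀ a with
    | refl => exact SimpleGraph.Reachable.refl _
    | tail _ h ih =>
      obtain ⟨F, hF, hb, hc⟩ := h
      have e1 : (incidenceGraph B).Adj (Sum.inl _) (Sum.inr ⟨F, hF⟩) := hb
      have e2 : (incidenceGraph B).Adj (Sum.inr ⟨F, hF⟩) (Sum.inl _) := hc
      exact ih.trans (e1.reachable.trans e2.reachable)
  have h2 : ∀ n, (incidenceGraph B).Reachable (Sum.inl a₀) n := by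
    rintro (a | F)
    · exact h1 a
    · obtain ⟨a, ha⟩ := hne F F.2
      have e : (incidenceGraph B).Adj (Sum.inl a) (Sum.inr F) := ha
      exact (h1 a).trans e.reachable
  exact (SimpleGraph.connected_iff_exists_forall_reachable _).2 ⟨_, h2⟩

/-- The breadth-first tree: the depth is the distance to the root, and the parent is the next node
on a shortest walk to it. -/
theorem RootedTree.nonempty_of_connected (h : (incidenceGraph B).Connected) :
    Nonempty (RootedTree B) := by
  obtain ⟨r⟩ := h.nonempty
  have key : ∀ n, ∃ m, n ≠ r → Incident n m ∧
      (incidenceGraph B).dist m r < (incidenceGraph B).dist n r := fun n => by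
    obtain ⟨p, hp⟩ := (h.preconnected n r).exists_walk_length_eq_dist
    cases p with
    | nil => exact ⟨r, fun h => absurd rfl h⟩
    | cons hadj p =>
      refine ⟨_, fun _ => ⟨hadj, ?_⟩⟩
      rw [← hp, SimpleGraph.Walk.length_cons]
      exact Nat.lt_succ_of_le (SimpleGraph.dist_le p)
  choose f hf using key
  exact ⟨⟨r, f, fun n => (incidenceGraph B).dist n r, fun n hn => (hf n hn).1,
    fun n hn => (hf n hn).2⟩⟩

namespace RootedTree

variable (T : RootedTree B)

theorem hasFlag_of_parent {n : α ⊕ B} (hn : n ≠ T.root) : ∃ F a, a ∈ F.1 ∧ T.HasFlag F a ∧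
    ((n = Sum.inl a ∧ T.parent n = Sum.inr F) ∨ (n = Sum.inr F ∧ T.parent n = Sum.inl a)) := by
  have hinc := T.incident n hn
  rcases n with a | F
  · rcases hp : T.parent (Sum.inl a) with b | F
    · rw [hp] at hinc
      exact hinc.elim
    · rw [hp] at hinc
      exact ⟨F, a, hinc, Or.inl ⟨hn, hp⟩, Or.inl ⟨rfl, rfl⟩⟩
  · rcases hp : T.parent (Sum.inr F) with a | F'
    · rw [hp] at hinc
      exact ⟨F, a, hinc, Or.inr ⟨hn, hp⟩, Or.inr ⟨rfl, rfl⟩⟩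
    · rw [hp] at hinc
      exact hinc.elim

theorem not_parent_parent {n : α ⊕ B} {m : α ⊕ B} (hn : n ≠ T.root) (hm : m ≠ T.root)
    (h : T.parent n = m) : T.parent m ≠ n := fun h' => by
  have h1 := T.depth_lt n hn
  have h2 := T.depth_lt m hm
  rw [h] at h1
  rw [h'] at h2
  exact lt_asymm h1 h2

open Classical in
/-- The end of a flag of the tree that is farther from the root. -/
def child (p : {p : B × α // p.2 ∈ p.1.1 ∧ T.HasFlag p.1 p.2}) : {n // n ≠ T.root} :=
  if h : Sum.inl p.1.2 ≠ T.root ∧ T.parent (Sum.inl p.1.2) = Sum.inr p.1.1 then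
    ⟨Sum.inl p.1.2, h.1⟩
  else ⟨Sum.inr p.1.1, (p.2.2.resolve_left h).1⟩

/-- A tree has one edge for every node other than the root, the edge to its parent. Injectivity uses
that a child has only one parent; surjectivity uses that the depth forbids two nodes to be parents
of each other. -/
theorem bijective_child : Function.Bijective T.child := by
  constructor
  · rintro ⟨⟨F, a⟩, ha, hT⟩ ⟨⟨F', a'⟩, ha', hT'⟩ h
    have h' := congrArg Subtype.val h
    unfold child at h'
    dsimp only at h'
    split_ifs at h' with h1 h2 h2
    · have e := Sum.inl_injective h'
      subst e
      have := Sum.inr_injective (h1.2.symm.trans h2.2)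
      subst this
      rfl
    · have e := Sum.inr_injective h'
      subst e
      have := Sum.inl_injective ((hT.resolve_left h1).2.symm.trans (hT'.resolve_left h2).2)
      subst this
      rfl
  · rintro ⟨n, hn⟩
    obtain ⟨F, a, ha, hT, ⟨rfl, h⟩ | ⟨rfl, h⟩⟩ := T.hasFlag_of_parent hn
    · exact ⟨⟨(F, a), ha, hT⟩, dif_pos ⟨hn, h⟩⟩
    · exact ⟨⟨(F, a), ha, hT⟩, dif_neg fun h' => T.not_parent_parent h'.1 hn h'.2 h⟩

/-- The number of flags outside a spanning tree. -/
theorem card_nontree [Finite α] :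
    Finite T.Nontree ∧ Nat.card T.Nontree + (Nat.card α + Nat.card B) =
      Nat.card {p : B × α // p.2 ∈ p.1.1} + 1 := by
  classical
  have : Finite (Finset α) := Finite.of_injective (fun s : Finset α => (s : Set α))
    Finset.coe_injective
  have h1 : Nat.card {n // n ≠ T.root} + 1 = Nat.card α + Nat.card B := by
    rw [← Nat.card_sum, ← Nat.card_congr (Equiv.sumCompl (· ≠ T.root)), Nat.card_sum]
    congr 1
    simp
  have h2 : Nat.card {p : B × α // p.2 ∈ p.1.1} =
      Nat.card {p : B × α // p.2 ∈ p.1.1 ∧ T.HasFlag p.1 p.2} + Nat.card T.Nontree := by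
    rw [← Nat.card_congr (Equiv.sumCompl
      (fun p : {p : B × α // p.2 ∈ p.1.1} => T.HasFlag p.1.1 p.1.2)), Nat.card_sum,
      Nat.card_congr (Equiv.subtypeSubtypeEquivSubtypeInter (fun p : B × α => p.2 ∈ p.1.1)
        fun p => T.HasFlag p.1 p.2),
      Nat.card_congr (Equiv.subtypeSubtypeEquivSubtypeInter (fun p : B × α => p.2 ∈ p.1.1)
        fun p => ¬ T.HasFlag p.1 p.2)]
  have h3 := Nat.card_eq_of_bijective _ T.bijective_child
  exact ⟨inferInstance, by lia⟩

/-- A closed walk without backtracking is not contained in a tree. -/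
theorem nonempty_nontree_of_cycle {ι : Type w} [Finite ι] [Nonempty ι] (s : ι → ι)
    (hs : Function.Surjective s) (v : ι → α) (F : ι → B) (h₁ : ∀ i, v i ∈ (F i).1)
    (h₂ : ∀ i, v (s i) ∈ (F i).1) (hv : ∀ i, v i ≠ v (s i)) (hF : ∀ i, F i ≠ F (s i)) :
    Nonempty T.Nontree := by
  by_contra hne
  have hT : ∀ F a, a ∈ F.1 → T.HasFlag F a := fun F a ha => by
    by_contra h
    exact hne ⟨⟨(F, a), ha, h⟩⟩
  -- At a deepest vertex of the walk the blocks before and after are distinct, so at most one of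
  -- them is its parent. The other is its child, and by `key` every further vertex of that block is
  -- deeper still, including one on the walk.
  obtain ⟨j, hj⟩ := Finite.exists_max fun i => T.depth (Sum.inl (v i))
  obtain ⟨i, rfl⟩ := hs j
  have key : ∀ F a b, a ∈ F.1 → b ∈ F.1 → b ≠ a → Sum.inr F ≠ T.root →
      T.parent (Sum.inr F) = Sum.inl a → T.depth (Sum.inl a) < T.depth (Sum.inl b) := by
    intro F a b ha hb hab hF hp
    obtain ⟨h, h'⟩ := (hT F b hb).resolve_right fun h =>
      hab (Sum.inl_injective (h.2.symm.trans hp))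
    have e1 := T.depth_lt _ h
    have e2 := T.depth_lt _ hF
    rw [h'] at e1
    rw [hp] at e2
    exact e2.trans e1
  rcases hT (F i) (v (s i)) (h₂ i) with ⟨-, h⟩ | ⟨hr, h⟩
  · rcases hT (F (s i)) (v (s i)) (h₁ (s i)) with ⟨-, h'⟩ | ⟨hr, h'⟩
    · exact hF i (Sum.inr_injective (h.symm.trans h'))
    · exact absurd (hj (s (s i))) (not_le.2 (key _ _ _ (h₁ _) (h₂ _) (hv _).symm hr h'))
  · exact absurd (hj i) (not_le.2 (key _ _ _ (h₂ _) (h₁ _) (hv _) hr h))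

end RootedTree

end PreAbstractSimplicialComplex
end

/-! ### Disjoint simplices: discrete homotopy type and collapses -/

noncomputable section

open Topology

namespace PreAbstractSimplicialComplex

variable {α : Type v} {X : PreAbstractSimplicialComplex α} {B : Set (Finset α)}

/-- A union of pairwise disjoint simplices is homotopy equivalent to the discrete space of these
simplices. -/
theorem IsBlockSystem.nonempty_homotopyEquiv_discrete (hB : X.IsBlockSystem B)
    (hd : ∀ F ∈ B, ∀ F' ∈ B, ∀ a, a ∈ F → a ∈ F' → F = F') [TopologicalSpace B]
    [DiscreteTopology B] : Nonempty (ContinuousMap.HomotopyEquiv X.Realization B) := by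
  have hblock : ∀ (x : X.Realization) (F : B), x.coord.support ⊆ F.1 → hB.block x = F :=
    fun x F hF => by
      obtain ⟨a, ha⟩ := x.support_nonempty
      exact Subtype.ext (hd _ (hB.block x).2 _ F.2 a (hB.support_subset_block x ha) (hF ha))
  have hc : Continuous hB.block := continuous_realization_iff.2 fun s => by
    obtain ⟨F, hF, hs⟩ := hB.exists_superset s.1 s.2
    have : (fun y => hB.block (X.simplexInclusion s y)) = fun _ => ⟨F, hF⟩ :=
      funext fun y => hblock _ _ ((support_simplexInclusion s y).trans hs)
    rw [this]
    exact continuous_const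
  have hcenter : ∀ F, hB.block (hB.center F) = F := fun F => hblock _ _ (hB.support_center F)
  let f : C(X.Realization, B) := ⟨hB.block, hc⟩
  let k : C(X.Realization, X.Realization) :=
    ⟨fun x => hB.center (hB.block x), (continuous_of_discreteTopology (f := hB.center)).comp hc⟩
  have hk : Realization.Contiguous (ContinuousMap.id X.Realization) k := fun s hs => by
    obtain ⟨F, hF, hsF⟩ := hB.exists_superset s hs
    refine ⟨F, hB.subset_faces hF, fun x hx => ⟨hx.trans hsF, ?_⟩⟩
    have : k x = hB.center ⟨F, hF⟩ := congrArg hB.center (hblock x ⟨F, hF⟩ (hx.trans hsF))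
    rw [this]
    exact hB.support_center _
  have hf : IsQuotientMap f := (isQuotientMap_iff _).2 ⟨isCoinducing_iff.2 fun U =>
    ⟨fun _ => isOpen_discrete U, fun h => h.preimage hc⟩, fun F => ⟨hB.center F, hcenter F⟩⟩
  refine hf.nonempty_homotopyEquiv (Realization.straightLine _ k hk)
    (fun x y h => congrArg hB.center h) fun t x y h => ?_
  have key : ∀ x, f (Realization.straightLine _ k hk (t, x)) = f x := fun x => by
    refine hblock _ _ (Realization.support_lineMap _ (hk.exists_face x)
      (hB.support_subset_block x) (hB.support_center _))
  rw [key, key, h]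

/-- The complex that remains when a free face and the simplex above it are removed. -/
def removePair (X : PreAbstractSimplicialComplex α) {s t : Finset α} (hst : s ⊂ t)
    (h : ∀ r ∈ X.faces, s ⊂ r → r = t) : PreAbstractSimplicialComplex α where
  faces := X.faces \ {s, t}
  isRelLowerSet_faces := by
    rintro r ⟨hr, hr'⟩
    simp only [Set.mem_insert_iff, Set.mem_singleton_iff, not_or] at hr'
    refine ⟨(X.isRelLowerSet_faces hr).1, fun r' hrr' hne => ⟨(X.isRelLowerSet_faces hr).2 hrr' hne,
      ?_⟩⟩
    rintro (rfl | rfl)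
    · exact hr'.2 (h r hr (lt_of_le_of_ne hrr' (Ne.symm hr'.1)))
    · exact hr'.2 (h r hr (lt_of_lt_of_le hst hrr'))

theorem elementaryCollapse_removePair (X : PreAbstractSimplicialComplex α) {s t : Finset α}
    (hs : s ∈ X.faces) (ht : t ∈ X.faces) (hst : s ⊂ t) (h : ∀ r ∈ X.faces, s ⊂ r → r = t) :
    X.ElementaryCollapse (X.removePair hst h) :=
  ⟨s, hs, t, ht, hst, h, rfl⟩

/-- The subcomplex of the simplices that contain no vertex in a given set. -/
def deleteVertices (X : PreAbstractSimplicialComplex α) (D : Set α) :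
    PreAbstractSimplicialComplex α where
  faces := {s | s ∈ X.faces ∧ ∀ a ∈ s, a ∉ D}
  isRelLowerSet_faces := fun _ hs => ⟨(X.isRelLowerSet_faces hs.1).1, fun _ ht hne =>
    ⟨(X.isRelLowerSet_faces hs.1).2 ht hne, fun a ha => hs.2 a (ht ha)⟩⟩

theorem _root_.Finset.eq_of_subset_triple [DecidableEq α] {a b c : α} (hab : a ≠ b) (hac : a ≠ c)
    (hbc : b ≠ c) {s : Finset α} (hs : s ⊆ {a, b, c}) (h : b ∈ s ∨ c ∈ s) :
    s = {b} ∨ s = {c} ∨ s = {a, b} ∨ s = {a, c} ∨ s = {b, c} ∨ s = {a, b, c} := by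
  have hext : ∀ t : Finset α, t ⊆ {a, b, c} → (a ∈ s ↔ a ∈ t) → (b ∈ s ↔ b ∈ t) →
      (c ∈ s ↔ c ∈ t) → s = t := fun t ht h1 h2 h3 => by
    ext x
    constructor
    · intro hx
      have := hs hx
      simp only [Finset.mem_insert, Finset.mem_singleton] at this
      rcases this with rfl | rfl | rfl <;> tauto
    · intro hx
      have := ht hx
      simp only [Finset.mem_insert, Finset.mem_singleton] at this
      rcases this with rfl | rfl | rfl <;> tauto
  have hba := hab.symm
  have hca := hac.symm
  have hcb := hbc.symm
  by_cases ha : a ∈ s <;> by_cases hb : b ∈ s <;> by_cases hc : c ∈ s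
  · exact Or.inr (Or.inr (Or.inr (Or.inr (Or.inr (hext _ subset_rfl (by simp [*]) (by simp [*])
      (by simp [*]))))))
  · exact Or.inr (Or.inr (Or.inl (hext _ (by simp [Finset.insert_subset_iff]) (by simp [*])
      (by simp [*]) (by simp [*]))))
  · exact Or.inr (Or.inr (Or.inr (Or.inl (hext _ (by simp [Finset.insert_subset_iff])
      (by simp [*]) (by simp [*]) (by simp [*])))))
  · tauto
  · exact Or.inr (Or.inr (Or.inr (Or.inr (Or.inl (hext _ (by simp) (by simp [*])
      (by simp [*]) (by simp [*]))))))
  · exact Or.inl (hext _ (by simp) (by simp [*]) (by simp [*]) (by simp [*]))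
  · exact Or.inr (Or.inl (hext _ (by simp) (by simp [*]) (by simp [*]) (by simp [*])))
  · tauto

/-- A triangle that meets the rest of the complex in at most one vertex collapses to this
vertex. -/
theorem collapses_of_triangle [DecidableEq α] (X Y : PreAbstractSimplicialComplex α) {a b c : α}
    (hab : a ≠ b) (hac : a ≠ c) (hbc : b ≠ c) (h : {a, b, c} ∈ X.faces)
    (hX : ∀ s ∈ X.faces, b ∈ s ∨ c ∈ s → s ⊆ {a, b, c})
    (hY : ∀ s, s ∈ Y.faces ↔ s ∈ X.faces ∧ b ∉ s ∧ c ∉ s) : X.Collapses Y := by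
  have hba := hab.symm
  have hca := hac.symm
  have hcb := hbc.symm
  have hsub : ∀ s, s ⊆ {a, b, c} → s.Nonempty → s ∈ X.faces :=
    fun s hs hne => (X.isRelLowerSet_faces h).2 hs hne
  have hcases := fun s hs hbc' => Finset.eq_of_subset_triple hab hac hbc (hX s hs hbc') hbc'
  have hmem : ∀ {s t : Finset α}, s ⊆ t → ∀ x, x ∈ t → x ∉ s → s ⊂ t := fun hst x hx hx' =>
    Finset.ssubset_iff_subset_ne.2 ⟨hst, fun h => hx' (h ▸ hx)⟩
  -- Three elementary collapses: the edge `{b, c}` is free in the triangle; once both are gone,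
  -- `{b}` is free in `{a, b}` and then `{c}` in `{a, c}`.
  have hst₁ : ({b, c} : Finset α) ⊂ {a, b, c} := hmem (by simp) a (by simp) (by simp [*])
  have h₁ : ∀ r ∈ X.faces, {b, c} ⊂ r → r = {a, b, c} := fun r hr hlt => by
    have hb : b ∈ r := hlt.1 (by simp)
    have hc : c ∈ r := hlt.1 (by simp)
    have hne := hlt.ne
    clear hst₁ hlt
    rcases hcases r hr (Or.inl hb) with rfl | rfl | rfl | rfl | rfl | rfl <;> simp [*] at hb hc hne ⊢
  let X₁ := X.removePair hst₁ h₁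
  have hX₁ : ∀ s, s ∈ X₁.faces ↔ s ∈ X.faces ∧ s ≠ {b, c} ∧ s ≠ {a, b, c} := fun s => by
    simp [X₁, removePair]
  have hst₂ : ({b} : Finset α) ⊂ {a, b} := hmem (by simp) a (by simp) (by simp [*])
  have h₂ : ∀ r ∈ X₁.faces, {b} ⊂ r → r = {a, b} := fun r hr hlt => by
    rw [hX₁] at hr
    have hb : b ∈ r := hlt.1 (by simp)
    have hne := hlt.ne
    obtain ⟨hr, hr₁, hr₂⟩ := hr
    rcases hcases r hr (Or.inl hb) with h | h | h | h | h | h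
    · exact absurd h.symm hne
    · rw [h] at hb
      exact absurd (Finset.mem_singleton.1 hb) hbc
    · exact h
    · rw [h] at hb
      simp [*] at hb
    · exact absurd h hr₁
    · exact absurd h hr₂
  let X₂ := X₁.removePair hst₂ h₂
  have hX₂ : ∀ s, s ∈ X₂.faces ↔ s ∈ X₁.faces ∧ s ≠ {b} ∧ s ≠ {a, b} := fun s => by
    simp [X₂, removePair]
  have hst₃ : ({c} : Finset α) ⊂ {a, c} := hmem (by simp) a (by simp) (by simp [*])
  have h₃ : ∀ r ∈ X₂.faces, {c} ⊂ r → r = {a, c} := fun r hr hlt => by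
    rw [hX₂, hX₁] at hr
    have hc : c ∈ r := hlt.1 (by simp)
    obtain ⟨⟨hr, hr₁, hr₂⟩, hr₃, hr₄⟩ := hr
    rcases hcases r hr (Or.inr hc) with h | h | h | h | h | h
    · exact absurd h hr₃
    · exact absurd h.symm hlt.ne
    · exact absurd h hr₄
    · exact h
    · exact absurd h hr₁
    · exact absurd h hr₂
  let X₃ := X₂.removePair hst₃ h₃
  have hX₃ : ∀ s, s ∈ X₃.faces ↔ s ∈ X₂.faces ∧ s ≠ {c} ∧ s ≠ {a, c} := fun s => by
    simp [X₃, removePair]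
  have hYX : Y = X₃ := by
    refine PreAbstractSimplicialComplex.ext (Set.ext fun s => ?_)
    rw [hY, hX₃, hX₂, hX₁]
    constructor
    · rintro ⟨hs, hb, hc⟩
      refine ⟨⟨⟨hs, ?_, ?_⟩, ?_, ?_⟩, ?_, ?_⟩ <;> rintro rfl <;> simp at hb hc
    · rintro ⟨⟨⟨hs, h1, h2⟩, h3, h4⟩, h5, h6⟩
      have : ¬ (b ∈ s ∨ c ∈ s) := fun h => by
        rcases hcases s hs h with h | h | h | h | h | h <;> contradiction
      exact ⟨hs, not_or.1 this⟩
  have hne : ∀ {s t : Finset α} (x), x ∈ s → x ∉ t → s ≠ t := fun x hx hx' h => hx' (h ▸ hx)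
  have hne' : ∀ {s t : Finset α} (x), x ∉ s → x ∈ t → s ≠ t := fun x hx hx' h => hx (h ▸ hx')
  rw [hYX]
  refine ((Relation.ReflTransGen.single (X.elementaryCollapse_removePair
    (hsub _ hst₁.1 (by simp)) h hst₁ h₁)).tail (X₁.elementaryCollapse_removePair ?_ ?_ hst₂ h₂)).tail
    (X₂.elementaryCollapse_removePair ?_ ?_ hst₃ h₃)
  · rw [hX₁]
    exact ⟨hsub _ (by simp) (by simp), hne' c (by simp [*]) (by simp), hne' c (by simp [*]) (by simp)⟩
  · rw [hX₁]
    exact ⟨hsub _ (by simp [Finset.insert_subset_iff]) (by simp), hne' c (by simp [*]) (by simp),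
      hne' c (by simp [*]) (by simp)⟩
  · rw [hX₂, hX₁]
    exact ⟨⟨hsub _ (by simp) (by simp), hne' b (by simp [*]) (by simp),
      hne' b (by simp [*]) (by simp)⟩, hne' b (by simp [*]) (by simp),
      hne' b (by simp [*]) (by simp)⟩
  · rw [hX₂, hX₁]
    exact ⟨⟨hsub _ (by simp [Finset.insert_subset_iff]) (by simp), hne' b (by simp [*]) (by simp),
      hne' b (by simp [*]) (by simp)⟩, hne' b (by simp [*]) (by simp),
      hne' b (by simp [*]) (by simp)⟩

/-- A finite union of pairwise disjoint triangles collapses to a discrete complex with one vertex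
in each of the triangles. -/
theorem IsBlockSystem.exists_collapses (hB : X.IsBlockSystem B)
    (hd : ∀ F ∈ B, ∀ F' ∈ B, ∀ a, a ∈ F → a ∈ F' → F = F') (hfin : B.Finite)
    (hcard : ∀ F ∈ B, F.card = 3) :
    ∃ Y, X.Collapses Y ∧ (∀ s ∈ Y.faces, s.card = 1) ∧ Y.faces.ncard = B.ncard := by
  classical
  have hp : ∀ F : B, ∃ a b c, F.1 = {a, b, c} ∧ a ≠ b ∧ a ≠ c ∧ b ≠ c := fun F => by
    obtain ⟨a, b, c, hab, hac, hbc, h⟩ := Finset.card_eq_three.1 (hcard F F.2)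
    exact ⟨a, b, c, h, hab, hac, hbc⟩
  choose a b c habc hab hac hbc using hp
  have hmema : ∀ F : B, a F ∈ F.1 := fun F => by
    have : a F ∈ ({a F, b F, c F} : Finset α) := Finset.mem_insert_self _ _
    rwa [← habc] at this
  -- Induction on the set of triangles already collapsed. Describing each intermediate complex by
  -- the deleted vertices keeps it explicit, and disjointness ensures that the next triangle is
  -- still intact.
  have key : ∀ S : Set (Finset α), S.Finite → S ⊆ B →
      X.Collapses (X.deleteVertices {x | ∃ F : B, F.1 ∈ S ∧ (x = b F ∨ x = c F)}) := by
    intro S hS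
    induction S, hS using Set.Finite.induction_on with
    | empty =>
      intro _
      have : X.deleteVertices {x | ∃ F : B, F.1 ∈ (∅ : Set (Finset α)) ∧ (x = b F ∨ x = c F)} = X :=
        PreAbstractSimplicialComplex.ext (by simp [deleteVertices])
      rw [this]
      exact Relation.ReflTransGen.refl
    | @insert F S hFS _ ih =>
      intro hFB
      refine (ih fun _ h => hFB (Set.mem_insert_of_mem _ h)).trans ?_
      have hF : F ∈ B := hFB (Set.mem_insert _ _)
      have hmem : ∀ {x}, x ∈ F ↔ x = a ⟨F, hF⟩ ∨ x = b ⟨F, hF⟩ ∨ x = c ⟨F, hF⟩ := fun {x} => by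
        have := congrArg (x ∈ ·) (habc ⟨F, hF⟩)
        simpa using this
      refine collapses_of_triangle _ _ (hab ⟨F, hF⟩) (hac ⟨F, hF⟩) (hbc ⟨F, hF⟩) ?_ ?_ fun s => ?_
      · rw [← habc]
        refine ⟨hB.subset_faces hF, ?_⟩
        rintro x hx ⟨F', hF', hx'⟩
        have : x ∈ F'.1 := by
          rw [habc F']
          rcases hx' with h | h <;> simp [h]
        have := hd F hF F' F'.2 x hx this
        exact hFS (this ▸ hF')
      · rintro s ⟨hs, -⟩ hbc'
        obtain ⟨F', hF', hsF'⟩ := hB.exists_superset s hs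
        rw [← habc]
        suffices F = F' by exact this ▸ hsF'
        rcases hbc' with h | h
        · exact hd F hF F' hF' _ (hmem.2 (Or.inr (Or.inl rfl))) (hsF' h)
        · exact hd F hF F' hF' _ (hmem.2 (Or.inr (Or.inr rfl))) (hsF' h)
      · constructor
        · rintro ⟨hs, h⟩
          exact ⟨⟨hs, fun x hx ⟨F', hF', h'⟩ => h x hx ⟨F', Set.mem_insert_of_mem _ hF', h'⟩⟩,
            fun hb => h _ hb ⟨⟨F, hF⟩, Set.mem_insert _ _, Or.inl rfl⟩,
            fun hb => h _ hb ⟨⟨F, hF⟩, Set.mem_insert _ _, Or.inr rfl⟩⟩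
        · rintro ⟨⟨hs, h⟩, hb, hc⟩
          refine ⟨hs, ?_⟩
          rintro x hx ⟨F', hF' | hF', h'⟩
          · have : F' = ⟨F, hF⟩ := Subtype.ext hF'
            subst this
            rcases h' with rfl | rfl
            · exact hb hx
            · exact hc hx
          · exact h x hx ⟨F', hF', h'⟩
  refine ⟨_, key B hfin subset_rfl, ?_⟩
  have hfaces : ∀ s, s ∈ (X.deleteVertices {x | ∃ F : B, F.1 ∈ B ∧ (x = b F ∨ x = c F)}).faces ↔
      ∃ F : B, s = {a F} := by
    intro s
    constructor
    · rintro ⟨hs, h⟩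
      obtain ⟨F, hF, hsF⟩ := hB.exists_superset s hs
      refine ⟨⟨F, hF⟩, ?_⟩
      have hne := (X.isRelLowerSet_faces hs).1
      refine (Finset.subset_singleton_iff.1 fun x hx => ?_).resolve_left hne.ne_empty
      have hx' : x ∈ ({a ⟨F, hF⟩, b ⟨F, hF⟩, c ⟨F, hF⟩} : Finset α) := by
        rw [← habc ⟨F, hF⟩]
        exact hsF hx
      simp only [Finset.mem_insert, Finset.mem_singleton] at hx' ⊢
      exact hx'.resolve_right fun h' => h x hx ⟨⟨F, hF⟩, hF, h'⟩
    · rintro ⟨F, rfl⟩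
      refine ⟨hB.singleton_mem _, fun x hx => ?_⟩
      rw [Finset.mem_singleton] at hx
      subst hx
      rintro ⟨F', hF', h⟩
      have h2 : a F ∈ F'.1 := by
        rw [habc F']
        rcases h with h | h <;> simp [h]
      have : F = F' := Subtype.ext (hd F F.2 F' F'.2 _ (hmema F) h2)
      subst this
      exact h.elim (hab F) (hac F)
  refine ⟨fun s hs => ?_, ?_⟩
  · obtain ⟨F, rfl⟩ := (hfaces s).1 hs
    exact Finset.card_singleton _
  · refine (Set.ncard_congr (fun F hF => {a ⟨F, hF⟩}) (fun F hF => (hfaces _).2 ⟨_, rfl⟩) ?_ ?_).symm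
    · intro F F' hF hF' h
      have h := Finset.singleton_injective h
      refine hd F hF F' hF' (a ⟨F, hF⟩) ?_ ?_
      · exact hmema _
      · exact h ▸ hmema ⟨F', hF'⟩
    · intro s hs
      obtain ⟨F, rfl⟩ := (hfaces s).1 hs
      exact ⟨F.1, F.2, rfl⟩

end PreAbstractSimplicialComplex

/-! ### Wedges of 0-dimensional spheres -/

theorem UnitSphere.eq_base_or_eq_neg (z : UnitSphere 0) :
    z = UnitSphere.base 0 ∨ z = -UnitSphere.base 0 := by
  have hz : z.1 0 = 1 ∨ z.1 0 = -1 := by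
    have := z.2
    rw [mem_sphere_zero_iff_norm, EuclideanSpace.norm_eq] at this
    simpa [abs_eq] using this
  refine hz.imp (fun h => ?_) fun h => ?_ <;>
  · ext i
    have : i = 0 := Subsingleton.elim (α := Fin 1) i 0
    subst this
    simp [UnitSphere.base, h]

theorem UnitSphere.neg_base_ne (d : ℕ) : -UnitSphere.base d ≠ UnitSphere.base d := fun h => by
  have := congrArg (fun z : UnitSphere d => z.1 0) h
  simp [UnitSphere.base] at this
  norm_num at this

theorem discreteTopology_wedgeOfSpheres_zero (ι : Type v) :
    DiscreteTopology (WedgeOfSpheres 0 ι) := by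
  have : Finite (UnitSphere 0) := by
    refine Set.finite_univ_iff.1 ((Set.toFinite {UnitSphere.base 0, -UnitSphere.base 0}).subset ?_)
    exact fun z _ => z.eq_base_or_eq_neg
  refine discreteTopology_iff_forall_isOpen.2 fun U => Wedge.isOpen_iff.2 fun i => ?_
  exact isOpen_discrete (α := UnitSphere 0) _

theorem card_wedgeOfSpheres_zero (ι : Type v) [Finite ι] :
    Nat.card (WedgeOfSpheres 0 ι) = Nat.card ι + 1 := by
  let f : Option ι → WedgeOfSpheres 0 ι := fun o =>
    o.elim Wedge.base fun i => Wedge.incl i (-UnitSphere.base 0)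
  have hne := UnitSphere.neg_base_ne 0
  have hf : Function.Bijective f := by
    constructor
    · rintro (_ | i) (_ | j) h
      · rfl
      · exact absurd h.symm (Wedge.incl_ne_base hne)
      · exact absurd h (Wedge.incl_ne_base hne)
      · have := Wedge.incl_eq_incl (X := fun _ : ι => UnitSphere 0)
          (x₀ := fun _ => UnitSphere.base 0) hne h
        rw [(Sigma.mk.inj_iff.1 this).1]
    · intro z
      rcases z.eq_base_or_incl with rfl | ⟨i, z, rfl⟩
      · exact ⟨none, rfl⟩
      · rcases UnitSphere.eq_base_or_eq_neg z with rfl | rfl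
        · exact ⟨none, (Wedge.incl_base i).symm⟩
        · exact ⟨some i, rfl⟩
  rw [← Nat.card_eq_of_bijective f hf, Finite.card_option]

end

/-! ### Anisotropic vectors, non-degenerate lines and orthogonal frames -/

noncomputable section

variable {K : Type u} {V : Type v} [Field K] [AddCommGroup V] [Module K V] {τ : RingAut K}
  {Ψ : V →ₗ[K] V →ₛₗ[(τ : K →+* K)] K}

namespace IsUnitary

theorem exists_apply_ne (h : IsUnitary Ψ) : ∃ x, τ x ≠ x := by
  by_contra! hτ
  have : τ = 1 := RingEquiv.ext hτ
  have h2 := h.orderOf_eq_two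
  rw [this, orderOf_one] at h2
  exact one_ne_zero (Nat.succ_injective h2).symm

theorem eq_zero_comm (h : IsUnitary Ψ) {v w : V} : Ψ v w = 0 ↔ Ψ w v = 0 := by
  rw [h.hermitian v w, map_eq_zero_iff _ τ.injective]

theorem apply_self (h : IsUnitary Ψ) (v : V) : τ (Ψ v v) = Ψ v v := (h.hermitian v v).symm

theorem exists_apply_ne_zero (h : IsUnitary Ψ) {v : V} (hv : v ≠ 0) : ∃ w, Ψ v w ≠ 0 := by
  by_contra! hw
  exact hv (h.nondegenerate v trivial fun w _ => hw w)

/-- Two vectors that are not orthogonal span a subspace with an anisotropic vector. -/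
theorem exists_anisotropic (h : IsUnitary Ψ) {u y : V} (huy : Ψ u y ≠ 0) :
    ∃ a b : K, Ψ (a • u + b • y) (a • u + b • y) ≠ 0 := by
  by_contra! hc
  have huu : Ψ u u = 0 := by simpa using hc 1 0
  have hyy : Ψ y y = 0 := by simpa using hc 0 1
  -- If all combinations are isotropic, only the cross terms survive. Comparing a scalar `c` moved
  -- by `τ` with `1` gives `(τ c - c) * Ψ u y = 0`, a contradiction. No assumption on the
  -- characteristic is needed.
  have key : ∀ c, τ c * Ψ u y + c * Ψ y u = 0 := fun c => by
    have := hc 1 c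
    simp only [map_add, LinearMap.add_apply, map_smulₛₗ, LinearMap.smul_apply, smul_eq_mul, huu,
      hyy, RingHom.id_apply] at this
    simpa [add_comm] using this
  obtain ⟨c, hc⟩ := h.exists_apply_ne
  have h1 := key 1
  have h2 := key c
  simp only [map_one, one_mul] at h1
  have : (τ c - c) * Ψ u y = 0 := by linear_combination h2 - c * h1
  rcases mul_eq_zero.1 this with h | h
  · exact hc (sub_eq_zero.1 h)
  · exact huy h

end IsUnitary

namespace NondegenerateLine

/-- The line spanned by an anisotropic vector. -/
def mk (v : V) (hv : Ψ v v ≠ 0) : NondegenerateLine Ψ :=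
  ⟨Submodule.span K {v}, finrank_span_singleton (by rintro rfl; simp at hv), by
    intro x hx hx'
    obtain ⟨c, rfl⟩ := Submodule.mem_span_singleton.1 hx
    have := hx' v (Submodule.mem_span_singleton_self v)
    rw [map_smul, LinearMap.smul_apply, smul_eq_mul] at this
    rw [(mul_eq_zero.1 this).resolve_right hv, zero_smul]⟩

theorem exists_eq_mk (S : NondegenerateLine Ψ) : ∃ (v : V) (hv : Ψ v v ≠ 0), mk v hv = S := by
  obtain ⟨⟨v, hvS⟩, hv0, hv⟩ := finrank_eq_one_iff'.1 S.2.1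
  have hS : S.1 = Submodule.span K {v} := by
    refine le_antisymm (fun w hw => ?_) ((Submodule.span_singleton_le_iff_mem _ _).2 hvS)
    obtain ⟨c, hc⟩ := hv ⟨w, hw⟩
    exact Submodule.mem_span_singleton.2 ⟨c, congrArg Subtype.val hc⟩
  refine ⟨v, fun h0 => hv0 (Subtype.ext (S.2.2 v hvS fun w hw => ?_)), Subtype.ext hS.symm⟩
  rw [hS] at hw
  obtain ⟨c, rfl⟩ := Submodule.mem_span_singleton.1 hw
  rw [map_smulₛₗ, h0, smul_zero]

/-- A vector that spans a non-degenerate line. -/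
def vec (S : NondegenerateLine Ψ) : V := S.exists_eq_mk.choose

theorem vec_ne (S : NondegenerateLine Ψ) : Ψ S.vec S.vec ≠ 0 := S.exists_eq_mk.choose_spec.choose

theorem mk_vec (S : NondegenerateLine Ψ) : mk S.vec S.vec_ne = S :=
  S.exists_eq_mk.choose_spec.choose_spec

theorem mk_eq_mk {v w : V} (hv : Ψ v v ≠ 0) (hw : Ψ w w ≠ 0) (c : K) (h : v = c • w) :
    mk v hv = mk w hw := by
  have hc : c ≠ 0 := by
    rintro rfl
    simp [h] at hv
  subst h
  exact Subtype.ext (Submodule.span_singleton_smul_eq hc.isUnit w)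

theorem exists_smul_of_mk_eq {v w : V} (hv : Ψ v v ≠ 0) (hw : Ψ w w ≠ 0) (h : mk v hv = mk w hw) :
    ∃ c : K, v = c • w := by
  have h' : Submodule.span K {v} = Submodule.span K {w} := congrArg Subtype.val h
  have : v ∈ Submodule.span K {w} := h' ▸ Submodule.mem_span_singleton_self v
  obtain ⟨c, hc⟩ := Submodule.mem_span_singleton.1 this
  exact ⟨c, hc.symm⟩

end NondegenerateLine

open NondegenerateLine

theorem orthogonalityGraph_adj_mk (h : IsUnitary Ψ) {v w : V} (hv : Ψ v v ≠ 0) (hw : Ψ w w ≠ 0) :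
    (orthogonalityGraph h).Adj (mk v hv) (mk w hw) ↔ Ψ v w = 0 := by
  refine ⟨fun H => H v (Submodule.mem_span_singleton_self v) w
    (Submodule.mem_span_singleton_self w), fun H x hx y hy => ?_⟩
  obtain ⟨c, rfl⟩ := Submodule.mem_span_singleton.1 hx
  obtain ⟨d, rfl⟩ := Submodule.mem_span_singleton.1 hy
  simp [H]

theorem orthogonalityGraph_adj_iff (h : IsUnitary Ψ) {S T : NondegenerateLine Ψ} :
    (orthogonalityGraph h).Adj S T ↔ Ψ S.vec T.vec = 0 := by
  conv_lhs => rw [← S.mk_vec, ← T.mk_vec]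
  exact orthogonalityGraph_adj_mk h _ _

/-- The component of a vector that is orthogonal to given lines. -/
def orthogonalPart (Ψ : V →ₗ[K] V →ₛₗ[(τ : K →+* K)] K) (s : Finset (NondegenerateLine Ψ)) (w : V) :
    V :=
  w - ∑ S ∈ s, (Ψ w S.vec / Ψ S.vec S.vec) • S.vec

section Clique

variable (h : IsUnitary Ψ) {s : Finset (NondegenerateLine Ψ)}
  (hs : (orthogonalityGraph h).IsClique (s : Set (NondegenerateLine Ψ)))

include hs

theorem apply_orthogonalPart (w : V) {T : NondegenerateLine Ψ} (hT : T ∈ s) :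
    Ψ (orthogonalPart Ψ s w) T.vec = 0 := by
  classical
  simp only [orthogonalPart, map_sub, map_sum, LinearMap.sub_apply, LinearMap.sum_apply, map_smul,
    LinearMap.smul_apply, smul_eq_mul]
  rw [Finset.sum_eq_single T, div_mul_cancel₀ _ T.vec_ne, sub_self]
  · intro S hS hST
    rw [(orthogonalityGraph_adj_iff h).1 (hs hS hT hST), mul_zero]
  · exact fun hT' => absurd hT hT'

theorem linearIndependent_vec : LinearIndependent K fun S : s => S.1.vec :=
  LinearMap.linearIndependent_of_isOrthoᵢ (B := Ψ)
    (LinearMap.isOrthoᵢ_def.2 fun S T hST => (orthogonalityGraph_adj_iff h).1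
      (hs S.2 T.2 fun e => hST (Subtype.ext e))) fun S => S.1.vec_ne

/-- A clique with fewer elements than the dimension can be extended. -/
theorem exists_adj_of_card_lt (hcard : s.card < Module.finrank K V) :
    ∃ T, ∀ S ∈ s, (orthogonalityGraph h).Adj T S := by
  have hlt : Module.finrank K (Submodule.span K (Set.range fun S : s => S.1.vec)) <
      Module.finrank K V := by
    rw [finrank_span_eq_card (linearIndependent_vec h hs), Fintype.card_coe]
    exact hcard
  obtain ⟨w, hw⟩ : ∃ w, w ∉ Submodule.span K (Set.range fun S : s => S.1.vec) := by
    by_contra! H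
    rw [(Submodule.eq_top_iff'.2 H), finrank_top] at hlt
    exact lt_irrefl _ hlt
  have hu0 : orthogonalPart Ψ s w ≠ 0 := fun h0 => hw <| by
    rw [sub_eq_zero.1 h0]
    exact Submodule.sum_mem _ fun S hS =>
      Submodule.smul_mem _ _ (Submodule.subset_span ⟨⟨S, hS⟩, rfl⟩)
  obtain ⟨x, hx⟩ := h.exists_apply_ne_zero hu0
  -- Passing from `x` to its orthogonal part does not change the pairing, since the first vector is
  -- orthogonal to the lines of `s`. Both vectors now lie in the orthogonal complement of the
  -- clique, and so does the anisotropic combination.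
  have hux : Ψ (orthogonalPart Ψ s w) (orthogonalPart Ψ s x) ≠ 0 := by
    conv_lhs =>
      enter [2]
      rw [orthogonalPart]
    rw [map_sub, map_sum, Finset.sum_eq_zero, sub_zero]
    · exact hx
    · intro S hS
      rw [map_smulₛₗ, apply_orthogonalPart h hs w hS, smul_zero]
  obtain ⟨a, b, hab⟩ := h.exists_anisotropic hux
  refine ⟨mk _ hab, fun S hS => ?_⟩
  rw [← S.mk_vec, orthogonalityGraph_adj_mk]
  simp [apply_orthogonalPart h hs _ hS]

theorem card_le_finrank_of_isClique [Module.Finite K V] : s.card ≤ Module.finrank K V := by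
  simpa using (linearIndependent_vec h hs).fintype_card_le_finrank

/-- Every clique is contained in an orthogonal frame. -/
theorem exists_mem_cliqueSet {n : ℕ} (hn : Module.finrank K V = n) [Module.Finite K V] :
    ∃ F ∈ (orthogonalityGraph h).cliqueSet n, s ⊆ F := by
  classical
  induction hk : n - s.card generalizing s with
  | zero =>
    have := card_le_finrank_of_isClique h hs
    exact ⟨s, SimpleGraph.mem_cliqueSet_iff.2 ⟨hs, by lia⟩, subset_rfl⟩
  | succ k ih =>
    obtain ⟨T, hT⟩ := exists_adj_of_card_lt h hs (by lia)
    have hTs : T ∉ s := fun hm => (hT T hm).ne rfl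
    have hs' : (orthogonalityGraph h).IsClique (insert T s : Finset (NondegenerateLine Ψ)) := by
      rw [Finset.coe_insert]
      exact hs.insert fun S hS _ => hT S hS
    obtain ⟨F, hF, hsF⟩ := ih hs' (by rw [Finset.card_insert_of_notMem hTs]; lia)
    exact ⟨F, hF, (Finset.subset_insert _ _).trans hsF⟩

theorem eq_zero_of_forall_apply_eq_zero [Module.Finite K V] (hcard : s.card = Module.finrank K V)
    {w : V} (hw : ∀ S ∈ s, Ψ w S.vec = 0) : w = 0 := by
  have hspan : Submodule.span K (Set.range fun S : s => S.1.vec) = ⊤ :=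
    (linearIndependent_vec h hs).span_eq_top_of_card_eq_finrank' (by simpa using hcard)
  refine h.nondegenerate w trivial fun x _ => ?_
  have hx : x ∈ Submodule.span K (Set.range fun S : s => S.1.vec) := hspan ▸ trivial
  induction hx using Submodule.span_induction with
  | mem x hx =>
    obtain ⟨S, rfl⟩ := hx
    exact hw S S.2
  | zero => simp
  | add x y _ _ hx hy => rw [map_add, hx trivial, hy trivial, add_zero]
  | smul c x _ hx => rw [map_smulₛₗ, hx trivial, smul_zero]

/-- A clique with one element less than the dimension can be extended in one way only. -/
theorem eq_of_forall_adj [Module.Finite K V] (hcard : s.card + 1 = Module.finrank K V)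
    {T T' : NondegenerateLine Ψ} (hT : ∀ S ∈ s, (orthogonalityGraph h).Adj T S)
    (hT' : ∀ S ∈ s, (orthogonalityGraph h).Adj T' S) : T' = T := by
  classical
  have hTs : T ∉ s := fun hm => (hT T hm).ne rfl
  have hs' : (orthogonalityGraph h).IsClique (insert T s : Finset (NondegenerateLine Ψ)) := by
    rw [Finset.coe_insert]
    exact hs.insert fun S hS _ => hT S hS
  -- The component of `T'.vec` orthogonal to `T` is orthogonal to the whole frame `insert T s`, so
  -- it vanishes.
  have h0 : T'.vec - (Ψ T'.vec T.vec / Ψ T.vec T.vec) • T.vec = 0 := by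
    refine eq_zero_of_forall_apply_eq_zero h hs'
      (by rw [Finset.card_insert_of_notMem hTs, hcard]) fun S hS => ?_
    rw [map_sub, LinearMap.sub_apply, map_smul, LinearMap.smul_apply, smul_eq_mul]
    rcases Finset.mem_insert.1 hS with rfl | hS
    · rw [div_mul_cancel₀ _ S.vec_ne, sub_self]
    · rw [(orthogonalityGraph_adj_iff h).1 (hT S hS), (orthogonalityGraph_adj_iff h).1 (hT' S hS),
        mul_zero, sub_zero]
  rw [← T.mk_vec, ← T'.mk_vec]
  exact mk_eq_mk _ _ _ (sub_eq_zero.1 h0)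

end Clique

section Frames

variable (h : IsUnitary Ψ)

theorem isClique_singleton (S : NondegenerateLine Ψ) : (orthogonalityGraph h).IsClique
    (({S} : Finset (NondegenerateLine Ψ)) : Set (NondegenerateLine Ψ)) := by
  rw [Finset.coe_singleton]
  exact Set.pairwise_singleton _ _

theorem eq_of_mem_of_finrank_eq_two (hn : Module.finrank K V = 2)
    {F F' : Finset (NondegenerateLine Ψ)} (hF : F ∈ (orthogonalityGraph h).cliqueSet 2)
    (hF' : F' ∈ (orthogonalityGraph h).cliqueSet 2) {a : NondegenerateLine Ψ} (ha : a ∈ F)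
    (ha' : a ∈ F') : F = F' := by
  have : Module.Finite K V := Module.finite_of_finrank_pos (by lia)
  rw [SimpleGraph.mem_cliqueSet_iff] at hF hF'
  refine Finset.eq_of_subset_of_card_le (fun x hx => ?_) (by rw [hF.card_eq, hF'.card_eq])
  by_cases hxa : x = a
  · rwa [hxa]
  obtain ⟨y, hy, hya⟩ := Finset.exists_mem_ne (by rw [hF'.card_eq]; lia) a
  have : x = y := eq_of_forall_adj h (isClique_singleton h a)
    (by rw [Finset.card_singleton, hn])
    (fun S hS => Finset.mem_singleton.1 hS ▸ hF'.isClique hy ha' hya)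
    (fun S hS => Finset.mem_singleton.1 hS ▸ hF.isClique hx ha hxa)
  rwa [this]

theorem eq_of_mem_of_finrank_eq_three (hn : Module.finrank K V = 3)
    {F F' : Finset (NondegenerateLine Ψ)} (hF : F ∈ (orthogonalityGraph h).cliqueSet 3)
    (hF' : F' ∈ (orthogonalityGraph h).cliqueSet 3) {a b : NondegenerateLine Ψ} (hab : a ≠ b)
    (ha : a ∈ F) (hb : b ∈ F) (ha' : a ∈ F') (hb' : b ∈ F') : F = F' := by
  classical
  have : Module.Finite K V := Module.finite_of_finrank_pos (by lia)
  rw [SimpleGraph.mem_cliqueSet_iff] at hF hF'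
  refine Finset.eq_of_subset_of_card_le (fun x hx => ?_) (by rw [hF.card_eq, hF'.card_eq])
  by_cases hxa : x = a
  · rwa [hxa]
  by_cases hxb : x = b
  · rwa [hxb]
  have hpair : ({a, b} : Finset (NondegenerateLine Ψ)).card = 2 := Finset.card_pair hab
  obtain ⟨y, hy, hyab⟩ := Finset.exists_mem_notMem_of_card_lt_card
    (s := {a, b}) (t := F') (by rw [hF'.card_eq, hpair]; lia)
  simp only [Finset.mem_insert, Finset.mem_singleton, not_or] at hyab
  have hsub : ({a, b} : Finset (NondegenerateLine Ψ)) ⊆ F := by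
    simp [Finset.insert_subset_iff, ha, hb]
  have : x = y := by
    refine eq_of_forall_adj h (hF.isClique.subset (Finset.coe_subset.2 hsub))
      (by rw [hpair, hn]) (fun S hS => ?_) fun S hS => ?_
    all_goals
      simp only [Finset.mem_insert, Finset.mem_singleton] at hS
      rcases hS with rfl | rfl
    · exact hF'.isClique hy ha' hyab.1
    · exact hF'.isClique hy hb' hyab.2
    · exact hF.isClique hx ha hxa
    · exact hF.isClique hx hb hxb
  rwa [this]

/-- A clique that lacks one line of a frame extends uniquely. Two common lines therefore fix a frame
of three, and a single common line fixes a frame of two. -/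
theorem isBlockSystem_frameComplex {n : ℕ} (hn : Module.finrank K V = n) (hn' : n = 2 ∨ n = 3) :
    (frameComplex h).IsBlockSystem ((orthogonalityGraph h).cliqueSet n) := by
  have : Module.Finite K V := Module.finite_of_finrank_pos (by lia)
  refine ⟨fun F hF => ?_, fun s hs => exists_mem_cliqueSet h hs.2 hn, ?_, fun F hF => ?_,
    fun S => ⟨Finset.singleton_nonempty S, isClique_singleton h S⟩⟩
  · rw [SimpleGraph.mem_cliqueSet_iff] at hF
    exact ⟨Finset.card_pos.1 (by rw [hF.card_eq]; lia), hF.isClique⟩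
  · rintro F hF F' hF' a b hab ha hb ha' hb'
    rcases hn' with rfl | rfl
    · exact eq_of_mem_of_finrank_eq_two h hn hF hF' ha ha'
    · exact eq_of_mem_of_finrank_eq_three h hn hF hF' hab ha hb ha' hb'
  · rw [(SimpleGraph.mem_cliqueSet_iff.1 hF).card_eq]
    lia

end Frames
end

/-! ### The fixed field and the connectedness of the orthogonality graph -/

noncomputable section

variable {K : Type u} {V : Type v} [Field K] [AddCommGroup V] [Module K V] {τ : RingAut K}
  {Ψ : V →ₗ[K] V →ₛₗ[(τ : K →+* K)] K}

open NondegenerateLine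

/-- The subfield of the elements fixed by an automorphism. -/
def fixedSubfield (τ : RingAut K) : Subfield K := FixedPoints.subfield (Subgroup.zpowers τ) K

theorem mem_fixedSubfield {x : K} : x ∈ fixedSubfield τ ↔ τ x = x := by
  refine ⟨fun hx => hx ⟨τ, Subgroup.mem_zpowers τ⟩, fun hx => ?_⟩
  rintro ⟨g, hg⟩
  obtain ⟨n, rfl⟩ := Subgroup.mem_zpowers_iff.1 hg
  have : τ ∈ MulAction.stabilizer (RingAut K) x := hx
  exact (MulAction.stabilizer (RingAut K) x).zpow_mem this n

section FixedSubfield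

variable (hτ : orderOf τ = 2)

include hτ

/-- Artin's theorem for the group of order two generated by `τ`. -/
theorem finrank_fixedSubfield : Module.Finite (fixedSubfield τ) K ∧
    Module.finrank (fixedSubfield τ) K = 2 := by
  have hfin : Finite (Subgroup.zpowers τ) :=
    Nat.finite_of_card_ne_zero (by rw [Nat.card_zpowers, hτ]; exact two_ne_zero)
  have := Fintype.ofFinite (Subgroup.zpowers τ)
  have h2 : Module.finrank (fixedSubfield τ) K = 2 := by
    rw [← hτ, ← Nat.card_zpowers, Nat.card_eq_fintype_card]
    exact FixedPoints.finrank_eq_card (Subgroup.zpowers τ) K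
  exact ⟨Module.finite_of_finrank_pos (by lia), h2⟩

theorem natCard_eq_natCard_fixedSubfield_sq : Nat.card K = Nat.card (fixedSubfield τ) ^ 2 := by
  obtain ⟨h1, h2⟩ := finrank_fixedSubfield hτ
  rw [Module.natCard_eq_pow_finrank (K := fixedSubfield τ) (V := K), h2]

theorem infinite_fixedSubfield [Infinite K] : Infinite (fixedSubfield τ) := by
  obtain ⟨h1, -⟩ := finrank_fixedSubfield hτ
  by_contra hc
  rw [not_infinite_iff_finite] at hc
  exact not_finite_iff_infinite.2 ‹Infinite K› (Module.finite_of_finite (fixedSubfield τ))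

end FixedSubfield

namespace IsUnitary

variable (h : IsUnitary Ψ)

include h

/-- The traces `z + τ z` form a nonzero subspace over the fixed field. If that field has an element
`k` other than `0` and `1`, then the traces of `0`, `z₀` and `k * z₀` are distinct when `z₀` has
nonzero trace, and two forbidden values cannot exclude all three. Otherwise the fixed field has two
elements and `K` has four. -/
theorem exists_trace_ne (hK : Nat.card K ≠ 4) (A e : K) :
    ∃ z, A + (z + τ z) ≠ 0 ∧ A + (z + τ z) ≠ e := by
  by_contra! hc
  obtain ⟨z₀, hz₀⟩ : ∃ z₀, z₀ + τ z₀ ≠ 0 := by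
    by_contra! ht
    obtain ⟨x, hx⟩ := h.exists_apply_ne
    have h1 := ht 1
    have h2 := ht x
    rw [map_one] at h1
    exact hx (by linear_combination h2 - x * h1)
  have key : ∀ k, τ k = k → k = 0 ∨ k = 1 := fun k hk => by
    have e0 := hc 0
    have e1 := hc z₀
    have e2 := hc (k * z₀)
    simp only [map_zero, add_zero, map_mul, hk] at e0 e1 e2
    by_contra! hk'
    have hk1 := sub_ne_zero.2 hk'.2
    have d1 : k * z₀ + k * τ z₀ ≠ 0 := by
      rw [← mul_add]
      exact mul_ne_zero hk'.1 hz₀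
    have d2 : k * z₀ + k * τ z₀ ≠ z₀ + τ z₀ := fun heq => by
      have : (k - 1) * (z₀ + τ z₀) = 0 := by linear_combination heq
      exact (mul_ne_zero hk1 hz₀) this
    by_cases hA0 : A = 0
    · have f1 := e1 (by rw [hA0, zero_add]; exact hz₀)
      have f2 := e2 (by rw [hA0, zero_add]; exact d1)
      exact d2 (by linear_combination f2 - f1)
    · have f0 := e0 hA0
      by_cases g1 : A + (z₀ + τ z₀) = 0
      · have f2 := e2 fun g2 => d2 (by linear_combination g2 - g1)
        exact d1 (by linear_combination f2 - f0)
      · exact hz₀ (by linear_combination e1 g1 - f0)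
  have hcard : Nat.card (fixedSubfield τ) = 2 := by
    refine Nat.card_eq_two_iff.2 ⟨0, 1, zero_ne_one, Set.eq_univ_of_forall fun k => ?_⟩
    exact (key k.1 (mem_fixedSubfield.1 k.2)).imp Subtype.ext Subtype.ext
  exact hK (by rw [natCard_eq_natCard_fixedSubfield_sq h.orderOf_eq_two, hcard]; norm_num)

end IsUnitary

section Connected

variable (h : IsUnitary Ψ)

/-- The condition `hd` says that the Gram determinant is nonzero. Then the part `w'` of `w`
orthogonal to `v` is anisotropic, and the line completing `v` and `w'` to a frame is orthogonal to
`w` as well. -/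
theorem exists_common_adj (hn : Module.finrank K V = 3) {v w : V} (hv : Ψ v v ≠ 0)
    (hw : Ψ w w ≠ 0) (hd : Ψ v v * Ψ w w ≠ Ψ v w * Ψ w v) :
    ∃ T, (orthogonalityGraph h).Adj (mk v hv) T ∧ (orthogonalityGraph h).Adj T (mk w hw) := by
  classical
  set w' := w - (Ψ w v / Ψ v v) • v with hw'
  have hw'v : Ψ w' v = 0 := by
    simp [hw', hv]
  have hw'w' : Ψ w' w' ≠ 0 := by
    have : Ψ w' w' = Ψ w w - (Ψ w v / Ψ v v) * Ψ v w := by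
      conv_lhs =>
        enter [2]
        rw [hw']
      rw [map_sub, map_smulₛₗ, hw'v, smul_zero, sub_zero]
      simp [hw']
    rw [this]
    intro h0
    field_simp at h0
    exact hd (by linear_combination h0)
  have hadj : (orthogonalityGraph h).Adj (mk w' hw'w') (mk v hv) :=
    (orthogonalityGraph_adj_mk h _ _).2 hw'v
  have hs : (orthogonalityGraph h).IsClique
      (({mk w' hw'w', mk v hv} : Finset (NondegenerateLine Ψ)) : Set (NondegenerateLine Ψ)) := by
    rw [Finset.coe_insert, Finset.coe_singleton]
    exact Set.pairwise_pair.2 fun _ => ⟨hadj, hadj.symm⟩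
  obtain ⟨T, hT⟩ := exists_adj_of_card_lt h hs (by
    rw [hn]
    exact lt_of_le_of_lt Finset.card_le_two (by lia))
  have h1 := hT (mk w' hw'w') (by simp)
  have h2 := hT (mk v hv) (by simp)
  refine ⟨T, h2.symm, ?_⟩
  rw [← T.mk_vec, orthogonalityGraph_adj_mk] at h1 h2 ⊢
  have : w = w' + (Ψ w v / Ψ v v) • v := by rw [hw', sub_add_cancel]
  rw [this, map_add, map_smulₛₗ, h1, h2, smul_zero, add_zero]

include h in
-- Here the part `w'` of `w` orthogonal to `v` is isotropic. Take `y` orthogonal to `v` but not to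
-- `w'`, and let `x = y + c • w'`: varying `c` changes `Ψ x x` by an arbitrary trace, while `Ψ x w`
-- stays fixed. Two values of `Ψ x x` must be avoided: `0`, and the one for which the Gram
-- determinant of `x` and `w` vanishes.
theorem exists_adj_of_degenerate (hK : Nat.card K ≠ 4) {v w : V} (hv : Ψ v v ≠ 0)
    (hw : Ψ w w ≠ 0) (hne : mk v hv ≠ mk w hw) (hd : Ψ v v * Ψ w w = Ψ v w * Ψ w v) :
    ∃ (x : V), Ψ x x ≠ 0 ∧ Ψ v x = 0 ∧ Ψ x x * Ψ w w ≠ Ψ x w * Ψ w x := by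
  set w' := w - (Ψ w v / Ψ v v) • v with hw'
  have hw'v : Ψ w' v = 0 := by
    simp [hw', hv]
  have hw'w' : Ψ w' w' = 0 := by
    have : Ψ w' w' = Ψ w w - (Ψ w v / Ψ v v) * Ψ v w := by
      conv_lhs =>
        enter [2]
        rw [hw']
      rw [map_sub, map_smulₛₗ, hw'v, smul_zero, sub_zero]
      simp [hw']
    rw [this]
    field_simp
    linear_combination hd
  have hw'0 : w' ≠ 0 := fun h0 => hne (mk_eq_mk hw hv _ (sub_eq_zero.1 h0)).symm
  obtain ⟨x₀, hx₀⟩ := h.exists_apply_ne_zero hw'0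
  set y := x₀ - (Ψ x₀ v / Ψ v v) • v with hy
  have hyv : Ψ y v = 0 := by
    simp [hy, hv]
  have hw'y : Ψ w' y ≠ 0 := by
    rwa [hy, map_sub, map_smulₛₗ, hw'v, smul_zero, sub_zero]
  have hyw' : Ψ y w' ≠ 0 := fun h0 => hw'y (h.eq_zero_comm.1 h0)
  obtain ⟨z, hz0, hze⟩ := h.exists_trace_ne hK (Ψ y y) (Ψ y w' * Ψ w' y / Ψ w w)
  have hxx : ∀ c : K, Ψ (y + c • w') (y + c • w') = Ψ y y + (c * Ψ w' y + τ (c * Ψ w' y)) := fun c => by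
    have : Ψ y w' = τ (Ψ w' y) := h.hermitian _ _
    simp only [map_add, LinearMap.add_apply, map_smul, map_smulₛₗ, LinearMap.smul_apply,
      smul_eq_mul, hw'w', map_mul, this]
    simp
    ring
  have hxv : ∀ c : K, Ψ (y + c • w') v = 0 := fun c => by simp [hyv, hw'v]
  have hwdec : w = w' + (Ψ w v / Ψ v v) • v := by rw [hw', sub_add_cancel]
  have hxw : ∀ c : K, Ψ (y + c • w') w = Ψ y w' := fun c => by
    conv_lhs =>
      enter [2]
      rw [hwdec]
    rw [map_add, map_smulₛₗ, hxv, smul_zero, add_zero]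
    simp [hw'w']
  have hwx : ∀ c : K, Ψ w (y + c • w') = Ψ w' y := fun c => by
    rw [h.hermitian, hxw, ← h.hermitian]
  have hzc : z / Ψ w' y * Ψ w' y = z := div_mul_cancel₀ _ hw'y
  refine ⟨y + (z / Ψ w' y) • w', ?_, h.eq_zero_comm.1 (hxv _), ?_⟩
  · rw [hxx, hzc]
    exact hz0
  · rw [hxx, hxw, hwx, hzc]
    intro heq
    exact hze (by rw [eq_div_iff hw, heq])

/-- In dimension `3`, over any field other than the field with four elements, the orthogonality
graph is connected. -/
theorem reflTransGen_mem_cliqueSet (hn : Module.finrank K V = 3) (hK : Nat.card K ≠ 4)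
    (S T : NondegenerateLine Ψ) :
    Relation.ReflTransGen (fun a b => ∃ F ∈ (orthogonalityGraph h).cliqueSet 3, a ∈ F ∧ b ∈ F)
      S T := by
  classical
  have : Module.Finite K V := Module.finite_of_finrank_pos (by lia)
  have hadj : ∀ {a b}, (orthogonalityGraph h).Adj a b →
      ∃ F ∈ (orthogonalityGraph h).cliqueSet 3, a ∈ F ∧ b ∈ F := fun {a b} hab => by
    have hs : (orthogonalityGraph h).IsClique
        (({a, b} : Finset (NondegenerateLine Ψ)) : Set (NondegenerateLine Ψ)) := by
      rw [Finset.coe_insert, Finset.coe_singleton]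
      exact Set.pairwise_pair.2 fun _ => ⟨hab, hab.symm⟩
    obtain ⟨F, hF, hsF⟩ := exists_mem_cliqueSet h hs hn
    exact ⟨F, hF, hsF (by simp), hsF (by simp)⟩
  obtain ⟨v, hv, rfl⟩ := S.exists_eq_mk
  obtain ⟨w, hw, rfl⟩ := T.exists_eq_mk
  by_cases hne : mk v hv = mk w hw
  · rw [hne]
  by_cases hd : Ψ v v * Ψ w w = Ψ v w * Ψ w v
  · obtain ⟨x, hx, hvx, hd'⟩ := exists_adj_of_degenerate h hK hv hw hne hd
    obtain ⟨T, h1, h2⟩ := exists_common_adj h hn hx hw hd'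
    exact ((Relation.ReflTransGen.single (hadj ((orthogonalityGraph_adj_mk h hv hx).2 hvx))).tail
      (hadj h1)).tail (hadj h2)
  · obtain ⟨T, h1, h2⟩ := exists_common_adj h hn hv hw hd
    exact (Relation.ReflTransGen.single (hadj h1)).tail (hadj h2)

end Connected

/-! ### Orthogonal pentagons over infinite fields -/

section Pentagon

variable (h : IsUnitary Ψ)

/-- The fixed field is infinite, so one of its elements is not a root of `X * (A + X²B) * (A' +
X²B')`, which is nonzero because `A` and `A'` are the constant terms of the last two factors. -/
theorem exists_fixed_ne_zero [Infinite K] (hτ : orderOf τ = 2) {A A' : K} (B B' : K) (hA : A ≠ 0)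
    (hA' : A' ≠ 0) : ∃ x, τ x = x ∧ x ≠ 0 ∧ A + x * x * B ≠ 0 ∧ A' + x * x * B' ≠ 0 := by
  open Polynomial in
  let p : K[X] := X * ((C A + X * X * C B) * (C A' + X * X * C B'))
  have hp : p ≠ 0 := by
    refine mul_ne_zero Polynomial.X_ne_zero (mul_ne_zero (fun h0 => hA ?_) fun h0 => hA' ?_)
    · simpa using congrArg (Polynomial.eval 0) h0
    · simpa using congrArg (Polynomial.eval 0) h0
  have hinf : (fixedSubfield τ : Set K).Infinite :=
    Set.infinite_coe_iff.1 (infinite_fixedSubfield hτ)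
  classical
  obtain ⟨x, hx, hxp⟩ := hinf.exists_notMem_finset p.roots.toFinset
  have : p.eval x ≠ 0 := fun h0 => hxp (by simpa [hp] using h0)
  simp only [p, Polynomial.eval_mul, Polynomial.eval_X, Polynomial.eval_add, Polynomial.eval_C,
    mul_ne_zero_iff] at this
  exact ⟨x, mem_fixedSubfield.1 hx, this.1, this.2.1, this.2.2⟩

include h in
-- Orthogonality of exactly the cyclically consecutive lines ensures that successive edges of the
-- pentagon lie in different frames, so it is a closed walk without backtracking in the incidence
-- graph.
theorem exists_pentagon (hn : Module.finrank K V = 3) [Infinite K] :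
    ∃ p : Fin 5 → V, (∀ i, Ψ (p i) (p i) ≠ 0) ∧ (∀ i, Ψ (p i) (p (i + 1)) = 0) ∧
      ∀ i, Ψ (p i) (p (i + 2)) ≠ 0 := by
  have : Module.Finite K V := Module.finite_of_finrank_pos (by lia)
  obtain ⟨F, hF, -⟩ := exists_mem_cliqueSet h (s := ∅) (by simp) hn
  obtain ⟨hF, hcard⟩ := SimpleGraph.mem_cliqueSet_iff.1 hF
  classical
  obtain ⟨S₁, S₂, S₃, h12, h13, h23, rfl⟩ := Finset.card_eq_three.1 hcard
  have o12 := (orthogonalityGraph_adj_iff h).1 (hF (by simp) (by simp) h12)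
  have o13 := (orthogonalityGraph_adj_iff h).1 (hF (by simp) (by simp) h13)
  have o23 := (orthogonalityGraph_adj_iff h).1 (hF (by simp) (by simp) h23)
  have q1 := S₁.vec_ne
  have q2 := S₂.vec_ne
  have q3 := S₃.vec_ne
  generalize S₁.vec = e₁ at *
  generalize S₂.vec = e₂ at *
  generalize S₃.vec = e₃ at *
  have o21 := h.eq_zero_comm.1 o12
  have o31 := h.eq_zero_comm.1 o13
  have o32 := h.eq_zero_comm.1 o23
  have t1 := h.apply_self e₁
  have t2 := h.apply_self e₂
  have t3 := h.apply_self e₃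
  generalize hQ1 : Ψ e₁ e₁ = Q₁ at *
  generalize hQ2 : Ψ e₂ e₂ = Q₂ at *
  generalize hQ3 : Ψ e₃ e₃ = Q₃ at *
  -- The choice of `k` makes `p 2` anisotropic, that of `s` makes `p 3` and `p 4` anisotropic: up to
  -- nonzero factors their norms are the expressions in `hs1` and `hs2`. That `k` and `s` are
  -- nonzero excludes unwanted orthogonalities.
  obtain ⟨k, hk, hk0, hk1, -⟩ := exists_fixed_ne_zero h.orderOf_eq_two Q₃ Q₃ q1 q1
  have hz : Q₁ * Q₃ * (Q₁ + k * k * Q₃) ≠ 0 := mul_ne_zero (mul_ne_zero q1 q3) hk1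
  obtain ⟨s, hs, hs0, hs1, hs2⟩ := exists_fixed_ne_zero h.orderOf_eq_two Q₂ Q₂ hz
    (mul_ne_zero (mul_ne_zero q1 q1) q3)
  -- `p 2` lies in the complement of `e₂`, `p 3` is a vector orthogonal to `p 2`, and `p 4` closes
  -- the pentagon, being orthogonal to `e₁` and `p 3`.
  let p : Fin 5 → V := ![e₁, e₂, e₁ + k • e₃, (Q₃ * k) • e₁ + s • e₂ - Q₁ • e₃,
    (Q₁ * Q₃) • e₂ + (s * Q₂) • e₃]
  have comp : ∀ a b c a' b' c' : K, Ψ (a • e₁ + b • e₂ + c • e₃) (a' • e₁ + b' • e₂ + c' • e₃) =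
      a * τ a' * Q₁ + b * τ b' * Q₂ + c * τ c' * Q₃ := fun a b c a' b' c' => by
    simp only [map_add, LinearMap.add_apply, map_smul, map_smulₛₗ, LinearMap.smul_apply,
      smul_eq_mul, o12, o13, o23, o21, o31, o32, hQ1, hQ2, hQ3]
    simp
    ring
  have p0 : p 0 = (1 : K) • e₁ + (0 : K) • e₂ + (0 : K) • e₃ := by simp [p]
  have p1 : p 1 = (0 : K) • e₁ + (1 : K) • e₂ + (0 : K) • e₃ := by simp [p]
  have p2 : p 2 = (1 : K) • e₁ + (0 : K) • e₂ + k • e₃ := by simp [p]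
  have p3 : p 3 = (Q₃ * k) • e₁ + s • e₂ + (-Q₁) • e₃ := by simp [p, sub_eq_add_neg]
  have p4 : p 4 = (0 : K) • e₁ + (Q₁ * Q₃) • e₂ + (s * Q₂) • e₃ := by simp [p]
  refine ⟨p, fun i => ?_, fun i => ?_, fun i => ?_⟩
  · fin_cases i
    · show Ψ (p 0) (p 0) ≠ 0
      rw [p0, comp]
      simpa using q1
    · show Ψ (p 1) (p 1) ≠ 0
      rw [p1, comp]
      simpa using q2
    · show Ψ (p 2) (p 2) ≠ 0
      rw [p2, comp, hk]
      simpa using hk1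
    · show Ψ (p 3) (p 3) ≠ 0
      rw [p3, comp, map_mul, map_neg, hk, hs, t1, t3]
      convert hs1 using 1
      ring
    · show Ψ (p 4) (p 4) ≠ 0
      rw [p4, comp, map_mul, map_mul, hs, t1, t2, t3]
      convert mul_ne_zero (mul_ne_zero q2 q3) hs2 using 1
      rw [map_zero]
      ring
  · fin_cases i
    · show Ψ (p 0) (p 1) = 0
      rw [p0, p1, comp]
      simp
    · show Ψ (p 1) (p 2) = 0
      rw [p1, p2, comp]
      simp
    · show Ψ (p 2) (p 3) = 0
      rw [p2, p3, comp, map_mul, map_neg, hk, hs, t1, t3]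
      ring
    · show Ψ (p 3) (p 4) = 0
      rw [p3, p4, comp, map_mul, map_mul, map_zero, hs, t1, t2, t3]
      ring
    · show Ψ (p 4) (p 0) = 0
      rw [p4, p0, comp]
      simp
  · fin_cases i
    · show Ψ (p 0) (p 2) ≠ 0
      rw [p0, p2, comp]
      simpa using q1
    · show Ψ (p 1) (p 3) ≠ 0
      rw [p1, p3, comp, hs]
      simpa using ⟨hs0, q2⟩
    · show Ψ (p 2) (p 4) ≠ 0
      rw [p2, p4, comp, map_mul τ s, hs, t2]
      simpa using ⟨⟨hk0, hs0, q2⟩, q3⟩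
    · show Ψ (p 3) (p 0) ≠ 0
      rw [p3, p0, comp]
      simpa using ⟨⟨q3, hk0⟩, q1⟩
    · show Ψ (p 4) (p 1) ≠ 0
      rw [p4, p1, comp]
      simpa using ⟨⟨q1, q3⟩, q2⟩

theorem nonempty_nontree_of_infinite (hn : Module.finrank K V = 3) [Infinite K]
    (T : PreAbstractSimplicialComplex.RootedTree ((orthogonalityGraph h).cliqueSet 3)) :
    Nonempty T.Nontree := by
  classical
  have : Module.Finite K V := Module.finite_of_finrank_pos (by lia)
  obtain ⟨p, hp, hadj, hnadj⟩ := exists_pentagon h hn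
  let v : Fin 5 → NondegenerateLine Ψ := fun i => mk (p i) (hp i)
  have hv : ∀ i, (orthogonalityGraph h).Adj (v i) (v (i + 1)) := fun i =>
    (orthogonalityGraph_adj_mk h _ _).2 (hadj i)
  have hv' : ∀ i, ¬ (orthogonalityGraph h).Adj (v i) (v (i + 2)) := fun i H =>
    hnadj i ((orthogonalityGraph_adj_mk h _ _).1 H)
  have hF : ∀ i, ∃ F ∈ (orthogonalityGraph h).cliqueSet 3, v i ∈ F ∧ v (i + 1) ∈ F := fun i => by
    have hs : (orthogonalityGraph h).IsClique
        (({v i, v (i + 1)} : Finset (NondegenerateLine Ψ)) : Set (NondegenerateLine Ψ)) := by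
      rw [Finset.coe_insert, Finset.coe_singleton]
      exact Set.pairwise_pair.2 fun _ => ⟨hv i, (hv i).symm⟩
    obtain ⟨F, hF, hsF⟩ := exists_mem_cliqueSet h hs hn
    exact ⟨F, hF, hsF (by simp), hsF (by simp)⟩
  choose F hFB hF1 hF2 using hF
  refine T.nonempty_nontree_of_cycle (fun i : Fin 5 => i + 1) (add_right_surjective 1) v
    (fun i => ⟨F i, hFB i⟩) hF1 hF2 (fun i => (hv i).ne) fun i heq => ?_
  have heq' : F i = F (i + 1) := congrArg Subtype.val heq
  have h1 : v (i + 2) ∈ F i := by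
    rw [heq']
    have := hF2 (i + 1)
    rwa [add_assoc] at this
  -- Otherwise `v (i + 4)`, which is adjacent to `v i`, would be adjacent to `v (i + 2)`.
  have hne : v i ≠ v (i + 2) := fun hii => by
    have e1 := hv (i + 4)
    have e2 := hv' (i + 2)
    rw [add_assoc, show (4 + 1 : Fin 5) = 0 by decide, add_zero, hii] at e1
    rw [add_assoc, show (2 + 2 : Fin 5) = 4 by decide] at e2
    exact e2 e1.symm
  exact hv' i ((SimpleGraph.mem_cliqueSet_iff.1 (hFB i)).isClique (hF1 i) h1 hne)

end Pentagon
end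

/-! ### Norm fibres and anisotropic vectors over finite fields -/

noncomputable section

variable {K : Type u} {V : Type v} [Field K] [AddCommGroup V] [Module K V] {τ : RingAut K}
  {Ψ : V →ₗ[K] V →ₛₗ[(τ : K →+* K)] K}

open NondegenerateLine

section NormFibres

theorem apply_apply_of_orderOf_eq_two (hτ : orderOf τ = 2) (x : K) : τ (τ x) = x := by
  have := pow_orderOf_eq_one τ
  rw [hτ, sq] at this
  exact congrArg (fun f : RingAut K => f x) this

/-- The number of anisotropic vectors of a diagonal Hermitian form. -/
def anisotropicCard (τ : RingAut K) {k : ℕ} (a : Fin k → K) : ℕ :=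
  Nat.card {x : Fin k → K // ∑ i, a i * (x i * τ (x i)) ≠ 0}

theorem anisotropicCard_zero (a : Fin 0 → K) : anisotropicCard τ a = 0 := by
  simp [anisotropicCard]

variable [Finite K] (hτ : orderOf τ = 2)

include hτ

/-- Over a finite field, the norm with respect to an involution is surjective onto the fixed
field, and the fibre of a nonzero element has `q + 1` elements. -/
theorem card_norm_fibre {c : K} (hc : τ c = c) (hc0 : c ≠ 0) :
    Nat.card {x : K // x * τ x = c} = Nat.card (fixedSubfield τ) + 1 := by
  have hττ := apply_apply_of_orderOf_eq_two hτ
  let t : Kˣ →* Kˣ := Units.map (τ : K →* K)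
  have ht : ∀ x : Kˣ, ((t x : Kˣ) : K) = τ x := fun x => rfl
  -- `f` is the norm and `g` sends `x` to `x / τ x`. The kernel of `g` is the unit group of the
  -- fixed field, and Hilbert 90 identifies its range with the kernel of `f`; so that kernel has
  -- `(q² - 1) / (q - 1) = q + 1` elements, and by cardinality the range of `f` is all of `g.ker`.
  let f : Kˣ →* Kˣ := MonoidHom.id Kˣ * t
  let g : Kˣ →* Kˣ := MonoidHom.id Kˣ / t
  have hf : ∀ x : Kˣ, ((f x : Kˣ) : K) = x * τ x := fun x => rfl
  have hg : ∀ x : Kˣ, g x = x / t x := fun x => rfl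
  have htt : ∀ x, t (t x) = x := fun x => Units.ext (hττ x)
  have hkerg : ∀ x, x ∈ g.ker ↔ τ x = x := fun x => by
    rw [MonoidHom.mem_ker, hg, div_eq_one, eq_comm, Units.ext_iff, ht]
  have hq := natCard_eq_natCard_fixedSubfield_sq hτ
  set q := Nat.card (fixedSubfield τ) with hqdef
  have hq2 : 2 ≤ q := Finite.one_lt_card
  have cardK : Nat.card Kˣ = q ^ 2 - 1 := by
    rw [Nat.card_units, hq]
  have cardkerg : Nat.card g.ker = q - 1 := by
    rw [hqdef, ← Nat.card_units]
    refine (Nat.card_eq_of_bijective (fun x : (fixedSubfield τ)ˣ =>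
      (⟨Units.map (fixedSubfield τ).subtype.toMonoidHom x, (hkerg _).2
        (mem_fixedSubfield.1 x.1.2)⟩ : g.ker)) ⟨fun x y hxy => ?_, fun x => ?_⟩).symm
    · have := congrArg (fun z : g.ker => ((z.1 : Kˣ) : K)) hxy
      exact Units.ext (Subtype.ext this)
    · have hx := (hkerg _).1 x.2
      refine ⟨Units.mk0 ⟨x.1.1, mem_fixedSubfield.2 hx⟩ fun h0 =>
        x.1.ne_zero (congrArg Subtype.val h0), Subtype.ext (Units.ext rfl)⟩
  have hrange : g.range = f.ker := by
    ext x
    rw [MonoidHom.mem_ker]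
    constructor
    · rintro ⟨y, rfl⟩
      refine Units.ext ?_
      rw [hf, hg, Units.val_div_eq_div_val, ht, map_div₀, hττ, Units.val_one]
      have := y.ne_zero
      have : τ y ≠ 0 := (map_ne_zero_iff _ τ.injective).2 this
      field_simp
    · intro hx
      have hx' : (x : K) * τ x = 1 := by rw [← hf, hx, Units.val_one]
      -- Explicit Hilbert 90: if `x * τ x = 1` then `x = (1 + x) / τ (1 + x)`, unless `x = -1`,
      -- which is `y / τ y` for `y = z - τ z`.
      by_cases h1 : (1 : K) + x = 0
      · obtain ⟨z, hz⟩ : ∃ z, τ z ≠ z := by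
          by_contra! hτ'
          have : τ = 1 := RingEquiv.ext hτ'
          rw [this, orderOf_one] at hτ
          exact one_ne_zero (Nat.succ_injective hτ).symm
        refine ⟨Units.mk0 (z - τ z) (sub_ne_zero.2 hz.symm), Units.ext ?_⟩
        rw [hg, Units.val_div_eq_div_val, ht, Units.val_mk0, map_sub, hττ, ← neg_sub z, div_neg,
          div_self (sub_ne_zero.2 hz.symm)]
        linear_combination -h1
      · refine ⟨Units.mk0 (1 + x) h1, Units.ext ?_⟩
        have h2 : τ ((1 : K) + x) ≠ 0 := (map_ne_zero_iff _ τ.injective).2 h1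
        rw [hg, Units.val_div_eq_div_val, ht, Units.val_mk0, div_eq_iff h2, map_add, map_one]
        linear_combination -hx'
  have hcardg : Nat.card g.ker * Nat.card g.range = q ^ 2 - 1 := by
    rw [← cardK]
    rw [← Subgroup.index_ker, Subgroup.card_mul_index]
  have hcardf : Nat.card f.ker * Nat.card f.range = q ^ 2 - 1 := by
    rw [← cardK]
    rw [← Subgroup.index_ker, Subgroup.card_mul_index]
  have hfac : q ^ 2 - 1 = (q - 1) * (q + 1) := by
    rw [mul_comm, ← Nat.sq_sub_sq, one_pow]
  have hkerf : Nat.card f.ker = q + 1 := by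
    rw [cardkerg, hrange, hfac] at hcardg
    exact Nat.eq_of_mul_eq_mul_left (by lia) hcardg
  have hrangef : f.range = g.ker := by
    have hle : f.range ≤ g.ker := by
      rintro _ ⟨y, rfl⟩
      rw [hkerg, hf, map_mul, hττ, mul_comm]
    refine Subgroup.eq_of_le_of_card_ge hle ?_
    rw [cardkerg]
    rw [hkerf, hfac, mul_comm] at hcardf
    exact (Nat.eq_of_mul_eq_mul_right (by lia) hcardf).ge
  have hcmem : Units.mk0 c hc0 ∈ f.range := by
    rw [hrangef, hkerg]
    exact hc
  obtain ⟨x₀, hx₀⟩ := hcmem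
  rw [← hkerf]
  have hx₀' : (x₀ : K) * τ x₀ = c := by rw [← hf, hx₀, Units.val_mk0]
  refine (Nat.card_eq_of_bijective (fun y : f.ker =>
    (⟨x₀ * (y.1 : K), ?_⟩ : {x : K // x * τ x = c})) ⟨fun y z hyz => ?_, fun x => ?_⟩).symm
  · have hy : ((y.1 : Kˣ) : K) * τ y.1 = 1 := by
      rw [← hf, MonoidHom.mem_ker.1 y.2, Units.val_one]
    rw [map_mul]
    linear_combination hx₀' + (x₀ : K) * τ x₀ * hy
  · have := congrArg Subtype.val hyz
    exact Subtype.ext (Units.ext (mul_left_cancel₀ x₀.ne_zero this))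
  · have hx0 : x.1 ≠ 0 := fun h0 => hc0 (by rw [← x.2, h0, zero_mul])
    refine ⟨⟨x₀⁻¹ * Units.mk0 x.1 hx0, ?_⟩, Subtype.ext ?_⟩
    · rw [MonoidHom.mem_ker, map_mul, map_inv, hx₀]
      rw [inv_mul_eq_one]
      exact Units.ext (by rw [hf, Units.val_mk0, Units.val_mk0, x.2])
    · simp

/-- Isotropic vectors are counted by the value of the form on all coordinates but the first: if it
is zero, the first coordinate must be `0`; if not, the first coordinate runs through a norm fibre of
`q + 1` elements. -/
theorem anisotropicCard_succ {k : ℕ} (a : Fin (k + 1) → K) (ha : ∀ i, τ (a i) = a i)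
    (ha0 : ∀ i, a i ≠ 0) : (anisotropicCard τ a : ℤ) =
      (Nat.card (fixedSubfield τ) : ℤ) ^ (2 * k + 2) - (Nat.card (fixedSubfield τ) : ℤ) ^ (2 * k) -
        Nat.card (fixedSubfield τ) * anisotropicCard τ (fun i => a i.succ) := by
  classical
  have := Fintype.ofFinite K
  have hττ := apply_apply_of_orderOf_eq_two hτ
  have hq := natCard_eq_natCard_fixedSubfield_sq hτ
  set q := Nat.card (fixedSubfield τ) with hqdef
  have hfun : ∀ m : ℕ, Nat.card (Fin m → K) = q ^ (2 * m) := fun m => by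
    rw [Nat.card_fun, Nat.card_fin, hq, pow_mul]
  let Q : (Fin k → K) → K := fun y => ∑ i, a i.succ * (y i * τ (y i))
  have hQ : ∀ y, τ (Q y) = Q y := fun y => by
    simp only [Q, map_sum, map_mul, hττ, ha]
    exact Finset.sum_congr rfl fun i _ => by ring
  have hfib : ∀ y, Nat.card {x : K // a 0 * (x * τ x) + Q y = 0} =
      1 + if Q y ≠ 0 then q else 0 := fun y => by
    have hequiv : ∀ x, a 0 * (x * τ x) + Q y = 0 ↔ x * τ x = -Q y / a 0 := fun x => by
      rw [eq_div_iff (ha0 0)]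
      constructor <;> intro h <;> linear_combination h
    simp only [hequiv]
    split_ifs with h
    · rw [card_norm_fibre hτ, add_comm]
      · rw [map_div₀, map_neg, hQ, ha]
      · exact div_ne_zero (neg_ne_zero.2 h) (ha0 0)
    · rw [not_not.1 h, neg_zero, zero_div, add_zero, Nat.card_eq_one_iff_unique]
      have hz : ∀ x : {x : K // x * τ x = 0}, x.1 = 0 := fun x => by
        rcases mul_eq_zero.1 x.2 with h | h
        · exact h
        · exact (map_eq_zero_iff _ τ.injective).1 h
      exact ⟨⟨fun x y => Subtype.ext ((hz x).trans (hz y).symm)⟩, ⟨⟨0, zero_mul _⟩⟩⟩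
  have hzero : Nat.card {x : Fin (k + 1) → K // ∑ i, a i * (x i * τ (x i)) = 0} =
      q ^ (2 * k) + q * anisotropicCard τ (fun i => a i.succ) := by
    have e : {x : Fin (k + 1) → K // ∑ i, a i * (x i * τ (x i)) = 0} ≃
        Σ y : Fin k → K, {x : K // a 0 * (x * τ x) + Q y = 0} :=
      { toFun := fun x => ⟨fun i => x.1 i.succ, x.1 0, by
          have hx := x.2
          rw [Fin.sum_univ_succ] at hx
          exact hx⟩
        invFun := fun p => ⟨Fin.cons p.2.1 p.1, by
          rw [Fin.sum_univ_succ]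
          simpa using p.2.2⟩
        left_inv := fun x => Subtype.ext (Fin.cons_self_tail x.1)
        right_inv := fun _ => rfl }
    rw [Nat.card_congr e, Nat.card_sigma]
    simp only [hfib]
    rw [Finset.sum_add_distrib, Finset.sum_const, Finset.card_univ, ← Nat.card_eq_fintype_card, hfun,
      smul_eq_mul, mul_one, ← Finset.sum_filter, Finset.sum_const, smul_eq_mul, mul_comm q,
      anisotropicCard, Nat.card_eq_fintype_card, Fintype.card_subtype]
  have htot := Nat.card_congr (Equiv.sumCompl
    (fun x : Fin (k + 1) → K => ∑ i, a i * (x i * τ (x i)) = 0))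
  rw [Nat.card_sum, hzero, hfun] at htot
  have : q ^ (2 * k) + q * anisotropicCard τ (fun i => a i.succ) + anisotropicCard τ a =
      q ^ (2 * k + 2) := htot
  zify at this
  linarith

theorem anisotropicCard_two (a : Fin 2 → K) (ha : ∀ i, τ (a i) = a i)
    (ha0 : ∀ i, a i ≠ 0) : (anisotropicCard τ a : ℤ) =
      ((Nat.card (fixedSubfield τ) : ℤ) ^ 2 - Nat.card (fixedSubfield τ)) * (Nat.card K - 1) := by
  rw [anisotropicCard_succ hτ a ha ha0, anisotropicCard_succ hτ _ (fun i => ha _) (fun i => ha0 _),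
    anisotropicCard_zero, natCard_eq_natCard_fixedSubfield_sq hτ]
  push_cast
  ring

theorem anisotropicCard_three (a : Fin 3 → K) (ha : ∀ i, τ (a i) = a i)
    (ha0 : ∀ i, a i ≠ 0) : (anisotropicCard τ a : ℤ) =
      ((Nat.card (fixedSubfield τ) : ℤ) ^ 4 - Nat.card (fixedSubfield τ) ^ 3 +
        Nat.card (fixedSubfield τ) ^ 2) * (Nat.card K - 1) := by
  rw [anisotropicCard_succ hτ a ha ha0, anisotropicCard_two hτ _ (fun i => ha _) (fun i => ha0 _),
    natCard_eq_natCard_fixedSubfield_sq hτ]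
  push_cast
  ring

end NormFibres
end

/-! ### Counting non-degenerate lines -/

noncomputable section

variable {K : Type u} {V : Type v} [Field K] [AddCommGroup V] [Module K V] {τ : RingAut K}
  {Ψ : V →ₗ[K] V →ₛₗ[(τ : K →+* K)] K}

open NondegenerateLine

theorem finite_nondegenerateLine [Finite K] [Module.Finite K V] :
    Finite (NondegenerateLine Ψ) := by
  have : Finite V := Module.finite_of_finite K
  have : Finite (Submodule K V) :=
    Finite.of_injective (fun S => (S : Set V)) SetLike.coe_injective
  exact Subtype.finite

section CliqueLines

variable (h : IsUnitary Ψ) {s : Finset (NondegenerateLine Ψ)}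
  (hs : (orthogonalityGraph h).IsClique (s : Set (NondegenerateLine Ψ)))

theorem orthogonalPart_eq_zero_iff {w : V} : orthogonalPart Ψ s w = 0 ↔
    w = ∑ S : s, (Ψ w S.1.vec / Ψ S.1.vec S.1.vec) • S.1.vec := by
  rw [orthogonalPart, sub_eq_zero,
    Finset.sum_coe_sort s fun S => (Ψ w S.vec / Ψ S.vec S.vec) • S.vec]

include hs

theorem apply_sum_smul_vec (x : s → K) (T : s) :
    Ψ (∑ S : s, x S • S.1.vec) T.1.vec = x T * Ψ T.1.vec T.1.vec := by
  simp only [map_sum, LinearMap.sum_apply, map_smul, LinearMap.smul_apply, smul_eq_mul]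
  refine Finset.sum_eq_single T (fun S _ hST => ?_) fun hT => absurd (Finset.mem_univ T) hT
  rw [(orthogonalityGraph_adj_iff h).1 (hs S.2 T.2 fun h' => hST (Subtype.ext h')), mul_zero]

theorem apply_sum_smul_vec_self (x : s → K) :
    Ψ (∑ S : s, x S • S.1.vec) (∑ S : s, x S • S.1.vec) =
      ∑ S : s, Ψ S.1.vec S.1.vec * (x S * τ (x S)) := by
  conv_lhs => rw [map_sum]
  refine Finset.sum_congr rfl fun T _ => ?_
  rw [map_smulₛₗ, apply_sum_smul_vec h hs, smul_eq_mul]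
  change τ (x T) * _ = _
  ring

/-- The lines in the span of a clique, each with its nonzero scalars, correspond to the
anisotropic vectors of the diagonal form of the clique. -/
theorem natCard_lines_mul_natCard_units :
    Nat.card {T : NondegenerateLine Ψ // orthogonalPart Ψ s T.vec = 0} * Nat.card Kˣ =
      Nat.card {x : s → K // ∑ S : s, Ψ S.1.vec S.1.vec * (x S * τ (x S)) ≠ 0} := by
  rw [← Nat.card_prod]
  have key : ∀ p : {T : NondegenerateLine Ψ // orthogonalPart Ψ s T.vec = 0} × Kˣ,
      ∑ S : s, ((p.2 : K) * (Ψ p.1.1.vec S.1.vec / Ψ S.1.vec S.1.vec)) • S.1.vec =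
        (p.2 : K) • p.1.1.vec := fun p => by
    simp only [mul_smul]
    rw [← Finset.smul_sum, ← orthogonalPart_eq_zero_iff.1 p.1.2]
  refine Nat.card_eq_of_bijective
    (fun p => ⟨fun S => (p.2 : K) * (Ψ p.1.1.vec S.1.vec / Ψ S.1.vec S.1.vec), ?_⟩)
    ⟨fun p p' hpp => ?_, fun x => ?_⟩
  · rw [← apply_sum_smul_vec_self h hs, key, map_smulₛₗ, map_smul, LinearMap.smul_apply]
    exact smul_ne_zero ((map_ne_zero_iff _ τ.injective).2 p.2.ne_zero)
      (smul_ne_zero p.2.ne_zero p.1.1.vec_ne)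
  · have hv : (p.2 : K) • p.1.1.vec = (p'.2 : K) • p'.1.1.vec := by
      rw [← key, ← key]
      exact Finset.sum_congr rfl fun S _ =>
        congrArg (fun c : K => c • S.1.vec) (congrFun (congrArg Subtype.val hpp) S)
    have hT : p.1 = p'.1 := Subtype.ext <| by
      rw [← p.1.1.mk_vec, ← p'.1.1.mk_vec]
      refine mk_eq_mk _ _ ((p.2 : K)⁻¹ * p'.2) ?_
      rw [mul_smul, ← hv, inv_smul_smul₀ p.2.ne_zero]
    refine Prod.ext hT (Units.ext ?_)
    rw [hT] at hv
    exact smul_left_injective K (fun h0 => p'.1.1.vec_ne (by rw [h0, map_zero])) hv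
  · have hz : Ψ (∑ S : s, x.1 S • S.1.vec) (∑ S : s, x.1 S • S.1.vec) ≠ 0 := by
      rw [apply_sum_smul_vec_self h hs]
      exact x.2
    obtain ⟨c, hc⟩ := exists_smul_of_mk_eq hz (mk _ hz).vec_ne (mk_vec _).symm
    have hc0 : c ≠ 0 := by
      rintro rfl
      rw [hc, zero_smul, map_zero] at hz
      exact hz rfl
    have hx : ∀ S : s, c * (Ψ (mk _ hz).vec S.1.vec / Ψ S.1.vec S.1.vec) = x.1 S := fun S => by
      have := apply_sum_smul_vec h hs x.1 S
      rw [hc, map_smul, LinearMap.smul_apply, smul_eq_mul] at this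
      rw [← mul_div_assoc, this, mul_div_cancel_right₀ _ S.1.vec_ne]
    refine ⟨(⟨mk _ hz, orthogonalPart_eq_zero_iff.2 ?_⟩, Units.mk0 c hc0),
      Subtype.ext (funext hx)⟩
    refine smul_right_injective V hc0 ?_
    simp only
    rw [← hc, Finset.smul_sum]
    exact Finset.sum_congr rfl fun S _ => by rw [smul_smul, hx]

theorem exists_natCard_lines_mul [Finite K] {k : ℕ} (hk : s.card = k) :
    ∃ a : Fin k → K, (∀ i, τ (a i) = a i) ∧ (∀ i, a i ≠ 0) ∧
      (Nat.card {T : NondegenerateLine Ψ // orthogonalPart Ψ s T.vec = 0} : ℤ) *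
        (Nat.card K - 1) = anisotropicCard τ a := by
  let e : s ≃ Fin k := s.equivFinOfCardEq hk
  refine ⟨fun i => Ψ (e.symm i).1.vec (e.symm i).1.vec, fun i => h.apply_self _,
    fun i => (e.symm i).1.vec_ne, ?_⟩
  have h1 := natCard_lines_mul_natCard_units h hs
  rw [Nat.card_units] at h1
  have h2 : Nat.card {x : s → K // ∑ S : s, Ψ S.1.vec S.1.vec * (x S * τ (x S)) ≠ 0} =
      anisotropicCard τ fun i => Ψ (e.symm i).1.vec (e.symm i).1.vec := by
    refine Nat.card_congr ((e.arrowCongr (Equiv.refl K)).subtypeEquiv fun x => ?_)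
    rw [← e.symm.sum_comp fun S : s => Ψ S.1.vec S.1.vec * (x S * τ (x S))]
    rfl
  rw [← h2, ← h1]
  have : 1 ≤ Nat.card K := Nat.card_pos
  push_cast [this]
  ring

theorem natCard_lines_of_card_eq_two [Finite K] (hk : s.card = 2) :
    (Nat.card {T : NondegenerateLine Ψ // orthogonalPart Ψ s T.vec = 0} : ℤ) =
      (Nat.card (fixedSubfield τ) : ℤ) ^ 2 - Nat.card (fixedSubfield τ) := by
  obtain ⟨a, ha, ha0, hcard⟩ := exists_natCard_lines_mul h hs hk
  rw [anisotropicCard_two h.orderOf_eq_two a ha ha0] at hcard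
  have : 1 < Nat.card K := Finite.one_lt_card
  exact mul_right_cancel₀ (by lia) hcard

theorem natCard_lines_of_card_eq_three [Finite K] (hk : s.card = 3) :
    (Nat.card {T : NondegenerateLine Ψ // orthogonalPart Ψ s T.vec = 0} : ℤ) =
      (Nat.card (fixedSubfield τ) : ℤ) ^ 4 - Nat.card (fixedSubfield τ) ^ 3 +
        Nat.card (fixedSubfield τ) ^ 2 := by
  obtain ⟨a, ha, ha0, hcard⟩ := exists_natCard_lines_mul h hs hk
  rw [anisotropicCard_three h.orderOf_eq_two a ha ha0] at hcard
  have : 1 < Nat.card K := Finite.one_lt_card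
  exact mul_right_cancel₀ (by lia) hcard

/-- All lines lie in the span of a frame. -/
theorem natCard_lines_of_card_eq_finrank [Module.Finite K V]
    (hcard : s.card = Module.finrank K V) :
    Nat.card {T : NondegenerateLine Ψ // orthogonalPart Ψ s T.vec = 0} =
      Nat.card (NondegenerateLine Ψ) :=
  Nat.card_congr (Equiv.subtypeUnivEquiv fun _ => eq_zero_of_forall_apply_eq_zero h hs hcard
    fun _ hS => apply_orthogonalPart h hs _ hS)

end CliqueLines

section Counting

variable (h : IsUnitary Ψ)

include h

theorem natCard_nondegenerateLine_of_finrank_eq_two [Finite K] (hn : Module.finrank K V = 2) :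
    (Nat.card (NondegenerateLine Ψ) : ℤ) =
      (Nat.card (fixedSubfield τ) : ℤ) ^ 2 - Nat.card (fixedSubfield τ) := by
  have : Module.Finite K V := Module.finite_of_finrank_pos (by lia)
  obtain ⟨F, hF, -⟩ := exists_mem_cliqueSet h (s := ∅) (by simp) hn
  rw [SimpleGraph.mem_cliqueSet_iff] at hF
  rw [← natCard_lines_of_card_eq_finrank h hF.isClique (hF.card_eq.trans hn.symm),
    natCard_lines_of_card_eq_two h hF.isClique hF.card_eq]

theorem natCard_nondegenerateLine_of_finrank_eq_three [Finite K] (hn : Module.finrank K V = 3) :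
    (Nat.card (NondegenerateLine Ψ) : ℤ) =
      (Nat.card (fixedSubfield τ) : ℤ) ^ 4 - Nat.card (fixedSubfield τ) ^ 3 +
        Nat.card (fixedSubfield τ) ^ 2 := by
  have : Module.Finite K V := Module.finite_of_finrank_pos (by lia)
  obtain ⟨F, hF, -⟩ := exists_mem_cliqueSet h (s := ∅) (by simp) hn
  rw [SimpleGraph.mem_cliqueSet_iff] at hF
  rw [← natCard_lines_of_card_eq_finrank h hF.isClique (hF.card_eq.trans hn.symm),
    natCard_lines_of_card_eq_three h hF.isClique hF.card_eq]

/-- In dimension three, the lines orthogonal to a given one are the same in number as the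
lines spanned by an orthogonal pair. -/
theorem natCard_neighbors [Finite K] (hn : Module.finrank K V = 3) (S : NondegenerateLine Ψ) :
    (Nat.card {T // (orthogonalityGraph h).Adj S T} : ℤ) =
      (Nat.card (fixedSubfield τ) : ℤ) ^ 2 - Nat.card (fixedSubfield τ) := by
  classical
  have : Module.Finite K V := Module.finite_of_finrank_pos (by lia)
  obtain ⟨F, hF, hSF⟩ := exists_mem_cliqueSet h (isClique_singleton h S) hn
  rw [Finset.singleton_subset_iff] at hSF
  rw [SimpleGraph.mem_cliqueSet_iff] at hF
  have hcl : (orthogonalityGraph h).IsClique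
      ((F.erase S : Finset (NondegenerateLine Ψ)) : Set (NondegenerateLine Ψ)) :=
    hF.isClique.subset (Finset.coe_subset.2 (Finset.erase_subset _ _))
  have hadj : ∀ R ∈ F.erase S, Ψ R.vec S.vec = 0 := fun R hR =>
    (orthogonalityGraph_adj_iff h).1
      (hF.isClique (Finset.mem_of_mem_erase hR) hSF (Finset.ne_of_mem_erase hR))
  rw [← natCard_lines_of_card_eq_two h hcl (by rw [Finset.card_erase_of_mem hSF, hF.card_eq])]
  refine congrArg _ (Nat.card_congr (Equiv.subtypeEquivRight fun T => ?_))
  -- The part of `T.vec` outside the span of the other two lines of the frame is orthogonal to these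
  -- lines, so it vanishes exactly when it is orthogonal to `S`; and its pairing with `S` is that of
  -- `T.vec`.
  have hpart : Ψ (orthogonalPart Ψ (F.erase S) T.vec) S.vec = Ψ T.vec S.vec := by
    rw [orthogonalPart, map_sub, LinearMap.sub_apply, map_sum, LinearMap.sum_apply,
      Finset.sum_eq_zero, sub_zero]
    intro R hR
    rw [map_smul, LinearMap.smul_apply, hadj R hR, smul_zero]
  rw [SimpleGraph.adj_comm, orthogonalityGraph_adj_iff, ← hpart]
  refine ⟨fun h0 => eq_zero_of_forall_apply_eq_zero h hF.isClique (hF.card_eq.trans hn.symm)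
    fun R hR => ?_, fun h0 => by rw [h0, map_zero, LinearMap.zero_apply]⟩
  by_cases hRS : R = S
  · rwa [hRS]
  · exact apply_orthogonalPart h hcl _ (Finset.mem_erase.2 ⟨hRS, hR⟩)

end Counting
end

/-! ### Counting flags and frames; the number of circles -/

noncomputable section

section Flags

variable {α : Type v} [Finite α] {B : Set (Finset α)}

/-- One side of a double count. Counting the same flags by their vertices relates the number of
frames to the number of lines. -/
theorem natCard_flags_of_card_eq {n : ℕ} (hB : ∀ F ∈ B, F.card = n) :
    Nat.card {p : B × α // p.2 ∈ p.1.1} = n * Nat.card B := by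
  have := Fintype.ofFinite B
  rw [Nat.card_congr (Equiv.subtypeProdEquivSigmaSubtype fun (F : B) a => a ∈ F.1), Nat.card_sigma,
    Finset.sum_congr rfl fun F _ => (Nat.card_eq_finsetCard F.1).trans (hB F.1 F.2),
    Finset.sum_const, Finset.card_univ, Nat.card_eq_fintype_card, smul_eq_mul, mul_comm]

theorem natCard_flags_of_natCard_eq {d : ℕ} (hd : ∀ a : α, Nat.card {F : B // a ∈ F.1} = d) :
    Nat.card {p : B × α // p.2 ∈ p.1.1} = d * Nat.card α := by
  have := Fintype.ofFinite α
  let e : {p : B × α // p.2 ∈ p.1.1} ≃ {p : α × B // p.1 ∈ p.2.1} :=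
    (Equiv.prodComm B α).subtypeEquiv fun _ => Iff.rfl
  rw [Nat.card_congr (e.trans (Equiv.subtypeProdEquivSigmaSubtype fun a (F : B) => a ∈ F.1)),
    Nat.card_sigma, Finset.sum_congr rfl fun a _ => hd a, Finset.sum_const, Finset.card_univ,
    Nat.card_eq_fintype_card, smul_eq_mul, mul_comm]

end Flags

variable {K : Type u} {V : Type v} [Field K] [AddCommGroup V] [Module K V] {τ : RingAut K}
  {Ψ : V →ₗ[K] V →ₛₗ[(τ : K →+* K)] K}

open NondegenerateLine PreAbstractSimplicialComplex

section Counting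

variable (h : IsUnitary Ψ)

theorem natCard_frames_containing_of_finrank_eq_two (hn : Module.finrank K V = 2)
    (S : NondegenerateLine Ψ) :
    Nat.card {F : (orthogonalityGraph h).cliqueSet 2 // S ∈ F.1} = 1 := by
  have : Module.Finite K V := Module.finite_of_finrank_pos (by lia)
  obtain ⟨F, hF, hSF⟩ := exists_mem_cliqueSet h (isClique_singleton h S) hn
  rw [Finset.singleton_subset_iff] at hSF
  rw [Nat.card_eq_one_iff_unique]
  exact ⟨⟨fun F F' => Subtype.ext (Subtype.ext
    (eq_of_mem_of_finrank_eq_two h hn F.1.2 F'.1.2 F.2 F'.2))⟩, ⟨⟨⟨F, hF⟩, hSF⟩⟩⟩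

theorem natCard_frames_of_finrank_eq_two [Finite K] (hn : Module.finrank K V = 2) :
    (2 * Nat.card ((orthogonalityGraph h).cliqueSet 2) : ℤ) =
      (Nat.card (fixedSubfield τ) : ℤ) ^ 2 - Nat.card (fixedSubfield τ) := by
  have : Module.Finite K V := Module.finite_of_finrank_pos (by lia)
  have : Finite (NondegenerateLine Ψ) := finite_nondegenerateLine
  rw [← natCard_nondegenerateLine_of_finrank_eq_two h hn]
  have h1 := natCard_flags_of_card_eq (B := (orthogonalityGraph h).cliqueSet 2)
    fun F hF => (SimpleGraph.mem_cliqueSet_iff.1 hF).card_eq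
  rw [natCard_flags_of_natCard_eq (natCard_frames_containing_of_finrank_eq_two h hn)] at h1
  lia

/-- In dimension three, the frames that contain a line partition its neighbours into pairs. -/
theorem natCard_frames_containing_of_finrank_eq_three [Finite K] (hn : Module.finrank K V = 3)
    (S : NondegenerateLine Ψ) :
    (2 * Nat.card {F : (orthogonalityGraph h).cliqueSet 3 // S ∈ F.1} : ℤ) =
      (Nat.card (fixedSubfield τ) : ℤ) ^ 2 - Nat.card (fixedSubfield τ) := by
  classical
  have : Module.Finite K V := Module.finite_of_finrank_pos (by lia)
  have : Finite (NondegenerateLine Ψ) := finite_nondegenerateLine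
  have := Fintype.ofFinite {F : (orthogonalityGraph h).cliqueSet 3 // S ∈ F.1}
  rw [← natCard_neighbors h hn S]
  have hcard : ∀ F : {F : (orthogonalityGraph h).cliqueSet 3 // S ∈ F.1},
      Nat.card (F.1.1.erase S) = 2 := fun F => by
    rw [Nat.card_eq_fintype_card, Fintype.card_coe, Finset.card_erase_of_mem F.2,
      (SimpleGraph.mem_cliqueSet_iff.1 F.1.2).card_eq]
  have hbij : Nat.card (Σ F : {F : (orthogonalityGraph h).cliqueSet 3 // S ∈ F.1},
      (F.1.1.erase S : Finset (NondegenerateLine Ψ))) =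
      Nat.card {T // (orthogonalityGraph h).Adj S T} := by
    refine Nat.card_eq_of_bijective (fun p => ⟨p.2.1,
      (SimpleGraph.mem_cliqueSet_iff.1 p.1.1.2).isClique p.1.2 (Finset.mem_of_mem_erase p.2.2)
        (Finset.ne_of_mem_erase p.2.2).symm⟩) ⟨?_, fun T => ?_⟩
    · rintro ⟨F, T, hT⟩ ⟨F', T', hT'⟩ hTT
      obtain rfl : T = T' := congrArg Subtype.val hTT
      obtain rfl : F = F' := Subtype.ext (Subtype.ext (eq_of_mem_of_finrank_eq_three h hn F.1.2
        F'.1.2 (Finset.ne_of_mem_erase hT) (Finset.mem_of_mem_erase hT) F.2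
        (Finset.mem_of_mem_erase hT') F'.2))
      rfl
    · have hcl : (orthogonalityGraph h).IsClique
          (({S, T.1} : Finset (NondegenerateLine Ψ)) : Set (NondegenerateLine Ψ)) := by
        rw [Finset.coe_pair]
        exact SimpleGraph.isClique_pair.2 fun _ => T.2
      obtain ⟨F, hF, hsub⟩ := exists_mem_cliqueSet h hcl hn
      exact ⟨⟨⟨⟨F, hF⟩, hsub (by simp)⟩, ⟨T.1, Finset.mem_erase.2 ⟨T.2.ne.symm, hsub (by simp)⟩⟩⟩,
        rfl⟩
  rw [← hbij, Nat.card_sigma, Finset.sum_congr rfl fun F _ => hcard F, Finset.sum_const,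
    Finset.card_univ, Nat.card_eq_fintype_card, smul_eq_mul]
  push_cast
  ring

theorem natCard_frames_of_finrank_eq_three [Finite K] (hn : Module.finrank K V = 3) :
    (6 * Nat.card ((orthogonalityGraph h).cliqueSet 3) : ℤ) =
      ((Nat.card (fixedSubfield τ) : ℤ) ^ 2 - Nat.card (fixedSubfield τ)) *
        Nat.card (NondegenerateLine Ψ) := by
  have : Module.Finite K V := Module.finite_of_finrank_pos (by lia)
  have : Finite (NondegenerateLine Ψ) := finite_nondegenerateLine
  obtain ⟨F, hF, -⟩ := exists_mem_cliqueSet h (s := ∅) (by simp) hn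
  obtain ⟨S, -⟩ := Finset.card_pos.1
    (by rw [(SimpleGraph.mem_cliqueSet_iff.1 hF).card_eq]; lia : 0 < F.card)
  have hS := natCard_frames_containing_of_finrank_eq_three h hn S
  have hd : ∀ T, Nat.card {F : (orthogonalityGraph h).cliqueSet 3 // T ∈ F.1} =
      Nat.card {F : (orthogonalityGraph h).cliqueSet 3 // S ∈ F.1} := fun T => by
    have := natCard_frames_containing_of_finrank_eq_three h hn T
    have h2 := hS.trans this.symm
    lia
  have h1 := natCard_flags_of_card_eq (B := (orthogonalityGraph h).cliqueSet 3)
    fun F hF => (SimpleGraph.mem_cliqueSet_iff.1 hF).card_eq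
  rw [natCard_flags_of_natCard_eq hd] at h1
  rw [← hS]
  zify at h1
  linear_combination -2 * h1

/-- The first Betti number of the frame complex of a three-dimensional unitary space over a finite
field. -/
theorem natCard_nontree [Finite K] (hn : Module.finrank K V = 3)
    (T : RootedTree ((orthogonalityGraph h).cliqueSet 3)) :
    Finite T.Nontree ∧ (3 * Nat.card T.Nontree : ℤ) =
      (Nat.card (fixedSubfield τ) : ℤ) ^ 6 - 2 * (Nat.card (fixedSubfield τ) : ℤ) ^ 5
        - (Nat.card (fixedSubfield τ) : ℤ) ^ 4 + 2 * (Nat.card (fixedSubfield τ) : ℤ) ^ 3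
        - 3 * (Nat.card (fixedSubfield τ) : ℤ) ^ 2 + 3 := by
  have : Module.Finite K V := Module.finite_of_finrank_pos (by lia)
  have : Finite (NondegenerateLine Ψ) := finite_nondegenerateLine
  obtain ⟨hfin, hcard⟩ := T.card_nontree
  refine ⟨hfin, ?_⟩
  rw [natCard_flags_of_card_eq fun F hF => (SimpleGraph.mem_cliqueSet_iff.1 hF).card_eq] at hcard
  have h6 := natCard_frames_of_finrank_eq_three h hn
  rw [natCard_nondegenerateLine_of_finrank_eq_three h hn] at h6
  have hN := natCard_nondegenerateLine_of_finrank_eq_three h hn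
  zify at hcard
  -- With `f` frames and `N` lines there are `3f` flags and `N + f` nodes, hence `2f - N + 1` flags
  -- outside the tree; and `6f = (q² - q) N`.
  linear_combination 3 * hcard + h6 - 3 * hN

end Counting
end

/-! ### Assembly of the three cases -/

noncomputable section

variable {K : Type u} {V : Type v} [Field K] [AddCommGroup V] [Module K V] {τ : RingAut K}
  {Ψ : V →ₗ[K] V →ₛₗ[(τ : K →+* K)] K}

open NondegenerateLine PreAbstractSimplicialComplex

section Main

variable (h : IsUnitary Ψ)

include h

theorem finite_and_natCard_fixedSubfield_eq {q : ℕ} (hq : q ≠ 0) (hK : Nat.card K = q ^ 2) :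
    Finite K ∧ Nat.card (fixedSubfield τ) = q := by
  refine ⟨Nat.finite_of_card_ne_zero (by rw [hK]; exact pow_ne_zero 2 hq), ?_⟩
  rw [natCard_eq_natCard_fixedSubfield_sq h.orderOf_eq_two] at hK
  exact Nat.pow_left_injective two_ne_zero hK

theorem nonempty_rootedTree (hn : Module.finrank K V = 3) (hK : Nat.card K ≠ 4) :
    Nonempty (RootedTree ((orthogonalityGraph h).cliqueSet 3)) := by
  have : Module.Finite K V := Module.finite_of_finrank_pos (by lia)
  obtain ⟨F, hF, -⟩ := exists_mem_cliqueSet h (s := ∅) (by simp) hn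
  obtain ⟨S, -⟩ := Finset.card_pos.1
    (by rw [(SimpleGraph.mem_cliqueSet_iff.1 hF).card_eq]; lia : 0 < F.card)
  have : Nonempty (NondegenerateLine Ψ) := ⟨S⟩
  refine RootedTree.nonempty_of_connected (connected_incidenceGraph (fun F hF => ?_)
    (reflTransGen_mem_cliqueSet h hn hK))
  exact Finset.card_pos.1 (by rw [(SimpleGraph.mem_cliqueSet_iff.1 hF).card_eq]; lia)

/-- The wedge is not a point: over an infinite field because of the pentagon, over a finite one
because the count is positive once the fixed field has at least three elements. -/
theorem nonempty_nontree (hn : Module.finrank K V = 3) (hK : Nat.card K ≠ 4)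
    (T : RootedTree ((orthogonalityGraph h).cliqueSet 3)) : Nonempty T.Nontree := by
  rcases finite_or_infinite K with hfin | hinf
  · obtain ⟨hT, hcard⟩ := natCard_nontree h hn T
    have hsq := natCard_eq_natCard_fixedSubfield_sq h.orderOf_eq_two
    have h2 : 1 < Nat.card (fixedSubfield τ) := Finite.one_lt_card
    have h3 : 3 ≤ Nat.card (fixedSubfield τ) := by
      by_contra! hlt
      rw [show Nat.card (fixedSubfield τ) = 2 by lia] at hsq
      exact hK hsq
    refine (Nat.card_pos_iff.1 ?_).1
    -- After substituting `q = 3 + m` the polynomial has only nonnegative coefficients and a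
    -- positive constant term.
    obtain ⟨m, hm⟩ := Nat.exists_eq_add_of_le h3
    rw [hm] at hcard
    have hpos : (0 : ℤ) < 3 * Nat.card T.Nontree := by
      rw [hcard]
      push_cast
      ring_nf
      positivity
    lia
  · exact nonempty_nontree_of_infinite h hn T

/-- For `q = 2` the number `(q² - q) / 2` of frames through a line equals `1`. -/
theorem eq_of_mem_of_natCard_eq_four (hn : Module.finrank K V = 3) (hK : Nat.card K = 2 ^ 2) :
    ∀ F ∈ (orthogonalityGraph h).cliqueSet 3, ∀ F' ∈ (orthogonalityGraph h).cliqueSet 3,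
      ∀ a, a ∈ F → a ∈ F' → F = F' := by
  obtain ⟨hfin, hq⟩ := finite_and_natCard_fixedSubfield_eq h two_ne_zero hK
  intro F hF F' hF' a ha ha'
  have hcard := natCard_frames_containing_of_finrank_eq_three h hn a
  rw [hq] at hcard
  have h1 : Nat.card {F : (orthogonalityGraph h).cliqueSet 3 // a ∈ F.1} = 1 := by
    push_cast at hcard
    lia
  have := (Nat.card_eq_one_iff_unique.1 h1).1
  have heq : (⟨⟨F, hF⟩, ha⟩ : {F : (orthogonalityGraph h).cliqueSet 3 // a ∈ F.1}) =
      ⟨⟨F', hF'⟩, ha'⟩ := Subsingleton.elim _ _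
  exact congrArg (fun G => G.1.1) heq

theorem natCard_frames_of_natCard_eq_four (hn : Module.finrank K V = 3)
    (hK : Nat.card K = 2 ^ 2) : Nat.card ((orthogonalityGraph h).cliqueSet 3) = 4 := by
  obtain ⟨hfin, hq⟩ := finite_and_natCard_fixedSubfield_eq h two_ne_zero hK
  have hcard := natCard_frames_of_finrank_eq_three h hn
  rw [natCard_nondegenerateLine_of_finrank_eq_three h hn, hq] at hcard
  push_cast at hcard
  lia

end Main

/-- `Nat.card` is `0` for infinite types, so `Nat.card K ≠ 4` admits all infinite fields, and the
finiteness of the index sets has to be asserted alongside their cardinalities. -/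
theorem proposition3p12 {K : Type u} {V : Type v} [Field K] [AddCommGroup V] [Module K V]
    {τ : RingAut K} (Ψ : V →ₗ[K] V →ₛₗ[(τ : K →+* K)] K) (h : IsUnitary Ψ) :
    (Module.finrank K V = 3 → Nat.card K ≠ 4 →
      ∃ ι : Type v, Nonempty ι ∧
        Nonempty (ContinuousMap.HomotopyEquiv (frameComplex h).Realization (WedgeOfSpheres 1 ι)) ∧
        ∀ q : ℕ, IsPrimePow q → Nat.card K = q ^ 2 →
          Finite ι ∧
          (Nat.card ι : ℚ) =
            1 / 3 * ((q : ℚ) ^ 6 - 2 * (q : ℚ) ^ 5 - (q : ℚ) ^ 4 + 2 * (q : ℚ) ^ 3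
              - 3 * (q : ℚ) ^ 2 + 3)) ∧
    (Module.finrank K V = 3 → Nat.card K = 4 →
      (∃ Y : PreAbstractSimplicialComplex (NondegenerateLine Ψ),
        (frameComplex h).Collapses Y ∧ (∀ s ∈ Y.faces, s.card = 1) ∧ Y.faces.ncard = 4) ∧
      Nonempty
        (ContinuousMap.HomotopyEquiv (frameComplex h).Realization (WedgeOfSpheres 0 (Fin 3)))) ∧
    (Module.finrank K V = 2 →
      ∃ (D : Type v) (_ : TopologicalSpace D), DiscreteTopology D ∧
        Nonempty (ContinuousMap.HomotopyEquiv (frameComplex h).Realization D) ∧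
        ∀ q : ℕ, IsPrimePow q → Nat.card K = q ^ 2 →
          Finite D ∧ (Nat.card D : ℚ) = (q : ℚ) * ((q : ℚ) - 1) / 2) := by
  refine ⟨fun hn hK => ?_, fun hn hK => ?_, fun hn => ?_⟩
  · obtain ⟨T⟩ := nonempty_rootedTree h hn hK
    refine ⟨T.Nontree, nonempty_nontree h hn hK T,
      (isBlockSystem_frameComplex h hn (Or.inr rfl)).nonempty_homotopyEquiv_wedge T,
      fun q hq hKq => ?_⟩
    obtain ⟨hfin, hcq⟩ := finite_and_natCard_fixedSubfield_eq h hq.ne_zero hKq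
    obtain ⟨hT, hcard⟩ := natCard_nontree h hn T
    refine ⟨hT, ?_⟩
    rw [hcq] at hcard
    have hcard' := congrArg (Int.cast : ℤ → ℚ) hcard
    push_cast at hcard'
    linear_combination hcard' / 3
  · have hB := isBlockSystem_frameComplex h hn (Or.inr rfl)
    have hd := eq_of_mem_of_natCard_eq_four h hn hK
    have h4 := natCard_frames_of_natCard_eq_four h hn hK
    have hfin : Finite ((orthogonalityGraph h).cliqueSet 3) :=
      Nat.finite_of_card_ne_zero (by rw [h4]; exact four_ne_zero)
    constructor
    · obtain ⟨Y, hY, hY1, hY4⟩ := hB.exists_collapses hd (Set.toFinite _)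
        fun F hF => (SimpleGraph.mem_cliqueSet_iff.1 hF).card_eq
      exact ⟨Y, hY, hY1, hY4.trans h4⟩
    · let : TopologicalSpace ((orthogonalityGraph h).cliqueSet 3) := ⊥
      have : DiscreteTopology ((orthogonalityGraph h).cliqueSet 3) := ⟨rfl⟩
      obtain ⟨e⟩ := hB.nonempty_homotopyEquiv_discrete hd
      have hw := discreteTopology_wedgeOfSpheres_zero (Fin 3)
      have hw4 := card_wedgeOfSpheres_zero (Fin 3)
      rw [Nat.card_fin] at hw4
      have : Finite (WedgeOfSpheres 0 (Fin 3)) :=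
        Nat.finite_of_card_ne_zero (by rw [hw4]; exact four_ne_zero)
      -- Both spaces are discrete with four points, the wedge having its base point and one further
      -- point for each sphere, so any bijection is a homeomorphism.
      let f : (orthogonalityGraph h).cliqueSet 3 ≃ WedgeOfSpheres 0 (Fin 3) :=
        (Finite.equivFinOfCardEq h4).trans (Finite.equivFinOfCardEq hw4).symm
      exact ⟨e.trans (f.toHomeomorphOfDiscrete).toHomotopyEquiv⟩
  · let : TopologicalSpace ((orthogonalityGraph h).cliqueSet 2) := ⊥
    have : DiscreteTopology ((orthogonalityGraph h).cliqueSet 2) := ⟨rfl⟩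
    refine ⟨(orthogonalityGraph h).cliqueSet 2, ⊥, ⟨rfl⟩,
      (isBlockSystem_frameComplex h hn (Or.inl rfl)).nonempty_homotopyEquiv_discrete
        fun F hF F' hF' a => eq_of_mem_of_finrank_eq_two h hn hF hF', fun q hq hKq => ?_⟩
    obtain ⟨hfin, hcq⟩ := finite_and_natCard_fixedSubfield_eq h hq.ne_zero hKq
    have : Module.Finite K V := Module.finite_of_finrank_pos (by lia)
    have : Finite (NondegenerateLine Ψ) := finite_nondegenerateLine
    refine ⟨inferInstance, ?_⟩
    have hcard := congrArg (Int.cast : ℤ → ℚ) (natCard_frames_of_finrank_eq_two h hn)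
    rw [hcq] at hcard
    push_cast at hcard
    linear_combination hcard / 2

end
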